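/- Let $N\in\mathbb{N}$, $2\le p<N$, $p^*=\frac{Np}{N-p}$, and let $T\ge 1$ be an integer. Regard $\mathbb{Z}^N$ as a graph with $x\sim y$ iff $\sum_{i=1}^N|x_i-y_i|=1$, and put $$\Delta_p u(x)=\sum_{y\sim x}|u(y)-u(x)|^{p-2}(u(y)-u(x)).$$ Let $V:\mathbb{Z}^N\to\mathbb{R}$ and $f:\mathbb{Z}^N\times\mathbb{R}\to\mathbb{R}$ satisfy: - $V(x)$ and $f(x,t)$ are $T$-periodic in each coordinate of $x$, and $\inf_{x}V(x)\ge 0$; - $t\mapsto f(x,t)$ is continuous for every $x$, and there are $a>0$ and $q>p^*$ with $f(x,t)\le a(1+|t|^{q-1})$ for all $x,t$; - $f(x,t)=o(|t|^{p^*-1})$ as $|t|\to0$, uniformly in $x$; - for every $x$ the function $t\mapsto f(x,t)/|t|^{p-1}$ is strictly increasing on $(-\infty,0)\cup(0,\infty)$; - $F(x,t)/|t|^p\to\infty$ as $|t|\to\infty$, uniformly in $x$, where $F(x,t)=\int_0^t f(x,s)\,ds$; - $f(x,-t)=-f(x,t)$ for all $x,t$. Let $E$ be the completion of the space of finitely supported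 functions $u:\mathbb{Z}^N\to\mathbb{R}$ with respect to the norm $$\|u\|=\Big(\tfrac12\sum_{x\sim y}|u(y)-u(x)|^p+\sum_{x}V(x)|u(x)|^p\Big)^{1/p}$$ (the first sum runs over ordered pairs), realised as a space of functions on $\mathbb{Z}^N$: $u\in E$ iff there are finitely supported $\varphi_n$ with $\varphi_n\to u$ pointwise and $\|\varphi_n-u\|\to0$. Then the equation $$-\Delta_p u(x)+V(x)|u(x)|^{p-2}u(x)=f(x,u(x)),\quad x\in\mathbb{Z}^N,\qquad u\in E,$$ has infinitely many geometrically distinct solutions: there is an infinite set of solutions such that for any two distinct members $u,v$ the orbits $\mathcal{O}(u)$ and $\mathcal{O}(v)$ are disjoint, where $\mathcal{O}(u)=\{u(\cdot-kT):k\in\mathbb{Z}^N\}$. -/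

import Mathlib

open Filter Topology

noncomputable section

/-- The integer lattice graph: `x` and `y` are joined by an edge iff `∑ i, |x i - y i| = 1`. -/
def latticeGraph (N : ℕ) : SimpleGraph (Fin N → ℤ) where
  Adj x y := ∑ i, |x i - y i| = 1
  symm := ⟨fun x y h => by simpa only [abs_sub_comm] using h⟩
  loopless := ⟨fun x h => by simp at h⟩

theorem latticeGraph_neighborSet_finite (N : ℕ) (x : Fin N → ℤ) :
    ((latticeGraph N).neighborSet x).Finite := by
  refine (Set.finite_Icc (x - 1) (x + 1)).subset fun y hy => ?_
  have hy' : ∑ i, |x i - y i| = 1 := hy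
  have h : ∀ i, |x i - y i| ≤ 1 := fun i => by
    rw [← hy']
    exact Finset.single_le_sum (f := fun i => |x i - y i|)
      (fun j _ => abs_nonneg _) (Finset.mem_univ i)
  constructor <;> intro i <;> have := abs_le.1 (h i) <;>
    simp only [Pi.sub_apply, Pi.add_apply, Pi.one_apply] <;> omega

instance latticeGraph_locallyFinite (N : ℕ) : (latticeGraph N).LocallyFinite :=
  fun x => (latticeGraph_neighborSet_finite N x).fintype

variable {𝕍 : Type*}

/-- The discrete `p`-Laplacian of `u` at the vertex `x`. -/
def pLaplacian (G : SimpleGraph 𝕍) [G.LocallyFinite] (p : ℝ) (u : 𝕍 → ℝ) (x : 𝕍) : ℝ :=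
  ∑ y ∈ G.neighborFinset x, |u y - u x| ^ (p - 2) * (u y - u x)

/-- The norm
`‖u‖ = (∑_{x ∼ y} ½ |u(y) - u(x)| ^ p + ∑_x V(x) |u(x)| ^ p) ^ (1/p)` for a nonnegative potential
`V`, with value `∞` when the sums diverge. The first sum runs over ordered pairs of adjacent
vertices (darts), so that every edge is counted twice. -/
def sobolevNorm (G : SimpleGraph 𝕍) (p : ℝ) (V : 𝕍 → ℝ) (u : 𝕍 → ℝ) : ENNReal :=
  (∑' d : G.Dart, ENNReal.ofReal (1 / 2 * |u d.snd - u d.fst| ^ p) +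
    ∑' x, ENNReal.ofReal (V x * |u x| ^ p)) ^ (1 / p)

/-- The space `E(𝕍)`: the completion of the finitely supported functions in `sobolevNorm`, realised
as a space of functions on `𝕍`. Its members are the functions that are limits, both in norm and
pointwise, of a sequence of finitely supported functions. (The pointwise limit has to be prescribed
as well since for `V = 0` the norm does not see additive constants; on `ℤ^N` with `p < N` the
Sobolev inequality makes every norm-Cauchy sequence of finitely supported functions converge
pointwise.) -/
def sobolevSpace (G : SimpleGraph 𝕍) (p : ℝ) (V : 𝕍 → ℝ) : Set (𝕍 → ℝ) :=
  {u | ∃ φ : ℕ → 𝕍 → ℝ, (∀ n, (Function.support (φ n)).Finite) ∧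
    (∀ x, Tendsto (fun n => φ n x) atTop (𝓝 (u x))) ∧
    Tendsto (fun n => sobolevNorm G p V (φ n - u)) atTop (𝓝 0)}

/-- `u` solves `-Δ_p u + V |u|^{p-2} u = f(x, u)` on the graph `G`, with `u ∈ E(𝕍)`. -/
def IsSolution (G : SimpleGraph 𝕍) [G.LocallyFinite] (p : ℝ) (V : 𝕍 → ℝ) (f : 𝕍 → ℝ → ℝ)
    (u : 𝕍 → ℝ) : Prop :=
  u ∈ sobolevSpace G p V ∧
    ∀ x, -pLaplacian G p u x + V x * (|u x| ^ (p - 2) * u x) = f x (u x)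

/-- `T`-periodicity in each coordinate of a function on `ℤ^N`. -/
def IsPeriodic {N : ℕ} {α : Type*} (T : ℕ) (h : (Fin N → ℤ) → α) : Prop :=
  ∀ (x : Fin N → ℤ) (i : Fin N), h (x + Pi.single i (T : ℤ)) = h x

/-- The orbit `{u(· - kT) : k ∈ ℤ^N}`. -/
def translationOrbit {N : ℕ} (T : ℕ) (u : (Fin N → ℤ) → ℝ) : Set ((Fin N → ℤ) → ℝ) :=
  Set.range fun (k : Fin N → ℤ) (x : Fin N → ℤ) => u (x - (T : ℤ) • k)

/-- Two functions are geometrically distinct if their orbits are disjoint. -/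
def GeometricallyDistinct {N : ℕ} (T : ℕ) (u v : (Fin N → ℤ) → ℝ) : Prop :=
  Disjoint (translationOrbit T u) (translationOrbit T v)

/-- The critical Sobolev exponent `p^* = Np / (N - p)`. -/
def criticalExponent (N : ℕ) (p : ℝ) : ℝ := N * p / (N - p)

end

/-! The equation is the Euler–Lagrange equation of `J = Q / p - pot`, where `Q` is the `p`-th power
of the norm and `pot` sums the primitives of `f`. On the lattice `ℓ^r` embeds in `ℓ^∞`, so with `r =
p^*` the Sobolev inequality (`lattice_sobolev`) bounds functions uniformly in terms of `Q`. Since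
`f` is small near `0`, `pot` is dominated by `Q` on uniformly small functions (`J_ge_of_small`).
Only one-vertex variations of `J` are ever needed, and convexity inequalities supply them.

Maxima on rays and cones. In the variable `σ = s ^ p` the primitive along a ray is strictly convex,
because `f / |t| ^ (p - 1)` increases, while `Q` is linear. So each nonzero `u` has exactly one
positive multiple that maximises `J` on its ray; such functions form the Nehari set `Neh`, with
infimum of energy `level > 0`. For `a ≥ 0 ≥ b` with disjoint supports the edge forms of `a` and `b`
have equal signs. Hence `J (a + b) ≥ J a + J b`, and by Minkowski `Q (s a + t b)` is concave in `(s
^ p, t ^ p)`, so the maximum of `J` on the cone is again unique (`Compat.exists_max`,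
`Compat.max_unique`).

Compactness. By Brezis–Lieb splitting, the remainder of a minimising sequence about a nonzero limit
must vanish uniformly, since otherwise it would carry energy in addition to `level`. Hence
nonnegative almost minimisers are uniformly close to ground states (`exists_ground_close`), which
exist and are critical.

Dichotomy. If the ground states form infinitely many orbits, they are the required solutions. If
they form finitely many, the rays through distinct ground states are uniformly separated
(`exists_coneSep`). Fix a ground state `w`, take `k` outside a finite set, and minimise the cone
maximum of `J` over sign-changing pairs close, up to scaling, to `w` and to minus the translate of
`w` by `k`. The infimum lies just above `2 * level` at most. Both members of a pair of such energy,
put on the Nehari set, are then almost minimisers; they are close to ground states, and by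
separation these are `w` and its translate. So the closeness constraint holds with room to spare,
the infimum is attained in its interior (`exists_min_near`), and an envelope argument shows that the
minimiser is critical (`grad_eq_zero_of_min_near`). Positive and negative parts recover `k`, so
different `k` give different orbits. -/

/-! ### Real-variable lemmas on odd nonlinearities -/

/-- The primitive of `h` vanishing at `0`. -/
noncomputable def primitive (h : ℝ → ℝ) (t : ℝ) : ℝ := ∫ s in (0 : ℝ)..t, h s

/-- Odd continuous functions `h` with `h t / |t| ^ (p - 1)` strictly increasing. -/
structure IsPMonotone (p : ℝ) (h : ℝ → ℝ) : Prop where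
  cont : Continuous h
  odd : Function.Odd h
  mono : StrictMonoOn (fun t => h t / |t| ^ (p - 1)) (Set.Iio 0 ∪ Set.Ioi 0)

/-- Tangent-line inequality of a convex function, by the mean value theorem. It replaces
differentiation of the energy throughout. -/
theorem sub_ge_of_monotone_deriv {F f : ℝ → ℝ} (hF : ∀ t, HasDerivAt F (f t) t) (hf : Monotone f)
    (z r : ℝ) : f z * r ≤ F (z + r) - F z := by
  rcases lt_trichotomy r 0 with h | h | h
  · obtain ⟨c, hc, he⟩ := exists_hasDerivAt_eq_slope F f (show z + r < z by linarith)
      (fun x _ => (hF x).continuousAt.continuousWithinAt) (fun x _ => hF x)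
    have h1 : f c ≤ f z := hf hc.2.le
    rw [eq_div_iff (by linarith)] at he
    nlinarith
  · simp [h]
  · obtain ⟨c, hc, he⟩ := exists_hasDerivAt_eq_slope F f (show z < z + r by linarith)
      (fun x _ => (hF x).continuousAt.continuousWithinAt) (fun x _ => hF x)
    have h1 : f z ≤ f c := hf hc.1.le
    rw [eq_div_iff (by linarith)] at he
    nlinarith

namespace IsPMonotone

variable {p : ℝ} {h : ℝ → ℝ}

theorem zero (H : IsPMonotone p h) : h 0 = 0 := H.odd.map_zero

/-- Compare `-t < 0 < t`: the quotient is monotone across the origin as well, and oddness makes its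
two values opposite. -/
theorem pos (H : IsPMonotone p h) {t : ℝ} (ht : 0 < t) : 0 < h t := by
  have := H.mono (a := -t) (b := t) (Or.inl (by simpa using ht)) (Or.inr ht) (by linarith)
  simp only [abs_neg, H.odd t] at this
  have h2 : 0 < |t| ^ (p - 1) := Real.rpow_pos_of_pos (abs_pos.2 ht.ne') _
  rw [div_lt_div_iff_of_pos_right h2] at this
  linarith

theorem monotone (H : IsPMonotone p h) (hp : 1 ≤ p) : Monotone h := by
  refine monotone_of_odd_of_monotoneOn_nonneg H.odd fun s hs t ht hst => ?_
  rcases (Set.mem_Ici.1 hs).eq_or_lt with h0 | h0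
  · rw [← h0, H.zero]
    rcases (Set.mem_Ici.1 ht).eq_or_lt with h1 | h1
    · rw [← h1, H.zero]
    · exact (H.pos h1).le
  · rcases hst.eq_or_lt with h1 | h1
    · rw [h1]
    · have ht0 : 0 < t := h0.trans h1
      have := H.mono (Or.inr h0) (Or.inr ht0) h1
      simp only [abs_of_pos h0, abs_of_pos ht0] at this
      rw [div_lt_div_iff₀ (Real.rpow_pos_of_pos h0 _) (Real.rpow_pos_of_pos ht0 _)] at this
      have h3 : s ^ (p - 1) ≤ t ^ (p - 1) := Real.rpow_le_rpow h0.le h1.le (by linarith)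
      have h4 := Real.rpow_pos_of_pos h0 (p - 1)
      have h5 := H.pos ht0
      by_contra hcon
      push Not at hcon
      have : h t * s ^ (p - 1) ≤ h s * t ^ (p - 1) := by
        apply mul_le_mul hcon.le h3 h4.le; linarith
      linarith

theorem hasDerivAt (H : IsPMonotone p h) (t : ℝ) : HasDerivAt (primitive h) (h t) t :=
  (H.cont.integral_hasStrictDerivAt 0 t).hasDerivAt

theorem continuous_primitive (H : IsPMonotone p h) : Continuous (primitive h) :=
  continuous_iff_continuousAt.2 fun t => (H.hasDerivAt t).continuousAt

theorem primitive_zero (h : ℝ → ℝ) : primitive h 0 = 0 := by simp [primitive]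

theorem primitive_even (H : IsPMonotone p h) (t : ℝ) : primitive h (-t) = primitive h t := by
  unfold primitive
  have h1 := intervalIntegral.integral_comp_neg (a := t) (b := 0) h
  rw [neg_zero] at h1
  rw [← h1, intervalIntegral.integral_symm, ← intervalIntegral.integral_neg]
  simp [H.odd _]

theorem primitive_abs (H : IsPMonotone p h) (t : ℝ) : primitive h |t| = primitive h t := by
  rcases abs_choice t with h1 | h1 <;> rw [h1]
  exact H.primitive_even t

theorem primitive_nonneg (H : IsPMonotone p h) (hp : 1 ≤ p) (t : ℝ) : 0 ≤ primitive h t := by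
  have := sub_ge_of_monotone_deriv H.hasDerivAt (H.monotone hp) 0 t
  simpa [H.zero, primitive_zero] using this

theorem tangent_le (H : IsPMonotone p h) (hp : 1 ≤ p) (z r : ℝ) :
    h z * r ≤ primitive h (z + r) - primitive h z :=
  sub_ge_of_monotone_deriv H.hasDerivAt (H.monotone hp) z r

/-- The substitution `σ = s ^ p` turns the derivative into a positive constant times `h / |·| ^ (p -
1)`, which is strictly increasing. This is the only place where the monotone quotient meets
convexity. -/
theorem strictConvexOn (H : IsPMonotone p h) (hp : 1 < p) {a : ℝ} (ha : 0 < a) :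
    StrictConvexOn ℝ (Set.Ici 0) fun σ : ℝ => primitive h (σ ^ p⁻¹ * a) := by
  have hp0 : 0 < p := by linarith
  refine StrictMonoOn.strictConvexOn_of_deriv (convex_Ici _) ?_ ?_
  · exact (H.continuous_primitive.comp
      ((Real.continuous_rpow_const (by positivity)).mul continuous_const)).continuousOn
  · rw [interior_Ici]
    have hd : ∀ σ : ℝ, 0 < σ → deriv (fun σ : ℝ => primitive h (σ ^ p⁻¹ * a)) σ =
        (a ^ p * p⁻¹) * (h (σ ^ p⁻¹ * a) / |σ ^ p⁻¹ * a| ^ (p - 1)) := by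
      intro σ hσ
      have h1 : HasDerivAt (fun σ : ℝ => σ ^ p⁻¹ * a) (p⁻¹ * σ ^ (p⁻¹ - 1) * a) σ :=
        (Real.hasDerivAt_rpow_const (Or.inl hσ.ne')).mul_const a
      have h2 := (H.hasDerivAt (σ ^ p⁻¹ * a)).comp σ h1
      have h3 : deriv (fun σ : ℝ => primitive h (σ ^ p⁻¹ * a)) σ = _ := h2.deriv
      rw [h3]
      have hb : 0 < σ ^ p⁻¹ := Real.rpow_pos_of_pos hσ _
      rw [abs_of_pos (by positivity), Real.mul_rpow hb.le ha.le, ← Real.rpow_mul hσ.le]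
      have h4 : σ ^ (p⁻¹ - 1) = (σ ^ (p⁻¹ * (p - 1)))⁻¹ := by
        rw [← Real.rpow_neg hσ.le]; congr 1; field_simp; ring
      have h5 : a ^ p = a ^ (p - 1) * a := by
        rw [← Real.rpow_add_one ha.ne']; congr 1; ring
      rw [h4, h5]
      have := Real.rpow_pos_of_pos hσ (p⁻¹ * (p - 1))
      have := Real.rpow_pos_of_pos ha (p - 1)
      field_simp
    intro s hs t ht hst
    rw [hd s hs, hd t ht]
    have h1 : s ^ p⁻¹ * a < t ^ p⁻¹ * a :=
      mul_lt_mul_of_pos_right (Real.rpow_lt_rpow (Set.mem_Ioi.1 hs).le hst (by positivity)) ha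
    have h2 : 0 < s ^ p⁻¹ * a := mul_pos (Real.rpow_pos_of_pos hs _) ha
    exact mul_lt_mul_of_pos_left (H.mono (Or.inr h2) (Or.inr (h2.trans h1)) h1) (by positivity)

end IsPMonotone

/-- The mean of order `p` of two numbers. -/
noncomputable def powMean (p s t : ℝ) : ℝ := ((s ^ p + t ^ p) / 2) ^ p⁻¹

theorem powMean_nonneg {p s t : ℝ} (hs : 0 ≤ s) (ht : 0 ≤ t) : 0 ≤ powMean p s t := by
  unfold powMean; positivity

namespace IsPMonotone

variable {p : ℝ} {h : ℝ → ℝ}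

theorem primitive_powMean_lt (H : IsPMonotone p h) (hp : 1 < p) {a s t : ℝ} (ha : a ≠ 0)
    (hs : 0 ≤ s) (ht : 0 ≤ t) (hst : s ≠ t) :
    2 * primitive h (powMean p s t * a) < primitive h (s * a) + primitive h (t * a) := by
  have key : ∀ r : ℝ, 0 ≤ r → primitive h (r * a) = primitive h (r * |a|) := fun r hr => by
    rw [← H.primitive_abs (r * a), abs_mul, abs_of_nonneg hr]
  rw [key _ hs, key _ ht, key _ (powMean_nonneg hs ht)]
  have hp0 : 0 < p := by linarith
  have hne : s ^ p ≠ t ^ p := fun he => hst ((Real.rpow_left_inj hs ht hp0.ne').1 he)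
  have := (H.strictConvexOn hp (abs_pos.2 ha)).2 (x := s ^ p) (y := t ^ p)
    (Set.mem_Ici.2 (by positivity)) (Set.mem_Ici.2 (by positivity)) hne
    (show (0 : ℝ) < 1 / 2 by norm_num) (show (0 : ℝ) < 1 / 2 by norm_num) (by norm_num)
  simp only [smul_eq_mul] at this
  rw [Real.rpow_rpow_inv hs hp0.ne', Real.rpow_rpow_inv ht hp0.ne',
    show 1 / 2 * s ^ p + 1 / 2 * t ^ p = (s ^ p + t ^ p) / 2 by ring] at this
  unfold powMean
  linarith

theorem primitive_powMean_le (H : IsPMonotone p h) (hp : 1 < p) {a s t : ℝ}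
    (hs : 0 ≤ s) (ht : 0 ≤ t) :
    2 * primitive h (powMean p s t * a) ≤ primitive h (s * a) + primitive h (t * a) := by
  rcases eq_or_ne a 0 with rfl | ha
  · simp [primitive_zero]
  rcases eq_or_ne s t with rfl | hst
  · have : powMean p s s = s := by
      unfold powMean
      rw [add_self_div_two, Real.rpow_rpow_inv hs (by linarith)]
    rw [this]; linarith
  · exact (H.primitive_powMean_lt hp ha hs ht hst).le

/-- A convex function of `σ = t ^ p` vanishing at `0` lies below its chord on `[0, 1]`. -/
theorem primitive_mul_le (H : IsPMonotone p h) (hp : 1 < p) {t : ℝ} (ht : 0 ≤ t) (ht1 : t ≤ 1)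
    (a : ℝ) : primitive h (t * a) ≤ t ^ p * primitive h a := by
  have hp0 : 0 < p := by linarith
  rcases eq_or_ne a 0 with rfl | ha
  · simp [primitive_zero]
  rw [← H.primitive_abs (t * a), ← H.primitive_abs a, abs_mul, abs_of_nonneg ht]
  have h1 : t ^ p ≤ 1 := Real.rpow_le_one ht ht1 hp0.le
  have := (H.strictConvexOn hp (abs_pos.2 ha)).convexOn.2 (x := 1) (y := 0)
    (Set.mem_Ici.2 (by norm_num)) (Set.mem_Ici.2 le_rfl)
    (show 0 ≤ t ^ p by positivity) (show 0 ≤ 1 - t ^ p by linarith) (by ring)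
  simp only [smul_eq_mul, mul_one, mul_zero, add_zero] at this
  rw [Real.rpow_rpow_inv ht hp0.ne', Real.one_rpow, one_mul,
    Real.zero_rpow (inv_ne_zero hp0.ne'), zero_mul, primitive_zero, mul_zero, add_zero] at this
  exact this

/-- The tangent at `|t|`, evaluated at `0`, gives `primitive h t ≤ h |t| * |t|`. -/
theorem primitive_small (H : IsPMonotone p h) {r ε δ : ℝ} (hp : 1 ≤ p) (hr : 1 < r)
    (hh : ∀ t, 0 < |t| → |t| < δ → |h t| ≤ ε * |t| ^ (r - 1)) {t : ℝ} (ht : |t| < δ) :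
    primitive h t ≤ ε * |t| ^ r := by
  have h1 := H.tangent_le hp |t| (-|t|)
  rw [add_neg_cancel, primitive_zero, H.primitive_abs] at h1
  rcases eq_or_ne t 0 with rfl | h0
  · simp [primitive_zero, Real.zero_rpow (show r ≠ 0 by linarith)]
  have h2 := hh |t| (by simpa using h0) (by simpa using ht)
  rw [abs_abs] at h2
  have h3 : |t| ^ r = |t| ^ (r - 1) * |t| := by
    rw [← Real.rpow_add_one (abs_pos.2 h0).ne']; congr 1; ring
  have h4 := le_abs_self (h |t|)
  have h5 := abs_nonneg t
  rw [h3, ← mul_assoc]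
  nlinarith

theorem primitive_lower (H : IsPMonotone p h) (hp : 1 ≤ p) {M R : ℝ} (hM : 0 ≤ M)
    (hh : ∀ t, R < |t| → M ≤ primitive h t / |t| ^ p) (t : ℝ) :
    M * |t| ^ p - M * |R| ^ p ≤ primitive h t := by
  by_cases ht : R < |t| ∧ t ≠ 0
  · have h1 := hh t ht.1
    rw [le_div_iff₀ (Real.rpow_pos_of_pos (abs_pos.2 ht.2) _)] at h1
    have : 0 ≤ M * |R| ^ p := by positivity
    linarith
  · have h1 : |t| ≤ |R| := by
      by_cases h0 : t = 0
      · simp [h0]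
      · have : ¬ R < |t| := fun h => ht ⟨h, h0⟩
        exact (not_lt.1 this).trans (le_abs_self R)
    have h2 : |t| ^ p ≤ |R| ^ p := Real.rpow_le_rpow (abs_nonneg _) h1 (by linarith)
    have := H.primitive_nonneg hp t
    nlinarith

end IsPMonotone

/-! ### Splitting inequalities of Brezis–Lieb type -/

theorem abs_add_rpow_le {r : ℝ} (hr : 1 ≤ r) (a b : ℝ) :
    |a + b| ^ r ≤ 2 ^ (r - 1) * (|a| ^ r + |b| ^ r) :=
  (Real.rpow_le_rpow (abs_nonneg _) (abs_add_le a b) (by linarith)).trans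
    (by exact_mod_cast NNReal.rpow_add_le_mul_rpow_add_rpow ⟨|a|, abs_nonneg a⟩ ⟨|b|, abs_nonneg b⟩ hr)

/-- If `b` is small relative to `a`, the local estimate applies. Otherwise `|a|` and `|a + b|` are
both multiples of `|b|` and the growth bound pays for everything. -/
theorem splitting_of_local {h : ℝ → ℝ} {r K M ε η : ℝ} (hr : 1 ≤ r) (hK : 0 ≤ K) (hη : 0 < η)
    (hε : 0 ≤ ε)
    (hb : ∀ t, |t| ≤ 2 * M → |h t| ≤ K * |t| ^ r)
    (hl : ∀ a b, |a| ≤ M → |b| ≤ η * |a| → |h (a + b) - h a| ≤ ε * |a| ^ r)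
    {a b : ℝ} (ha : |a| ≤ M) (hbM : |b| ≤ M) :
    |h (a + b) - h a| ≤ ε * |a| ^ r + K * ((1 + η⁻¹) ^ r + (η⁻¹) ^ r) * |b| ^ r := by
  by_cases hc : |b| ≤ η * |a|
  · have := hl a b ha hc
    have : 0 ≤ K * ((1 + η⁻¹) ^ r + (η⁻¹) ^ r) * |b| ^ r := by positivity
    linarith
  · push Not at hc
    have h1 : |a| ≤ η⁻¹ * |b| := by
      rw [inv_mul_eq_div, le_div_iff₀ hη]; linarith
    have h2 : |a + b| ≤ (1 + η⁻¹) * |b| := by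
      have := abs_add_le a b; linarith
    have h3 : |h (a + b)| ≤ K * ((1 + η⁻¹) ^ r * |b| ^ r) := by
      refine (hb _ (by have := abs_add_le a b; linarith)).trans ?_
      refine mul_le_mul_of_nonneg_left ?_ hK
      rw [← Real.mul_rpow (by positivity) (abs_nonneg _)]
      exact Real.rpow_le_rpow (abs_nonneg _) h2 (by linarith)
    have h4 : |h a| ≤ K * ((η⁻¹) ^ r * |b| ^ r) := by
      refine (hb _ (by linarith [abs_nonneg a])).trans ?_
      refine mul_le_mul_of_nonneg_left ?_ hK
      rw [← Real.mul_rpow (by positivity) (abs_nonneg _)]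
      exact Real.rpow_le_rpow (abs_nonneg _) h1 (by linarith)
    have h5 := abs_sub (h (a + b)) (h a)
    have : 0 ≤ ε * |a| ^ r := by positivity
    nlinarith

/-- Splitting for continuous functions that are `o(|t| ^ r)` at the origin. -/
theorem splitting_of_isLittleO {h : ℝ → ℝ} (hc : Continuous h) {r : ℝ} (hr : 1 ≤ r)
    (h0 : ∀ ε > 0, ∃ δ > 0, ∀ t, |t| < δ → |h t| ≤ ε * |t| ^ r) (M : ℝ) {ε : ℝ} (hε : 0 < ε) :
    ∃ C, ∀ a b, |a| ≤ M → |b| ≤ M → |h (a + b) - h a| ≤ ε * |a| ^ r + C * |b| ^ r := by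
  obtain ⟨K, hK0, hK⟩ : ∃ K, 0 ≤ K ∧ ∀ t, |t| ≤ 2 * M → |h t| ≤ K * |t| ^ r := by
    obtain ⟨δ, hδ, hδh⟩ := h0 1 one_pos
    obtain ⟨B, hB⟩ := (isCompact_Icc (a := -(2 * M)) (b := 2 * M)).exists_bound_of_continuousOn
      hc.continuousOn
    have hB' : ∀ t, |t| ≤ 2 * M → |h t| ≤ |B| := fun t ht =>
      (hB t (abs_le.1 ht)).trans (le_abs_self B)
    refine ⟨1 + |B| / δ ^ r, by positivity, fun t ht => ?_⟩
    by_cases htd : |t| < δ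
    · have := hδh t htd
      have : 0 ≤ |B| / δ ^ r * |t| ^ r := by positivity
      linarith
    · push Not at htd
      have h1 : δ ^ r ≤ |t| ^ r := Real.rpow_le_rpow hδ.le htd (by linarith)
      have h2 : 0 < δ ^ r := Real.rpow_pos_of_pos hδ _
      have h3 : |B| ≤ |B| / δ ^ r * |t| ^ r := by
        rw [div_mul_eq_mul_div, le_div_iff₀ h2]
        exact mul_le_mul_of_nonneg_left h1 (abs_nonneg _)
      have := hB' t ht
      have : 0 ≤ |t| ^ r := by positivity
      linarith
  obtain ⟨η, hη, hl⟩ : ∃ η, 0 < η ∧ ∀ a b, |a| ≤ M → |b| ≤ η * |a| →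
      |h (a + b) - h a| ≤ ε * |a| ^ r := by
    have h2r : (0 : ℝ) < 2 ^ r := Real.rpow_pos_of_pos two_pos _
    obtain ⟨δ, hδ, hδh⟩ := h0 (ε / (2 ^ r + 1)) (by positivity)
    have huc := (isCompact_Icc (a := -(2 * M)) (b := 2 * M)).uniformContinuousOn_of_continuous
      hc.continuousOn
    rw [Metric.uniformContinuousOn_iff] at huc
    -- For `|a| < δ / 2` both values are small by `h0`. For `|a| ≥ δ / 2` the allowance `ε * |a| ^
    -- r` is at least this modulus, and uniform continuity suffices.
    obtain ⟨θ, hθ, hu⟩ := huc (ε * (δ / 2) ^ r) (by positivity)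
    refine ⟨min 1 (θ / (|M| + 1)), by positivity, fun a b ha hb => ?_⟩
    have hb1 : |b| ≤ |a| := hb.trans (by
      have := min_le_left 1 (θ / (|M| + 1)); nlinarith [abs_nonneg a])
    by_cases had : |a| < δ / 2
    · have h1 : |a + b| ≤ 2 * |a| := by have := abs_add_le a b; linarith
      have h2 := hδh (a + b) (by linarith)
      have h3 := hδh a (by linarith)
      have h4 : |a + b| ^ r ≤ 2 ^ r * |a| ^ r := by
        rw [← Real.mul_rpow two_pos.le (abs_nonneg _)]
        exact Real.rpow_le_rpow (abs_nonneg _) h1 (by linarith)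
      have h5 := abs_sub (h (a + b)) (h a)
      have h6 : ε / (2 ^ r + 1) * |a + b| ^ r ≤ ε / (2 ^ r + 1) * (2 ^ r * |a| ^ r) :=
        mul_le_mul_of_nonneg_left h4 (by positivity)
      have h7 : ε / (2 ^ r + 1) * (2 ^ r * |a| ^ r) + ε / (2 ^ r + 1) * |a| ^ r = ε * |a| ^ r := by
        field_simp
      linarith
    · push Not at had
      have h1 : |b| < θ := by
        have h2 : |a| < |M| + 1 := by have := le_abs_self M; linarith
        have h3 : |b| ≤ θ / (|M| + 1) * |a| := hb.trans
          (mul_le_mul_of_nonneg_right (min_le_right _ _) (abs_nonneg _))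
        refine h3.trans_lt ?_
        rw [div_mul_eq_mul_div, div_lt_iff₀ (by positivity)]
        exact mul_lt_mul_of_pos_left h2 hθ
      have h2 := hu (a + b) (abs_le.1 (by have := abs_add_le a b; linarith)) a
        (abs_le.1 (by linarith [abs_nonneg a])) (by simpa [Real.dist_eq] using h1)
      rw [Real.dist_eq] at h2
      refine h2.le.trans (mul_le_mul_of_nonneg_left ?_ hε.le)
      exact Real.rpow_le_rpow (by positivity) had (by linarith)
  exact ⟨_, fun a b ha hb => splitting_of_local hr hK0 hη hε.le hK hl ha hb⟩

/-- By homogeneity the local estimate reduces to continuity of `t ^ p` at `1`. The growth bound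
holds on the whole line, so the cut-off `M` may depend on `a` and `b`. -/
theorem splitting_abs_rpow {p : ℝ} (hp : 1 ≤ p) {ε : ℝ} (hε : 0 < ε) :
    ∃ C, ∀ a b : ℝ, |(|a + b| ^ p - |a| ^ p)| ≤ ε * |a| ^ p + C * |b| ^ p := by
  have hp0 : 0 < p := by linarith
  have hc : ContinuousAt (fun t : ℝ => t ^ p) 1 := Real.continuousAt_rpow_const _ _ (Or.inl one_ne_zero)
  obtain ⟨δ, hδ, hd⟩ := Metric.continuousAt_iff.1 hc ε hε
  simp only [Real.dist_eq, Real.one_rpow] at hd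
  refine ⟨1 * ((1 + (min 1 (δ / 2))⁻¹) ^ p + ((min 1 (δ / 2))⁻¹) ^ p), fun a b => ?_⟩
  refine splitting_of_local (h := fun t => |t| ^ p) (M := max |a| |b|) hp zero_le_one
    (by positivity) hε.le ?_ ?_ (le_max_left _ _) (le_max_right _ _)
  · intro t _
    rw [one_mul, abs_of_nonneg (by positivity)]
  · intro a b _ hb
    rcases eq_or_ne a 0 with rfl | ha
    · have : b = 0 := by simpa using hb
      simp [this, Real.zero_rpow hp0.ne']
    have ha' := abs_pos.2 ha
    have h1 : |(|a + b| / |a| - 1)| < δ := by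
      rw [div_sub_one ha'.ne', abs_div, abs_abs, div_lt_iff₀ ha']
      have h2 : |(|a + b| - |a|)| ≤ |b| := by
        have := abs_abs_sub_abs_le (a + b) a; simpa using this
      have h3 : min 1 (δ / 2) * |a| ≤ δ / 2 * |a| :=
        mul_le_mul_of_nonneg_right (min_le_right _ _) ha'.le
      nlinarith
    have h2 := (hd h1).le
    rw [Real.div_rpow (abs_nonneg _) (abs_nonneg _)] at h2
    have h3 : 0 < |a| ^ p := Real.rpow_pos_of_pos ha' _
    rw [div_sub_one h3.ne', abs_div, abs_of_pos h3, div_le_iff₀ h3] at h2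
    exact h2

/-- If `A n i → 0` for each `i` and `|A n i| ≤ ε * B n i + C ε * β i` with bounded sums of `B n`
and summable `β`, then the sums of `A n` tend to zero. -/
theorem tendsto_tsum_of_splitting {ι : Type*} {A B : ℕ → ι → ℝ} {β : ι → ℝ} {M : ℝ}
    (hβ : Summable β) (hB0 : ∀ n i, 0 ≤ B n i) (hB : ∀ n, Summable (B n))
    (hBM : ∀ n, ∑' i, B n i ≤ M) (hA : ∀ i, Tendsto (fun n => A n i) atTop (𝓝 0))
    (hs : ∀ ε > 0, ∃ C, ∀ n i, |A n i| ≤ ε * B n i + C * β i) :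
    Tendsto (fun n => ∑' i, A n i) atTop (𝓝 0) := by
  have hM : 0 ≤ M := (tsum_nonneg (hB0 0)).trans (hBM 0)
  have hAs : ∀ n, Summable fun i => |A n i| := fun n => by
    obtain ⟨C, hC⟩ := hs 1 one_pos
    exact Summable.of_nonneg_of_le (fun _ => abs_nonneg _) (hC n)
      (((hB n).mul_left 1).add (hβ.mul_left C))
  rw [Metric.tendsto_atTop]
  intro ε hε
  obtain ⟨C, hC⟩ := hs (ε / (2 * (M + 1))) (by positivity)
  set κ := ε / (2 * (M + 1)) with hκ
  have hκ0 : 0 < κ := by positivity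
  -- Subtracting `κ * B n i` leaves a part dominated by the fixed summable `|C * β i|`, so dominated
  -- convergence applies to it; the subtracted part sums to at most `κ * M < ε / 2`.
  have hlim : Tendsto (fun n => ∑' i, max (|A n i| - κ * B n i) 0) atTop (𝓝 (∑' _ : ι, (0 : ℝ))) := by
    refine tendsto_tsum_of_dominated_convergence (bound := fun i => |C * β i|)
      (hβ.mul_left C).abs (fun i => ?_) (Eventually.of_forall fun n i => ?_)
    · refine tendsto_of_tendsto_of_tendsto_of_le_of_le tendsto_const_nhds
        (by simpa using (hA i).abs) (fun n => le_max_right _ _) (fun n => ?_)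
      exact max_le (by have := mul_nonneg hκ0.le (hB0 n i); linarith) (abs_nonneg _)
    · rw [Real.norm_of_nonneg (le_max_right _ _)]
      refine max_le ?_ (abs_nonneg _)
      have := hC n i
      have := le_abs_self (C * β i)
      linarith
  rw [tsum_zero] at hlim
  obtain ⟨n0, hn0⟩ := (Metric.tendsto_atTop.1 hlim) (ε / 2) (by positivity)
  refine ⟨n0, fun n hn => ?_⟩
  have h1 := hn0 n hn
  rw [Real.dist_eq, sub_zero] at h1
  have h1' := (le_abs_self _).trans_lt h1
  rw [Real.dist_eq, sub_zero]
  have hms : Summable fun i => max (|A n i| - κ * B n i) 0 :=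
    Summable.of_nonneg_of_le (fun _ => le_max_right _ _)
      (fun i => max_le (by have := mul_nonneg hκ0.le (hB0 n i); linarith) (abs_nonneg _)) (hAs n)
  have h2 : ∑' i, |A n i| ≤ ∑' i, (max (|A n i| - κ * B n i) 0 + κ * B n i) :=
    (hAs n).tsum_le_tsum (fun i => by have := le_max_left (|A n i| - κ * B n i) 0; linarith)
      (hms.add ((hB n).mul_left κ))
  rw [hms.tsum_add ((hB n).mul_left κ), tsum_mul_left] at h2
  have h3 : κ * ∑' i, B n i ≤ κ * M := mul_le_mul_of_nonneg_left (hBM n) hκ0.le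
  have h4 : κ * M < ε / 2 := by
    rw [hκ, div_mul_eq_mul_div, div_lt_div_iff₀ (by positivity) (by positivity)]
    nlinarith
  have h5 : |∑' i, A n i| ≤ ∑' i, |A n i| := by
    have := norm_tsum_le_tsum_norm (f := A n) (by simpa using hAs n)
    simpa using this
  linarith

theorem Set.Finite.exists_uniform_const {α : Type*} {s : Set α} (hs : s.Finite)
    {Pr : α → ℝ → Prop} (hmono : ∀ a C C', C ≤ C' → Pr a C → Pr a C') (h : ∀ a ∈ s, ∃ C, Pr a C) :
    ∃ C, ∀ a ∈ s, Pr a C := by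
  induction s, hs using Set.Finite.induction_on with
  | empty => exact ⟨0, by simp⟩
  | @insert a s _ _ ih =>
    obtain ⟨C, hC⟩ := ih fun b hb => h b (Set.mem_insert_of_mem _ hb)
    obtain ⟨C', hC'⟩ := h a (Set.mem_insert _ _)
    refine ⟨max C C', fun b hb => ?_⟩
    rcases hb with rfl | hb
    · exact hmono _ _ _ (le_max_right _ _) hC'
    · exact hmono _ _ _ (le_max_left _ _) (hC b hb)

/-- Brezis–Lieb splitting for sums of a family of functions with a uniform splitting property. -/
theorem tendsto_tsum_split {ι : Type*} {h : ι → ℝ → ℝ} {S : ℝ → Prop} {r B : ℝ} (hr : 0 < r)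
    (hS : S 0) (h0 : ∀ i, h i 0 = 0)
    (hsplit : ∀ ε > 0, ∃ C, ∀ i a b, S a → S b →
      |h i (a + b) - h i a| ≤ ε * |a| ^ r + C * |b| ^ r)
    {a b : ℕ → ι → ℝ} {γ : ι → ℝ} (ha : ∀ n i, S (a n i)) (hb : ∀ n i, S (b n i))
    (hbγ : ∀ n i, |b n i| ≤ γ i) (hγ : Summable fun i => γ i ^ r)
    (has : ∀ n, Summable fun i => |a n i| ^ r) (haB : ∀ n, ∑' i, |a n i| ^ r ≤ B)
    (hlim : ∀ i, Tendsto (fun n => a n i) atTop (𝓝 0)) :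
    Tendsto (fun n => ∑' i, (h i (a n i + b n i) - h i (a n i) - h i (b n i))) atTop (𝓝 0) := by
  obtain ⟨C₁, hC₁⟩ : ∃ C, ∀ i a, S a → |h i a| ≤ C * |a| ^ r := by
    obtain ⟨C, hC⟩ := hsplit 1 one_pos
    refine ⟨C, fun i a ha => ?_⟩
    have := hC i 0 a hS ha
    simpa [h0, Real.zero_rpow hr.ne'] using this
  have hγ0 : ∀ i, 0 ≤ γ i := fun i => (abs_nonneg _).trans (hbγ 0 i)
  have hbr : ∀ n i, |b n i| ^ r ≤ γ i ^ r := fun n i =>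
    Real.rpow_le_rpow (abs_nonneg _) (hbγ n i) hr.le
  refine tendsto_tsum_of_splitting (B := fun n i => |a n i| ^ r) (β := fun i => γ i ^ r) (M := B) hγ
    (fun n i => by positivity) has haB (fun i => ?_) (fun ε hε => ?_)
  · have har : Tendsto (fun n => |a n i| ^ r) atTop (𝓝 0) := by
      have := ((hlim i).abs).rpow_const (p := r) (Or.inr hr.le)
      simpa [Real.zero_rpow hr.ne'] using this
    rw [Metric.tendsto_atTop]
    intro ε hε
    -- Here the splitting is used with `b` as the base point: `b n i` need not converge and no
    -- continuity of `h i` is assumed.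
    obtain ⟨C, hC⟩ := hsplit (ε / (2 * (γ i ^ r + 1))) (by have := hγ0 i; positivity)
    have h1 : Tendsto (fun n => (|C| + |C₁|) * |a n i| ^ r) atTop (𝓝 0) := by
      simpa using har.const_mul (|C| + |C₁|)
    obtain ⟨n0, hn0⟩ := (Metric.tendsto_atTop.1 h1) (ε / 2) (by positivity)
    refine ⟨n0, fun n hn => ?_⟩
    have h2 := hn0 n hn
    rw [Real.dist_eq, sub_zero, abs_of_nonneg (by positivity)] at h2
    rw [Real.dist_eq, sub_zero]
    have h3 := hC i _ _ (hb n i) (ha n i)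
    have h4 := hC₁ i _ (ha n i)
    have h5 : |h i (a n i + b n i) - h i (a n i) - h i (b n i)| ≤
        |h i (b n i + a n i) - h i (b n i)| + |h i (a n i)| := by
      rw [add_comm (b n i)]
      have := abs_sub (h i (a n i + b n i) - h i (b n i)) (h i (a n i))
      rwa [sub_right_comm] at this
    have h6 : ε / (2 * (γ i ^ r + 1)) * |b n i| ^ r ≤ ε / 2 := by
      have := hγ0 i
      rw [div_mul_eq_mul_div, div_le_div_iff₀ (by positivity) two_pos]
      have := hbr n i
      nlinarith
    have h7 : C * |a n i| ^ r ≤ |C| * |a n i| ^ r :=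
      mul_le_mul_of_nonneg_right (le_abs_self C) (by positivity)
    have h8 : C₁ * |a n i| ^ r ≤ |C₁| * |a n i| ^ r :=
      mul_le_mul_of_nonneg_right (le_abs_self C₁) (by positivity)
    linarith
  · obtain ⟨C, hC⟩ := hsplit ε hε
    refine ⟨|C| + |C₁|, fun n i => ?_⟩
    have h3 := hC i _ _ (ha n i) (hb n i)
    have h4 := hC₁ i _ (hb n i)
    have h5 := abs_sub (h i (a n i + b n i) - h i (a n i)) (h i (b n i))
    have h7 : C * |b n i| ^ r ≤ |C| * γ i ^ r :=
      mul_le_mul (le_abs_self C) (hbr n i) (by positivity) (abs_nonneg _)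
    have h8 : C₁ * |b n i| ^ r ≤ |C₁| * γ i ^ r :=
      mul_le_mul (le_abs_self C₁) (hbr n i) (by positivity) (abs_nonneg _)
    linarith

/-! ### The variational problem -/

/-- A variational problem on `ℤ^N`: an energy `∑ₑ |A e * u (hd e) - B e * u (tl e)| ^ p` over a
locally finite family of edges satisfying a Sobolev inequality with exponent `r > p`, and a
superlinear odd nonlinearity `f`, both invariant under translations by multiples of `T`. -/
structure LatticeProblem (N : ℕ) (ι : Type) where
  p : ℝ
  r : ℝ
  two_le : 2 ≤ p
  p_lt_r : p < r
  T : ℕ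
  T_pos : 0 < T
  A : ι → ℝ
  B : ι → ℝ
  A_nonneg : ∀ e, 0 ≤ A e
  B_nonneg : ∀ e, 0 ≤ B e
  B_eq_or : ∀ e, B e = A e ∨ B e = 0
  hd : ι → Fin N → ℤ
  tl : ι → Fin N → ℤ
  finite_star : ∀ x, {e | hd e = x ∨ tl e = x}.Finite
  shiftE : (Fin N → ℤ) → ι ≃ ι
  hd_shift : ∀ k e, hd (shiftE k e) = hd e + (T : ℤ) • k
  tl_shift : ∀ k e, tl (shiftE k e) = tl e + (T : ℤ) • k
  A_shift : ∀ k e, A (shiftE k e) = A e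
  B_shift : ∀ k e, B (shiftE k e) = B e
  K : ℝ
  K_nonneg : 0 ≤ K
  sobolev : ∀ u : (Fin N → ℤ) → ℝ, Summable (fun e => |A e * u (hd e) - B e * u (tl e)| ^ p) →
    Summable (fun x => |u x| ^ r) →
    ∑' x, |u x| ^ r ≤ K * (∑' e, |A e * u (hd e) - B e * u (tl e)| ^ p) ^ (r / p)
  f : (Fin N → ℤ) → ℝ → ℝ
  f_shift : ∀ x k, f (x + (T : ℤ) • k) = f x
  f_pm : ∀ x, IsPMonotone p (f x)
  f_zero : ∀ ε > 0, ∃ δ > 0, ∀ x t, 0 < |t| → |t| < δ → |f x t| ≤ ε * |t| ^ (r - 1)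
  F_super : ∀ M : ℝ, ∃ R : ℝ, ∀ x t, R < |t| → M ≤ primitive (f x) t / |t| ^ p

namespace LatticeProblem

variable {N : ℕ} {ι : Type} (P : LatticeProblem N ι)

/-- The linear form on functions attached to an edge. -/
def form (e : ι) (u : (Fin N → ℤ) → ℝ) : ℝ := P.A e * u (P.hd e) - P.B e * u (P.tl e)

/-- The primitive of the nonlinearity. -/
noncomputable def F (x : Fin N → ℤ) (t : ℝ) : ℝ := primitive (P.f x) t

/-- The `p`-th power of the energy norm. -/
noncomputable def Q (u : (Fin N → ℤ) → ℝ) : ℝ := ∑' e, |P.form e u| ^ P.p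

/-- The potential energy. -/
noncomputable def pot (u : (Fin N → ℤ) → ℝ) : ℝ := ∑' x, P.F x (u x)

/-- The energy functional. -/
noncomputable def J (u : (Fin N → ℤ) → ℝ) : ℝ := P.Q u / P.p - P.pot u

/-- Functions of finite energy in `ℓ ^ r`. -/
structure Adm (u : (Fin N → ℤ) → ℝ) : Prop where
  form : Summable fun e => |P.form e u| ^ P.p
  pow : Summable fun x => |u x| ^ P.r

variable {P}

theorem p_pos : 0 < P.p := by linarith [P.two_le]
theorem one_lt_p : 1 < P.p := by linarith [P.two_le]
theorem r_pos : 0 < P.r := by linarith [P.two_le, P.p_lt_r]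
theorem one_lt_r : 1 < P.r := by linarith [P.two_le, P.p_lt_r]

@[simp] theorem form_add (e : ι) (u v : (Fin N → ℤ) → ℝ) :
    P.form e (u + v) = P.form e u + P.form e v := by
  simp only [form, Pi.add_apply]; ring

@[simp] theorem form_smul (e : ι) (t : ℝ) (u : (Fin N → ℤ) → ℝ) :
    P.form e (t • u) = t * P.form e u := by
  simp only [form, Pi.smul_apply, smul_eq_mul]; ring

@[simp] theorem form_zero (e : ι) : P.form e 0 = 0 := by simp [form]

theorem tendsto_form {α : Type*} {l : Filter α} {y : α → (Fin N → ℤ) → ℝ} {u : (Fin N → ℤ) → ℝ}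
    (h : ∀ x, Tendsto (fun n => y n x) l (𝓝 (u x))) (e : ι) :
    Tendsto (fun n => P.form e (y n)) l (𝓝 (P.form e u)) :=
  ((h _).const_mul _).sub ((h _).const_mul _)

theorem F_zero (x) : P.F x 0 = 0 := IsPMonotone.primitive_zero _

theorem F_nonneg (x t) : 0 ≤ P.F x t := (P.f_pm x).primitive_nonneg one_lt_p.le t

theorem F_abs (x t) : P.F x |t| = P.F x t := (P.f_pm x).primitive_abs t

theorem continuous_F (x) : Continuous (P.F x) := (P.f_pm x).continuous_primitive

/-- By periodicity `f x` depends only on the residues of `x` modulo `T`. Finiteness makes the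
splitting constants uniform in `x`. -/
theorem finite_range_f : (Set.range P.f).Finite := by
  refine ((Set.finite_Icc (0 : Fin N → ℤ) (fun _ => (P.T : ℤ))).image P.f).subset ?_
  rintro _ ⟨x, rfl⟩
  have hT : (0 : ℤ) < P.T := by exact_mod_cast P.T_pos
  refine ⟨fun i => x i % P.T, ⟨fun i => Int.emod_nonneg _ hT.ne', fun i =>
    (Int.emod_lt_of_pos _ hT).le⟩, ?_⟩
  refine (P.f_shift _ fun i => x i / P.T).symm.trans (congrArg P.f (funext fun i => ?_))
  exact Int.emod_add_mul_ediv _ _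

theorem F_small {ε : ℝ} (hε : 0 < ε) :
    ∃ ρ > 0, ∀ x t, |t| < ρ → P.F x t ≤ ε * |t| ^ P.r := by
  obtain ⟨δ, hδ, h⟩ := P.f_zero ε hε
  exact ⟨δ, hδ, fun x t ht => (P.f_pm x).primitive_small one_lt_p.le one_lt_r (h x) ht⟩

theorem F_split (M : ℝ) {ε : ℝ} (hε : 0 < ε) : ∃ C, ∀ x a b, |a| ≤ M → |b| ≤ M →
    |P.F x (a + b) - P.F x a| ≤ ε * |a| ^ P.r + C * |b| ^ P.r := by
  suffices h : ∃ C, ∀ h ∈ Set.range P.f, ∀ a b, |a| ≤ M → |b| ≤ M →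
      |primitive h (a + b) - primitive h a| ≤ ε * |a| ^ P.r + C * |b| ^ P.r from
    h.imp fun C hC x => hC _ ⟨x, rfl⟩
  refine (P.finite_range_f).exists_uniform_const (Pr := fun h C => ∀ a b, |a| ≤ M →
    |b| ≤ M → |primitive h (a + b) - primitive h a| ≤ ε * |a| ^ P.r + C * |b| ^ P.r) ?_ ?_
  · intro h C C' hCC' hh a b ha hb
    have := mul_le_mul_of_nonneg_right hCC' (show 0 ≤ |b| ^ P.r by positivity)
    linarith [hh a b ha hb]
  · rintro _ ⟨x, rfl⟩
    refine splitting_of_isLittleO (P.f_pm x).continuous_primitive one_lt_r.le (fun ε hε => ?_) M hε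
    obtain ⟨ρ, hρ, h⟩ := P.F_small hε
    exact ⟨ρ, hρ, fun t ht => by
      rw [abs_of_nonneg ((P.f_pm x).primitive_nonneg one_lt_p.le t)]; exact h x t ht⟩

theorem F_le (M : ℝ) : ∃ C, 0 ≤ C ∧ ∀ x t, |t| ≤ M → P.F x t ≤ C * |t| ^ P.r := by
  obtain ⟨C, hC⟩ := P.F_split M one_pos
  refine ⟨|C|, abs_nonneg _, fun x t ht => ?_⟩
  have := hC x 0 t (by simpa using (abs_nonneg t).trans ht) ht
  simp only [zero_add, F_zero, sub_zero, abs_zero, Real.zero_rpow P.r_pos.ne', mul_zero,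
    abs_of_nonneg (F_nonneg x t)] at this
  exact this.trans (mul_le_mul_of_nonneg_right (le_abs_self C) (by positivity))

theorem F_lower (M : ℝ) (hM : 0 ≤ M) : ∃ C, 0 ≤ C ∧ ∀ x t, M * |t| ^ P.p - C ≤ P.F x t := by
  obtain ⟨R, hR⟩ := P.F_super M
  exact ⟨M * |R| ^ P.p, by positivity, fun x t =>
    (P.f_pm x).primitive_lower one_lt_p.le hM (hR x) t⟩

theorem Q_nonneg (u) : 0 ≤ P.Q u := tsum_nonneg fun _ => by positivity

theorem pot_nonneg (u) : 0 ≤ P.pot u := tsum_nonneg fun x => F_nonneg x _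

theorem Q_smul (t : ℝ) (u) : P.Q (t • u) = |t| ^ P.p * P.Q u := by
  unfold Q
  rw [← tsum_mul_left]
  congr 1; funext e
  rw [form_smul, abs_mul, Real.mul_rpow (abs_nonneg _) (abs_nonneg _)]

theorem Q_smul_of_nonneg {t : ℝ} (ht : 0 ≤ t) (u) : P.Q (t • u) = t ^ P.p * P.Q u := by
  rw [Q_smul, abs_of_nonneg ht]

theorem Q_zero : P.Q 0 = 0 := by simp [Q, Real.zero_rpow P.p_pos.ne']
theorem pot_zero : P.pot 0 = 0 := by simp [pot, F_zero]
theorem J_zero : P.J 0 = 0 := by simp [J, Q_zero, pot_zero]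

/-! ### Operations on admissible functions. -/

namespace Adm

variable {u v : (Fin N → ℤ) → ℝ}

theorem zero : P.Adm 0 :=
  ⟨by simp [Real.zero_rpow P.p_pos.ne'],
    by simp [Real.zero_rpow P.r_pos.ne']⟩

theorem add (hu : P.Adm u) (hv : P.Adm v) : P.Adm (u + v) := by
  constructor
  · refine Summable.of_nonneg_of_le (fun _ => by positivity) (fun e => ?_)
      ((hu.form.add hv.form).mul_left (2 ^ (P.p - 1)))
    rw [form_add]
    exact abs_add_rpow_le one_lt_p.le _ _
  · exact Summable.of_nonneg_of_le (fun _ => by positivity)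
      (fun x => abs_add_rpow_le one_lt_r.le _ _) ((hu.pow.add hv.pow).mul_left (2 ^ (P.r - 1)))

theorem smul (hu : P.Adm u) (t : ℝ) : P.Adm (t • u) := by
  constructor
  · refine (hu.form.mul_left (|t| ^ P.p)).congr fun e => ?_
    rw [form_smul, abs_mul, Real.mul_rpow (abs_nonneg _) (abs_nonneg _)]
  · refine (hu.pow.mul_left (|t| ^ P.r)).congr fun x => ?_
    rw [Pi.smul_apply, smul_eq_mul, abs_mul, Real.mul_rpow (abs_nonneg _) (abs_nonneg _)]

theorem sub (hu : P.Adm u) (hv : P.Adm v) : P.Adm (u - v) := by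
  have := hu.add (hv.smul (-1))
  rwa [neg_one_smul, ← sub_eq_add_neg] at this

/-- Where `B = A` the form is a multiple of a difference, where `B = 0` a multiple of a value; a
1-Lipschitz map fixing `0` increases neither. It covers absolute values, positive and negative
parts, and truncations. -/
theorem abs_form_comp_le {ψ : ℝ → ℝ} (hψ : ∀ s t, |ψ s - ψ t| ≤ |s - t|) (h0 : ψ 0 = 0) (e : ι)
    (u : (Fin N → ℤ) → ℝ) : |P.form e fun x => ψ (u x)| ≤ |P.form e u| := by
  rcases P.B_eq_or e with h | h
  · simp only [LatticeProblem.form, h, ← mul_sub, abs_mul]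
    exact mul_le_mul_of_nonneg_left (hψ _ _) (abs_nonneg _)
  · simp only [LatticeProblem.form, h, zero_mul, sub_zero, abs_mul]
    have := hψ (u (P.hd e)) 0
    rw [h0, sub_zero, sub_zero] at this
    exact mul_le_mul_of_nonneg_left this (abs_nonneg _)

theorem comp (hu : P.Adm u) {ψ : ℝ → ℝ} (hψ : ∀ s t, |ψ s - ψ t| ≤ |s - t|) (h0 : ψ 0 = 0) :
    P.Adm fun x => ψ (u x) := by
  constructor
  · exact Summable.of_nonneg_of_le (fun _ => by positivity) (fun e =>
      Real.rpow_le_rpow (abs_nonneg _) (abs_form_comp_le hψ h0 e u) P.p_pos.le) hu.form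
  · refine Summable.of_nonneg_of_le (fun _ => by positivity) (fun x =>
      Real.rpow_le_rpow (abs_nonneg _) ?_ P.r_pos.le) hu.pow
    have := hψ (u x) 0
    rwa [h0, sub_zero, sub_zero] at this

theorem Q_comp_le (hu : P.Adm u) {ψ : ℝ → ℝ} (hψ : ∀ s t, |ψ s - ψ t| ≤ |s - t|) (h0 : ψ 0 = 0) :
    P.Q (fun x => ψ (u x)) ≤ P.Q u :=
  (hu.comp hψ h0).form.tsum_le_tsum (fun e =>
    Real.rpow_le_rpow (abs_nonneg _) (abs_form_comp_le hψ h0 e u) P.p_pos.le) hu.form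

/-- Finitely supported functions are admissible. -/
theorem of_finite_support (h : (Function.support u).Finite) : P.Adm u := by
  constructor
  · refine summable_of_hasFiniteSupport ((h.biUnion fun x _ => P.finite_star x).subset ?_)
    intro e he
    rw [Set.mem_iUnion₂]
    by_contra hcon
    push Not at hcon
    have h1 : u (P.hd e) = 0 := by
      by_contra h1; exact hcon _ h1 (Or.inl rfl)
    have h2 : u (P.tl e) = 0 := by
      by_contra h1; exact hcon _ h1 (Or.inr rfl)
    exact he (by simp [LatticeProblem.form, h1, h2, Real.zero_rpow P.p_pos.ne'])
  · refine summable_of_hasFiniteSupport (h.subset fun x hx h0 => hx ?_)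
    simp [h0, Real.zero_rpow P.r_pos.ne']

theorem abs_rpow_le (hu : P.Adm u) (x) : |u x| ^ P.r ≤ ∑' x, |u x| ^ P.r :=
  hu.pow.le_tsum x fun _ _ => by positivity

theorem abs_le (hu : P.Adm u) (x) : |u x| ≤ (∑' x, |u x| ^ P.r) ^ P.r⁻¹ := by
  have := Real.rpow_le_rpow (by positivity) (hu.abs_rpow_le x) (inv_nonneg.2 P.r_pos.le)
  rwa [Real.rpow_rpow_inv (abs_nonneg _) P.r_pos.ne'] at this

theorem F_summable (hu : P.Adm u) : Summable fun x => P.F x (u x) := by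
  obtain ⟨C, -, hC⟩ := P.F_le ((∑' x, |u x| ^ P.r) ^ P.r⁻¹)
  exact Summable.of_nonneg_of_le (fun x => F_nonneg x _) (fun x => hC x _ (hu.abs_le x))
    (hu.pow.mul_left C)

theorem Q_add_le (hu : P.Adm u) (hv : P.Adm v) :
    P.Q (u + v) ≤ 2 ^ (P.p - 1) * (P.Q u + P.Q v) := by
  unfold Q
  rw [← hu.form.tsum_add hv.form, ← tsum_mul_left]
  refine (hu.add hv).form.tsum_le_tsum (fun e => ?_) ((hu.form.add hv.form).mul_left _)
  rw [form_add]
  exact abs_add_rpow_le one_lt_p.le _ _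

theorem Q_sub_le (hu : P.Adm u) (hv : P.Adm v) :
    P.Q (u - v) ≤ 2 ^ (P.p - 1) * (P.Q u + P.Q v) := by
  have := hu.Q_add_le (hv.smul (-1))
  rwa [neg_one_smul, ← sub_eq_add_neg, ← neg_one_smul ℝ v, Q_smul, abs_neg, abs_one, Real.one_rpow,
    one_mul] at this

theorem sobolev (hu : P.Adm u) : ∑' x, |u x| ^ P.r ≤ P.K * P.Q u ^ (P.r / P.p) :=
  P.sobolev u hu.form hu.pow

theorem F_le_pot (hu : P.Adm u) (x) : P.F x (u x) ≤ P.pot u :=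
  hu.F_summable.le_tsum x fun _ _ => F_nonneg _ _

theorem support_large_finite (hu : P.Adm u) {κ : ℝ} (hκ : 0 < κ) : {x | κ ≤ |u x|}.Finite := by
  have := hu.pow.tendsto_cofinite_zero.eventually (gt_mem_nhds (Real.rpow_pos_of_pos hκ P.r))
  refine Set.Finite.subset this fun x hx => ?_
  simp only [Set.mem_compl_iff, Set.mem_ofPred_eq, not_lt] at hx ⊢
  exact Real.rpow_le_rpow hκ.le hx P.r_pos.le

end Adm

/-- Sobolev controls the `ℓ^r` sum, and each term of a sum is at most the sum. All later estimates
of `F` can therefore be made on a bounded interval. -/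
theorem bound_of_Q (B : ℝ) : ∃ M, 0 ≤ M ∧ ∀ u, P.Adm u → P.Q u ≤ B →
    (∑' x, |u x| ^ P.r) ≤ M ∧ ∀ x, |u x| ≤ M := by
  have hB : 0 ≤ P.K * |B| ^ (P.r / P.p) := mul_nonneg P.K_nonneg (by positivity)
  refine ⟨max (P.K * |B| ^ (P.r / P.p)) ((P.K * |B| ^ (P.r / P.p)) ^ P.r⁻¹),
    hB.trans (le_max_left _ _), fun u hu hQ => ?_⟩
  have h1 : (∑' x, |u x| ^ P.r) ≤ P.K * |B| ^ (P.r / P.p) :=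
    hu.sobolev.trans (mul_le_mul_of_nonneg_left (Real.rpow_le_rpow (Q_nonneg u)
      (hQ.trans (le_abs_self B)) (div_nonneg P.r_pos.le P.p_pos.le)) P.K_nonneg)
  refine ⟨h1.trans (le_max_left _ _), fun x => (hu.abs_le x).trans (le_trans ?_ (le_max_right _ _))⟩
  exact Real.rpow_le_rpow (tsum_nonneg fun _ => by positivity) h1 (inv_nonneg.2 P.r_pos.le)

theorem small_of_Q {ρ : ℝ} (hρ : 0 < ρ) : ∃ q > 0, ∀ u, P.Adm u → P.Q u ≤ q → ∀ x, |u x| < ρ := by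
  have h1 : Tendsto (fun q : ℝ => P.K * q ^ (P.r / P.p)) (𝓝[>] 0) (𝓝 0) := by
    have hc : Continuous fun q : ℝ => P.K * q ^ (P.r / P.p) :=
      continuous_const.mul (Real.continuous_rpow_const (div_nonneg P.r_pos.le P.p_pos.le))
    have := hc.tendsto 0
    rw [Real.zero_rpow (div_pos P.r_pos P.p_pos).ne', mul_zero] at this
    exact this.mono_left nhdsWithin_le_nhds
  obtain ⟨q, hq, hq0⟩ := ((h1.eventually (gt_mem_nhds (Real.rpow_pos_of_pos hρ P.r))).and
    self_mem_nhdsWithin).exists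
  refine ⟨q, hq0, fun u hu hQ x => ?_⟩
  by_contra hcon
  push Not at hcon
  have h2 := Real.rpow_le_rpow hρ.le hcon P.r_pos.le
  have h3 := (hu.abs_rpow_le x).trans hu.sobolev
  have h4 : P.K * P.Q u ^ (P.r / P.p) ≤ P.K * q ^ (P.r / P.p) :=
    mul_le_mul_of_nonneg_left (Real.rpow_le_rpow (Q_nonneg u) hQ
      (div_nonneg P.r_pos.le P.p_pos.le)) P.K_nonneg
  linarith

theorem Adm.Q_pos {u} (hu : P.Adm u) (h : u ≠ 0) : 0 < P.Q u := by
  refine (Q_nonneg u).lt_of_ne fun h0 => h ?_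
  funext x
  by_contra hx
  obtain ⟨q, hq, hh⟩ := P.small_of_Q (abs_pos.2 hx)
  exact lt_irrefl _ (hh u hu (h0 ▸ hq.le) x)

/-- In bounded sets, uniformly small functions have small potential energy. -/
theorem pot_le_of_small (B : ℝ) : ∃ ρ > 0, ∀ u, P.Adm u → P.Q u ≤ B → (∀ x, |u x| < ρ) →
    P.pot u ≤ P.Q u / (2 * P.p) := by
  -- As `r > p`, one factor `Q` splits off from `K * Q ^ (r / p)`, leaving at most `L` when `Q ≤ B`.
  set L := P.K * |B| ^ (P.r / P.p - 1) with hL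
  have hL0 : 0 ≤ L := mul_nonneg P.K_nonneg (by positivity)
  have hp := P.p_pos
  obtain ⟨ρ, hρ, hF⟩ := P.F_small (show 0 < 1 / (2 * P.p * (L + 1)) by positivity)
  refine ⟨ρ, hρ, fun u hu hQ hs => ?_⟩
  have h1 : P.pot u ≤ 1 / (2 * P.p * (L + 1)) * ∑' x, |u x| ^ P.r := by
    rw [← tsum_mul_left]
    exact hu.F_summable.tsum_le_tsum (fun x => hF x _ (hs x)) (hu.pow.mul_left _)
  have h2 : ∑' x, |u x| ^ P.r ≤ L * P.Q u := by
    refine hu.sobolev.trans ?_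
    rcases (Q_nonneg (P := P) u).eq_or_lt with h0 | h0
    · rw [← h0, Real.zero_rpow (div_pos P.r_pos P.p_pos).ne']; simp
    · have : P.Q u ^ (P.r / P.p) = P.Q u ^ (P.r / P.p - 1) * P.Q u := by
        rw [← Real.rpow_add_one h0.ne']; congr 1; ring
      rw [this, hL, mul_assoc P.K]
      refine mul_le_mul_of_nonneg_left (mul_le_mul_of_nonneg_right ?_ h0.le) P.K_nonneg
      refine Real.rpow_le_rpow h0.le (hQ.trans (le_abs_self B)) ?_
      rw [sub_nonneg, one_le_div hp]; exact P.p_lt_r.le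
  refine h1.trans ?_
  rw [one_div_mul_eq_div, div_le_div_iff₀ (by positivity) (by positivity)]
  have := Q_nonneg (P := P) u
  have h3 : (∑' x, |u x| ^ P.r) * (2 * P.p) ≤ (L * P.Q u) * (2 * P.p) :=
    mul_le_mul_of_nonneg_right h2 (by positivity)
  nlinarith [mul_nonneg this hp.le]

/-- Only the sup norm has to be small; `Q` may have any prescribed bound. This excludes vanishing of
Nehari sequences and makes the energy of uniformly small remainders nonnegative. -/
theorem J_ge_of_small (B : ℝ) : ∃ ρ > 0, ∀ u, P.Adm u → P.Q u ≤ B → (∀ x, |u x| < ρ) →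
    P.Q u / (2 * P.p) ≤ P.J u := by
  obtain ⟨ρ, hρ, h⟩ := P.pot_le_of_small B
  refine ⟨ρ, hρ, fun u hu hQ hs => ?_⟩
  have := h u hu hQ hs
  have h2 : P.Q u / P.p = P.Q u / (2 * P.p) + P.Q u / (2 * P.p) := by
    have := P.p_pos; field_simp; ring
  unfold J
  linarith

theorem J_ge_of_Q_small : ∃ q > 0, ∀ u, P.Adm u → P.Q u ≤ q → P.Q u / (2 * P.p) ≤ P.J u := by
  obtain ⟨ρ, hρ, h⟩ := P.J_ge_of_small 1
  obtain ⟨q, hq, h'⟩ := P.small_of_Q hρ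
  exact ⟨min q 1, by positivity, fun u hu hQ =>
    h u hu (hQ.trans (min_le_right _ _)) (h' u hu (hQ.trans (min_le_left _ _)))⟩

/-! ### Limits -/

/-- Fatou's lemma for sums: the bounds pass to the limit on every finite partial sum. -/
theorem adm_of_tendsto {B : ℝ} {y : ℕ → (Fin N → ℤ) → ℝ} {u : (Fin N → ℤ) → ℝ}
    (hy : ∀ n, P.Adm (y n)) (hB : ∀ n, P.Q (y n) ≤ B)
    (h : ∀ x, Tendsto (fun n => y n x) atTop (𝓝 (u x))) : P.Adm u ∧ P.Q u ≤ B := by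
  obtain ⟨M, -, hM⟩ := P.bound_of_Q B
  have h1 : ∀ s : Finset ι, ∑ e ∈ s, |P.form e u| ^ P.p ≤ B := fun s => by
    refine le_of_tendsto' (tendsto_finsetSum s fun e _ =>
      ((tendsto_form h e).abs).rpow_const (Or.inr P.p_pos.le)) fun n => ?_
    exact ((hy n).form.sum_le_tsum s fun _ _ => by positivity).trans (hB n)
  have h2 : ∀ s : Finset (Fin N → ℤ), ∑ x ∈ s, |u x| ^ P.r ≤ M := fun s => by
    refine le_of_tendsto' (tendsto_finsetSum s fun x _ =>
      ((h x).abs).rpow_const (Or.inr P.r_pos.le)) fun n => ?_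
    exact ((hy n).pow.sum_le_tsum s fun _ _ => by positivity).trans (hM _ (hy n) (hB n)).1
  have h3 := summable_of_sum_le (fun e => by positivity) h1
  exact ⟨⟨h3, summable_of_sum_le (fun e => by positivity) h2⟩, h3.tsum_le_of_sum_le h1⟩

/-- Continuity of the energy under dominated pointwise convergence. -/
theorem tendsto_J_of_dominated {y : ℕ → (Fin N → ℤ) → ℝ} {u : (Fin N → ℤ) → ℝ} {β : ι → ℝ}
    {γ : (Fin N → ℤ) → ℝ} (hβ : Summable fun e => β e ^ P.p) (hγ : Summable fun x => γ x ^ P.r)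
    (hyβ : ∀ n e, |P.form e (y n)| ≤ β e) (hyγ : ∀ n x, |y n x| ≤ γ x)
    (h : ∀ x, Tendsto (fun n => y n x) atTop (𝓝 (u x))) :
    Tendsto (fun n => P.J (y n)) atTop (𝓝 (P.J u)) := by
  have hγ0 : ∀ x, 0 ≤ γ x := fun x => (abs_nonneg _).trans (hyγ 0 x)
  refine Tendsto.sub (Tendsto.div_const ?_ _) ?_
  · refine tendsto_tsum_of_dominated_convergence hβ
      (fun e => ((tendsto_form h e).abs).rpow_const (Or.inr P.p_pos.le))
      (Eventually.of_forall fun n e => ?_)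
    rw [Real.norm_of_nonneg (by positivity)]
    exact Real.rpow_le_rpow (abs_nonneg _) (hyβ n e) P.p_pos.le
  · have hγM : ∀ x, γ x ≤ (∑' x, γ x ^ P.r) ^ P.r⁻¹ := fun x => by
      have h1 : γ x ^ P.r ≤ ∑' x, γ x ^ P.r :=
        hγ.le_tsum x fun y _ => Real.rpow_nonneg (hγ0 y) _
      have := Real.rpow_le_rpow (Real.rpow_nonneg (hγ0 x) _) h1 (inv_nonneg.2 P.r_pos.le)
      rwa [Real.rpow_rpow_inv (hγ0 x) P.r_pos.ne'] at this
    obtain ⟨C, hC0, hC⟩ := P.F_le ((∑' x, γ x ^ P.r) ^ P.r⁻¹)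
    refine tendsto_tsum_of_dominated_convergence (hγ.mul_left C)
      (fun x => ((continuous_F x).tendsto _).comp (h x)) (Eventually.of_forall fun n x => ?_)
    rw [Real.norm_of_nonneg (F_nonneg _ _)]
    exact (hC x _ ((hyγ n x).trans (hγM x))).trans (mul_le_mul_of_nonneg_left
      (Real.rpow_le_rpow (abs_nonneg _) (hyγ n x) P.r_pos.le) hC0)

/-- Brezis–Lieb splitting of the energy. -/
theorem tendsto_J_split {B S : ℝ} {y : ℕ → (Fin N → ℤ) → ℝ} {z : (Fin N → ℤ) → ℝ} {t : ℕ → ℝ}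
    (hy : ∀ n, P.Adm (y n)) (hB : ∀ n, P.Q (y n) ≤ B) (hz : P.Adm z) (ht : ∀ n, |t n| ≤ S)
    (h : ∀ x, Tendsto (fun n => y n x) atTop (𝓝 0)) :
    Tendsto (fun n => P.J (y n + t n • z) - P.J (y n) - P.J (t n • z)) atTop (𝓝 0) := by
  obtain ⟨M, hM0, hM⟩ := P.bound_of_Q B
  have hS : 0 ≤ S := (abs_nonneg _).trans (ht 0)
  have hz' : ∀ n e, |P.form e (t n • z)| ≤ S * |P.form e z| := fun n e => by
    rw [form_smul, abs_mul]; exact mul_le_mul_of_nonneg_right (ht n) (abs_nonneg _)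
  have hz'' : ∀ n x, |(t n • z) x| ≤ S * |z x| := fun n x => by
    rw [Pi.smul_apply, smul_eq_mul, abs_mul]
    exact mul_le_mul_of_nonneg_right (ht n) (abs_nonneg _)
  have hsp : Summable fun e => (S * |P.form e z|) ^ P.p := by
    simp_rw [Real.mul_rpow hS (abs_nonneg _)]; exact hz.form.mul_left _
  have hsr : Summable fun x => (S * |z x|) ^ P.r := by
    simp_rw [Real.mul_rpow hS (abs_nonneg _)]; exact hz.pow.mul_left _
  have h1 := tendsto_tsum_split (h := fun (_ : ι) t => |t| ^ P.p) (S := fun _ => True) (B := B)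
    P.p_pos trivial (fun _ => by simp [Real.zero_rpow P.p_pos.ne'])
    (fun ε hε => by
      obtain ⟨C, hC⟩ := splitting_abs_rpow P.one_lt_p.le hε
      exact ⟨C, fun _ a b _ _ => hC a b⟩)
    (a := fun n e => P.form e (y n)) (b := fun n e => P.form e (t n • z))
    (fun _ _ => trivial) (fun _ _ => trivial) hz' hsp (fun n => (hy n).form) hB
    (fun e => by simpa using tendsto_form (P := P) (u := 0) h e)
  set M' := max M (S * (∑' x, |z x| ^ P.r) ^ P.r⁻¹)
  have h2 := tendsto_tsum_split (h := P.F) (S := fun s => |s| ≤ M') (B := M)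
    P.r_pos (by rw [abs_zero]; exact hM0.trans (le_max_left _ _)) F_zero (fun ε hε => P.F_split M' hε)
    (a := y) (b := fun n x => (t n • z) x)
    (fun n x => ((hM _ (hy n) (hB n)).2 x).trans (le_max_left _ _))
    (fun n x => ((hz'' n x).trans (mul_le_mul_of_nonneg_left (hz.abs_le x) hS)).trans
      (le_max_right _ _)) hz'' hsr (fun n => (hy n).pow)
    (fun n => (hM _ (hy n) (hB n)).1) h
  have h3 := (h1.div_const P.p).sub h2
  rw [zero_div, sub_zero] at h3
  refine h3.congr fun n => ?_
  have htz := hz.smul (t n)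
  have hyz := (hy n).add htz
  have e1 : ∑' e, (|P.form e (y n) + P.form e (t n • z)| ^ P.p - |P.form e (y n)| ^ P.p -
      |P.form e (t n • z)| ^ P.p) = P.Q (y n + t n • z) - P.Q (y n) - P.Q (t n • z) := by
    have hs := hyz.form
    simp_rw [form_add] at hs
    rw [(hs.sub (hy n).form).tsum_sub htz.form, hs.tsum_sub (hy n).form]
    simp only [Q, form_add]
  have e2 : ∑' x, (P.F x (y n x + (t n • z) x) - P.F x (y n x) - P.F x ((t n • z) x)) =
      P.pot (y n + t n • z) - P.pot (y n) - P.pot (t n • z) := by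
    have hs : Summable fun x => P.F x (y n x + (t n • z) x) := hyz.F_summable
    rw [(hs.sub (hy n).F_summable).tsum_sub htz.F_summable, hs.tsum_sub (hy n).F_summable]
    rfl
  rw [e1, e2]
  unfold J
  ring

end LatticeProblem

namespace LatticeProblem

variable {N : ℕ} {ι : Type} {P : LatticeProblem N ι} {a b u : (Fin N → ℤ) → ℝ}

theorem summable_add_rpow {κ : Type*} {f g : κ → ℝ} {r : ℝ} (hr : 1 ≤ r) (hf0 : ∀ i, 0 ≤ f i)
    (hg0 : ∀ i, 0 ≤ g i) (hf : Summable fun i => f i ^ r) (hg : Summable fun i => g i ^ r) :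
    Summable fun i => (f i + g i) ^ r := by
  refine Summable.of_nonneg_of_le (fun i => Real.rpow_nonneg (add_nonneg (hf0 i) (hg0 i)) _)
    (fun i => ?_) ((hf.add hg).mul_left (2 ^ (r - 1)))
  have := abs_add_rpow_le hr (f i) (g i)
  rwa [abs_of_nonneg (hf0 i), abs_of_nonneg (hg0 i),
    abs_of_nonneg (add_nonneg (hf0 i) (hg0 i))] at this

theorem summable_mul_rpow {κ : Type*} {f : κ → ℝ} {r S : ℝ} (hS : 0 ≤ S)
    (hf0 : ∀ i, 0 ≤ f i) (hf : Summable fun i => f i ^ r) :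
    Summable fun i => (S * f i) ^ r := by
  simp_rw [Real.mul_rpow hS (hf0 _)]
  exact hf.mul_left _

/-! ### Pairs of functions with disjoint supports -/

/-- Admissible pairs with disjoint supports whose differences along edges have equal signs. -/
structure Compat (P : LatticeProblem N ι) (a b : (Fin N → ℤ) → ℝ) : Prop where
  left : P.Adm a
  right : P.Adm b
  form_mul : ∀ e, 0 ≤ P.form e a * P.form e b
  mul : ∀ x, a x * b x = 0

namespace Compat

theorem symm (h : P.Compat a b) : P.Compat b a :=
  ⟨h.right, h.left, fun e => by rw [mul_comm]; exact h.form_mul e,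
    fun x => by rw [mul_comm]; exact h.mul x⟩

/-- Makes a ray a degenerate cone, so that rays and two-dimensional cones share all later
statements. -/
theorem zero_right (h : P.Adm a) : P.Compat a 0 :=
  ⟨h, .zero, fun e => by simp, fun x => by simp⟩

theorem smul (h : P.Compat a b) {s t : ℝ} (hs : 0 ≤ s) (ht : 0 ≤ t) :
    P.Compat (s • a) (t • b) := by
  refine ⟨h.left.smul s, h.right.smul t, fun e => ?_, fun x => ?_⟩
  · rw [form_smul, form_smul, mul_mul_mul_comm]
    exact mul_nonneg (mul_nonneg hs ht) (h.form_mul e)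
  · rw [Pi.smul_apply, Pi.smul_apply, smul_eq_mul, smul_eq_mul, mul_mul_mul_comm, h.mul, mul_zero]

theorem abs_form (h : P.Compat a b) (e : ι) :
    |P.form e (a + b)| = |P.form e a| + |P.form e b| := by
  rw [form_add, abs_add_eq_add_abs_iff]
  rcases mul_nonneg_iff.1 (h.form_mul e) with h | h
  · exact Or.inl h
  · exact Or.inr h

theorem abs_form_smul (h : P.Compat a b) {s t : ℝ} (hs : 0 ≤ s) (ht : 0 ≤ t) (e : ι) :
    |P.form e (s • a + t • b)| = s * |P.form e a| + t * |P.form e b| := by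
  rw [(h.smul hs ht).abs_form, form_smul, form_smul, abs_mul, abs_mul, abs_of_nonneg hs,
    abs_of_nonneg ht]

theorem pot_add (h : P.Compat a b) : P.pot (a + b) = P.pot a + P.pot b := by
  unfold pot
  rw [← h.left.F_summable.tsum_add h.right.F_summable]
  congr 1; funext x
  rcases mul_eq_zero.1 (h.mul x) with h | h <;> simp [h, F_zero]

/-- Equal signs give `|form (a + b)| = |form a| + |form b|`, and `t ^ p` is superadditive on
nonnegative numbers. -/
theorem Q_add_ge (h : P.Compat a b) : P.Q a + P.Q b ≤ P.Q (a + b) := by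
  unfold Q
  rw [← h.left.form.tsum_add h.right.form]
  refine (h.left.form.add h.right.form).tsum_le_tsum (fun e => ?_) (h.left.add h.right).form
  rw [h.abs_form]
  exact Real.add_rpow_le_rpow_add (abs_nonneg _) (abs_nonneg _) P.one_lt_p.le

theorem J_add_ge (h : P.Compat a b) : P.J a + P.J b ≤ P.J (a + b) := by
  unfold J
  rw [h.pot_add]
  have := div_le_div_of_nonneg_right h.Q_add_ge P.p_pos.le
  rw [add_div] at this
  linarith

end Compat

theorem tendsto_J_comb {s t : ℕ → ℝ} {s₀ t₀ : ℝ} (ha : P.Adm a) (hb : P.Adm b)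
    (hs : Tendsto s atTop (𝓝 s₀)) (ht : Tendsto t atTop (𝓝 t₀)) :
    Tendsto (fun n => P.J (s n • a + t n • b)) atTop (𝓝 (P.J (s₀ • a + t₀ • b))) := by
  obtain ⟨S, hS⟩ := (Metric.isBounded_range_of_tendsto s hs).exists_norm_le
  obtain ⟨T, hT⟩ := (Metric.isBounded_range_of_tendsto t ht).exists_norm_le
  have hS' : ∀ n, |s n| ≤ S := fun n => hS _ ⟨n, rfl⟩
  have hT' : ∀ n, |t n| ≤ T := fun n => hT _ ⟨n, rfl⟩
  have hS0 : 0 ≤ S := (abs_nonneg _).trans (hS' 0)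
  have hT0 : 0 ≤ T := (abs_nonneg _).trans (hT' 0)
  refine tendsto_J_of_dominated (β := fun e => S * |P.form e a| + T * |P.form e b|)
    (γ := fun x => S * |a x| + T * |b x|) ?_ ?_ ?_ ?_ ?_
  · exact summable_add_rpow P.one_lt_p.le (fun _ => by positivity) (fun _ => by positivity)
      (summable_mul_rpow hS0 (fun _ => abs_nonneg _) ha.form)
      (summable_mul_rpow hT0 (fun _ => abs_nonneg _) hb.form)
  · exact summable_add_rpow P.one_lt_r.le (fun _ => by positivity) (fun _ => by positivity)
      (summable_mul_rpow hS0 (fun _ => abs_nonneg _) ha.pow)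
      (summable_mul_rpow hT0 (fun _ => abs_nonneg _) hb.pow)
  · intro n e
    rw [form_add, form_smul, form_smul]
    refine (abs_add_le _ _).trans ?_
    rw [abs_mul, abs_mul]
    exact add_le_add (mul_le_mul_of_nonneg_right (hS' n) (abs_nonneg _))
      (mul_le_mul_of_nonneg_right (hT' n) (abs_nonneg _))
  · intro n x
    refine (abs_add_le _ _).trans ?_
    simp only [Pi.smul_apply, smul_eq_mul, abs_mul]
    exact add_le_add (mul_le_mul_of_nonneg_right (hS' n) (abs_nonneg _))
      (mul_le_mul_of_nonneg_right (hT' n) (abs_nonneg _))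
  · intro x
    exact (hs.mul_const _).add (ht.mul_const _)

theorem continuous_J_comb (ha : P.Adm a) (hb : P.Adm b) :
    Continuous fun q : ℝ × ℝ => P.J (q.1 • a + q.2 • b) := by
  rw [continuous_iff_seqContinuous]
  intro q q₀ hq
  exact tendsto_J_comb ha hb (hq.fst_nhds) (hq.snd_nhds)

/-! ### Coercivity -/

/-- A single vertex with `|a x| ≥ κ` suffices: superlinearity of `F` there outweighs all of `Q`. The
factor `2 ^ (p - 1)` anticipates the bound of `Q (s a + t b)` by `Q (s a)` and `Q (t b)`. -/
theorem coercive_aux (B : ℝ) {κ : ℝ} (hκ : 0 < κ) : ∃ C, 0 ≤ C ∧ ∀ a, P.Adm a → P.Q a ≤ B →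
    (∃ x, κ ≤ |a x|) → ∀ s : ℝ, 0 ≤ s →
    2 ^ (P.p - 1) * P.Q (s • a) / P.p - P.pot (s • a) ≤ C - s ^ P.p := by
  have hp := P.p_pos
  set L : ℝ := 2 ^ (P.p - 1) * |B| / P.p with hL
  have hL0 : 0 ≤ L := by positivity
  -- The slope turns `|s * a x| ^ p ≥ s ^ p * κ ^ p` into `(L + 1) * s ^ p`: the share `L` cancels
  -- the energy term and `1` remains.
  obtain ⟨C, hC0, hC⟩ := P.F_lower ((L + 1) / κ ^ P.p) (by positivity)
  refine ⟨C, hC0, fun a ha hQ ⟨x, hx⟩ s hs => ?_⟩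
  have h1 := (ha.smul s).F_le_pot x
  have h2 := hC x ((s • a) x)
  have h3 : s ^ P.p * κ ^ P.p ≤ |(s • a) x| ^ P.p := by
    rw [Pi.smul_apply, smul_eq_mul, abs_mul, abs_of_nonneg hs, ← Real.mul_rpow hs hκ.le]
    exact Real.rpow_le_rpow (by positivity) (mul_le_mul_of_nonneg_left hx hs) hp.le
  have h4 : (L + 1) * s ^ P.p ≤ (L + 1) / κ ^ P.p * |(s • a) x| ^ P.p := by
    have := mul_le_mul_of_nonneg_left h3 (show 0 ≤ (L + 1) / κ ^ P.p by positivity)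
    refine le_trans (le_of_eq ?_) this
    have : 0 < κ ^ P.p := Real.rpow_pos_of_pos hκ _
    field_simp
  have h5 : 2 ^ (P.p - 1) * P.Q (s • a) / P.p ≤ L * s ^ P.p := by
    rw [Q_smul_of_nonneg hs, hL, div_mul_eq_mul_div]
    refine div_le_div_of_nonneg_right ?_ hp.le
    have : s ^ P.p * P.Q a ≤ s ^ P.p * |B| :=
      mul_le_mul_of_nonneg_left (hQ.trans (le_abs_self B)) (by positivity)
    have := mul_le_mul_of_nonneg_left this (show (0 : ℝ) ≤ 2 ^ (P.p - 1) by positivity)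
    linarith
  linarith

theorem coercive (B : ℝ) {κ : ℝ} (hκ : 0 < κ) : ∃ C, 0 ≤ C ∧ ∀ a b, P.Compat a b → P.Q a ≤ B →
    P.Q b ≤ B → (∃ x, κ ≤ |a x|) → (b = 0 ∨ ∃ x, κ ≤ |b x|) → ∀ s t : ℝ, 0 ≤ s → 0 ≤ t →
    P.J (s • a + t • b) ≤ C - s ^ P.p := by
  obtain ⟨C, hC0, hC⟩ := P.coercive_aux B hκ
  refine ⟨2 * C, by positivity, fun a b hab ha hb hax hbx s t hs ht => ?_⟩
  have h1 := hC a hab.left ha hax s hs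
  have h2 : 2 ^ (P.p - 1) * P.Q (t • b) / P.p - P.pot (t • b) ≤ C := by
    rcases hbx with rfl | hbx
    · rw [smul_zero, Q_zero, pot_zero]; simpa using hC0
    · have := hC b hab.right hb hbx t ht
      have : 0 ≤ t ^ P.p := by positivity
      linarith
  have h3 := (hab.left.smul s).Q_add_le (hab.right.smul t)
  have h4 := div_le_div_of_nonneg_right h3 P.p_pos.le
  have h5 : 2 ^ (P.p - 1) * (P.Q (s • a) + P.Q (t • b)) / P.p =
    2 ^ (P.p - 1) * P.Q (s • a) / P.p + 2 ^ (P.p - 1) * P.Q (t • b) / P.p := by ring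
  unfold J
  rw [(hab.smul hs ht).pot_add]
  linarith

theorem coercive_bound (B : ℝ) {κ : ℝ} (hκ : 0 < κ) : ∃ S : ℝ, 0 < S ∧ ∀ a b, P.Compat a b →
    P.Q a ≤ B → P.Q b ≤ B → (∃ x, κ ≤ |a x|) → (b = 0 ∨ ∃ x, κ ≤ |b x|) → ∀ s t : ℝ, 0 ≤ s → 0 ≤ t →
    0 ≤ P.J (s • a + t • b) → s ≤ S := by
  obtain ⟨C, hC0, hC⟩ := P.coercive B hκ
  refine ⟨(C + 1) ^ P.p⁻¹, by positivity, fun a b hab ha hb hax hbx s t hs ht h => ?_⟩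
  have h1 := hC a b hab ha hb hax hbx s t hs ht
  have h2 : s ^ P.p ≤ C + 1 := by linarith
  have := Real.rpow_le_rpow (by positivity) h2 (inv_nonneg.2 P.p_pos.le)
  rwa [Real.rpow_rpow_inv hs P.p_pos.ne'] at this

/-! ### Scaling -/

theorem J_smul_ge (hu : P.Adm u) {t : ℝ} (ht : 0 ≤ t) (ht1 : t ≤ 1) :
    t ^ P.p * P.J u ≤ P.J (t • u) := by
  have h1 : P.pot (t • u) ≤ t ^ P.p * P.pot u := by
    unfold pot
    rw [← tsum_mul_left]
    exact (hu.smul t).F_summable.tsum_le_tsum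
      (fun x => (P.f_pm x).primitive_mul_le P.one_lt_p ht ht1 _) (hu.F_summable.mul_left _)
  unfold J
  rw [Q_smul_of_nonneg ht, mul_sub, mul_div_assoc]
  linarith

theorem J_smul_le_smul (hu : P.Adm u) {s t : ℝ} (ht : 0 ≤ t) (hs : 0 < s) (hts : t ≤ s) :
    (t / s) ^ P.p * P.J (s • u) ≤ P.J (t • u) := by
  have := J_smul_ge (hu.smul s) (div_nonneg ht hs.le) ((div_le_one hs).2 hts)
  rwa [smul_smul, div_mul_cancel₀ _ hs.ne'] at this

/-- Scale `u` onto the sphere `Q = q` on which `J ≥ q / (2 * p)`; this constant does not depend on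
`u`. -/
theorem exists_scale_J_ge (P : LatticeProblem N ι) :
    ∃ c > 0, ∀ u, P.Adm u → u ≠ 0 → ∃ s : ℝ, 0 < s ∧ c ≤ P.J (s • u) := by
  obtain ⟨q, hq, h⟩ := P.J_ge_of_Q_small
  have hp := P.p_pos
  refine ⟨q / (2 * P.p), by positivity, fun u hu h0 => ?_⟩
  have hQ := hu.Q_pos h0
  refine ⟨(q / P.Q u) ^ P.p⁻¹, by positivity, ?_⟩
  have h1 : P.Q ((q / P.Q u) ^ P.p⁻¹ • u) = q := by
    rw [Q_smul_of_nonneg (by positivity), Real.rpow_inv_rpow (by positivity) hp.ne',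
      div_mul_cancel₀ _ hQ.ne']
  have := h _ (hu.smul _) h1.le
  rwa [h1] at this

/-! ### Maximisers on two-dimensional cones -/

/-- Coercivity confines the search to a compact set. For `b = 0` the second coefficient is
irrelevant and is normalised to `1`, which later forces its limit. -/
theorem Compat.exists_max (h : P.Compat a b) (ha : a ≠ 0) : ∃ s t : ℝ, 0 < s ∧ 0 < t ∧
    (b = 0 → t = 1) ∧
    ∀ s' t' : ℝ, 0 ≤ s' → 0 ≤ t' → P.J (s' • a + t' • b) ≤ P.J (s • a + t • b) := by
  -- If the coefficient of `a` were `0`, adding a multiple of `a` with positive energy would raise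
  -- `J` by superadditivity.
  have hpos : ∀ {a b : (Fin N → ℤ) → ℝ}, P.Compat a b → a ≠ 0 → ∀ s t : ℝ, 0 ≤ s → 0 ≤ t →
      (∀ s' t' : ℝ, 0 ≤ s' → 0 ≤ t' → P.J (s' • a + t' • b) ≤ P.J (s • a + t • b)) → 0 < s := by
    intro a b h ha s t hs ht hmax
    refine hs.lt_of_ne fun h0 => ?_
    obtain ⟨c, hc, hsc⟩ := P.exists_scale_J_ge
    obtain ⟨s', hs', hJ⟩ := hsc a h.left ha
    have h1 := hmax s' t hs'.le ht
    have h2 := (h.smul hs'.le ht).J_add_ge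
    rw [← h0, zero_smul, zero_add] at h1
    linarith
  obtain ⟨x, hx⟩ := Function.ne_iff.1 ha
  have hx' : 0 < |a x| := abs_pos.2 hx
  have hg := continuous_J_comb h.left h.right
  by_cases hb : b = 0
  · obtain ⟨S, hS0, hS⟩ := P.coercive_bound (max (P.Q a) (P.Q b)) hx'
    obtain ⟨s, hs, hmax⟩ := (isCompact_Icc (a := (0 : ℝ)) (b := S)).exists_isMaxOn
      (Set.nonempty_Icc.2 hS0.le)
      (f := fun s => P.J (s • a + (1 : ℝ) • b))
      (hg.comp (continuous_id.prodMk continuous_const)).continuousOn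
    have hmax' : ∀ s' t' : ℝ, 0 ≤ s' → 0 ≤ t' →
        P.J (s' • a + t' • b) ≤ P.J (s • a + (1 : ℝ) • b) := by
      intro s' t' hs' ht'
      have h0 : P.J (s' • a + t' • b) = P.J (s' • a + (1 : ℝ) • b) := by rw [hb]; simp
      rw [h0]
      by_cases hneg : 0 ≤ P.J (s' • a + (1 : ℝ) • b)
      · exact hmax ⟨hs', hS a b h (le_max_left _ _) (le_max_right _ _) ⟨x, le_rfl⟩ (Or.inl hb)
          s' 1 hs' zero_le_one hneg⟩
      · have h1 : P.J ((0 : ℝ) • a + (1 : ℝ) • b) ≤ P.J (s • a + (1 : ℝ) • b) :=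
          hmax ⟨le_rfl, hS0.le⟩
        have h2 : P.J ((0 : ℝ) • a + (1 : ℝ) • b) = 0 := by rw [hb]; simp [J_zero]
        linarith
    exact ⟨s, 1, hpos h ha s 1 hs.1 zero_le_one hmax', one_pos, fun _ => rfl, hmax'⟩
  · obtain ⟨y, hy⟩ := Function.ne_iff.1 hb
    have hy' : 0 < |b y| := abs_pos.2 hy
    obtain ⟨S, hS0, hS⟩ := P.coercive_bound (max (P.Q a) (P.Q b)) (lt_min hx' hy')
    obtain ⟨q, hq, hmax⟩ := ((isCompact_Icc (a := (0 : ℝ)) (b := S)).prod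
      (isCompact_Icc (a := (0 : ℝ)) (b := S))).exists_isMaxOn
      ⟨(0, 0), ⟨le_rfl, hS0.le⟩, ⟨le_rfl, hS0.le⟩⟩ hg.continuousOn
    have hmax' : ∀ s' t' : ℝ, 0 ≤ s' → 0 ≤ t' →
        P.J (s' • a + t' • b) ≤ P.J (q.1 • a + q.2 • b) := by
      intro s' t' hs' ht'
      by_cases hneg : 0 ≤ P.J (s' • a + t' • b)
      · have h1 := hS a b h (le_max_left _ _) (le_max_right _ _) ⟨x, min_le_left _ _⟩
          (Or.inr ⟨y, min_le_right _ _⟩) s' t' hs' ht' hneg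
        have h2 := hS b a h.symm (le_max_right _ _) (le_max_left _ _) ⟨y, min_le_right _ _⟩
          (Or.inr ⟨x, min_le_left _ _⟩) t' s' ht' hs' (by rwa [add_comm])
        exact hmax (a := (s', t')) ⟨⟨hs', h1⟩, ⟨ht', h2⟩⟩
      · have h1 : P.J ((0 : ℝ) • a + (0 : ℝ) • b) ≤ P.J (q.1 • a + q.2 • b) :=
          hmax (a := (0, 0)) ⟨⟨le_rfl, hS0.le⟩, ⟨le_rfl, hS0.le⟩⟩
        simp only [zero_smul, add_zero, J_zero] at h1
        linarith
    refine ⟨q.1, q.2, hpos h ha _ _ hq.1.1 hq.2.1 hmax', ?_, fun h0 => absurd h0 hb, hmax'⟩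
    refine hpos h.symm hb q.2 q.1 hq.2.1 hq.1.1 fun t' s' ht' hs' => ?_
    rw [add_comm, add_comm (q.2 • b)]
    exact hmax' s' t' hs' ht'

/-- Minkowski's inequality in `ℓ^p` on two points for the vectors `(s₁, s₂) * A` and `(t₁, t₂) * B`:
it is midpoint concavity in the variables `s ^ p`, `t ^ p`. -/
theorem add_rpow_powMean_ge {p : ℝ} (hp : 1 ≤ p) {A B s₁ s₂ t₁ t₂ : ℝ} (hA : 0 ≤ A) (hB : 0 ≤ B)
    (hs₁ : 0 ≤ s₁) (hs₂ : 0 ≤ s₂) (ht₁ : 0 ≤ t₁) (ht₂ : 0 ≤ t₂) :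
    (s₁ * A + t₁ * B) ^ p + (s₂ * A + t₂ * B) ^ p ≤
      2 * (powMean p s₁ s₂ * A + powMean p t₁ t₂ * B) ^ p := by
  have hp0 : 0 < p := by linarith
  have h := Real.Lp_add_le_of_nonneg (s := Finset.univ) (f := ![s₁ * A, s₂ * A])
    (g := ![t₁ * B, t₂ * B]) hp
    (by intro i _; fin_cases i <;> simp <;> positivity)
    (by intro i _; fin_cases i <;> simp <;> positivity)
  simp only [Fin.sum_univ_two, Matrix.cons_val_zero, Matrix.cons_val_one] at h
  have key : ∀ s₁ s₂ A : ℝ, 0 ≤ s₁ → 0 ≤ s₂ → 0 ≤ A →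
      ((s₁ * A) ^ p + (s₂ * A) ^ p) ^ (1 / p) = 2 ^ p⁻¹ * (powMean p s₁ s₂ * A) := by
    intro s₁ s₂ A h1 h2 h3
    rw [Real.mul_rpow h1 h3, Real.mul_rpow h2 h3, ← add_mul, one_div,
      Real.mul_rpow (by positivity) (by positivity), Real.rpow_rpow_inv h3 hp0.ne', ← mul_assoc]
    unfold powMean
    rw [← Real.mul_rpow (by positivity) (by positivity)]
    congr 3; ring
  rw [key _ _ _ hs₁ hs₂ hA, key _ _ _ ht₁ ht₂ hB, ← mul_add] at h
  have h2 := Real.rpow_le_rpow (by positivity) h hp0.le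
  have hm1 : 0 ≤ powMean p s₁ s₂ := powMean_nonneg hs₁ hs₂
  have hm2 : 0 ≤ powMean p t₁ t₂ := powMean_nonneg ht₁ ht₂
  rwa [one_div, Real.rpow_inv_rpow (by positivity) hp0.ne',
    Real.mul_rpow (by positivity) (by positivity), Real.rpow_inv_rpow two_pos.le hp0.ne'] at h2

theorem pot_powMean_le (ha : P.Adm a) {s t : ℝ} (hs : 0 ≤ s) (ht : 0 ≤ t) :
    2 * P.pot (powMean P.p s t • a) ≤ P.pot (s • a) + P.pot (t • a) := by
  unfold pot
  rw [← (ha.smul s).F_summable.tsum_add (ha.smul t).F_summable, ← tsum_mul_left]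
  exact ((ha.smul _).F_summable.mul_left 2).tsum_le_tsum
    (fun x => (P.f_pm x).primitive_powMean_le P.one_lt_p hs ht)
    ((ha.smul s).F_summable.add (ha.smul t).F_summable)

theorem pot_powMean_lt (ha : P.Adm a) (h0 : a ≠ 0) {s t : ℝ} (hs : 0 ≤ s) (ht : 0 ≤ t)
    (hst : s ≠ t) :
    2 * P.pot (powMean P.p s t • a) < P.pot (s • a) + P.pot (t • a) := by
  obtain ⟨x, hx⟩ := Function.ne_iff.1 h0
  unfold pot
  rw [← (ha.smul s).F_summable.tsum_add (ha.smul t).F_summable, ← tsum_mul_left]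
  exact Summable.tsum_lt_tsum (i := x)
    (fun x => (P.f_pm x).primitive_powMean_le P.one_lt_p hs ht)
    ((P.f_pm x).primitive_powMean_lt P.one_lt_p hx hs ht hst)
    ((ha.smul _).F_summable.mul_left 2) ((ha.smul s).F_summable.add (ha.smul t).F_summable)

theorem Compat.Q_powMean_ge (h : P.Compat a b) {s₁ s₂ t₁ t₂ : ℝ}
    (hs₁ : 0 ≤ s₁) (hs₂ : 0 ≤ s₂) (ht₁ : 0 ≤ t₁) (ht₂ : 0 ≤ t₂) :
    P.Q (s₁ • a + t₁ • b) + P.Q (s₂ • a + t₂ • b) ≤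
      2 * P.Q (powMean P.p s₁ s₂ • a + powMean P.p t₁ t₂ • b) := by
  have h1 := ((h.left.smul s₁).add (h.right.smul t₁)).form
  have h2 := ((h.left.smul s₂).add (h.right.smul t₂)).form
  unfold Q
  rw [← h1.tsum_add h2, ← tsum_mul_left]
  refine (h1.add h2).tsum_le_tsum (fun e => ?_)
    (((h.left.smul _).add (h.right.smul _)).form.mul_left 2)
  rw [h.abs_form_smul hs₁ ht₁, h.abs_form_smul hs₂ ht₂,
    h.abs_form_smul (powMean_nonneg hs₁ hs₂) (powMean_nonneg ht₁ ht₂)]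
  exact add_rpow_powMean_ge P.one_lt_p.le (abs_nonneg _) (abs_nonneg _) hs₁ hs₂ ht₁ ht₂

/-- At the power mean of two maximisers, twice `Q` is at least the sum of the two values while twice
`pot` is strictly less if the coefficients of `a` differ. The other coefficient is treated by
exchanging `a` and `b`. -/
theorem Compat.max_unique (h : P.Compat a b) (ha : a ≠ 0) {s₁ s₂ t₁ t₂ : ℝ}
    (hs₁ : 0 ≤ s₁) (hs₂ : 0 ≤ s₂) (ht₁ : 0 ≤ t₁) (ht₂ : 0 ≤ t₂)
    (h1 : ∀ s' t' : ℝ, 0 ≤ s' → 0 ≤ t' → P.J (s' • a + t' • b) ≤ P.J (s₁ • a + t₁ • b))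
    (h2 : P.J (s₁ • a + t₁ • b) ≤ P.J (s₂ • a + t₂ • b)) : s₁ = s₂ := by
  by_contra hne
  have hm1 := powMean_nonneg (p := P.p) hs₁ hs₂
  have hm2 := powMean_nonneg (p := P.p) ht₁ ht₂
  have h3 := h1 _ _ hm1 hm2
  have h4 := pot_powMean_lt h.left ha hs₁ hs₂ hne
  have h5 := pot_powMean_le h.right ht₁ ht₂
  have h6 := div_le_div_of_nonneg_right (h.Q_powMean_ge hs₁ hs₂ ht₁ ht₂) P.p_pos.le
  rw [add_div, mul_div_assoc] at h6
  unfold J at h2 h3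
  rw [(h.smul hs₁ ht₁).pot_add] at h2 h3
  rw [(h.smul hs₂ ht₂).pot_add] at h2
  rw [(h.smul hm1 hm2).pot_add] at h3
  linarith

/-! ### The Nehari set -/

/-- Functions at which the energy is maximal along their ray. -/
structure Neh (P : LatticeProblem N ι) (u : (Fin N → ℤ) → ℝ) : Prop where
  adm : P.Adm u
  ne_zero : u ≠ 0
  max : ∀ t : ℝ, 0 ≤ t → P.J (t • u) ≤ P.J u

theorem Adm.exists_neh (hu : P.Adm u) (h0 : u ≠ 0) : ∃ s : ℝ, 0 < s ∧ P.Neh (s • u) := by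
  obtain ⟨s, t, hs, -, -, hmax⟩ := (Compat.zero_right hu).exists_max h0
  refine ⟨s, hs, hu.smul s, smul_ne_zero hs.ne' h0, fun t ht => ?_⟩
  have := hmax (t * s) 0 (by positivity) le_rfl
  simpa [smul_smul] using this

theorem Neh.eq_one (h : P.Neh u) {s : ℝ} (hs : 0 ≤ s) (h2 : P.J u ≤ P.J (s • u)) : s = 1 := by
  refine ((Compat.zero_right h.adm).max_unique h.ne_zero (s₁ := 1) (t₁ := 0) (t₂ := 0)
    zero_le_one hs le_rfl le_rfl (fun s' t' hs' _ => ?_) ?_).symm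
  · simpa using h.max s' hs'
  · simpa using h2

/-- The ground state level. -/
noncomputable def level (P : LatticeProblem N ι) : ℝ := sInf (P.J '' {u | P.Neh u})

theorem Neh.exists_lower (P : LatticeProblem N ι) : ∃ c > 0, ∀ u, P.Neh u → c ≤ P.J u := by
  obtain ⟨c, hc, h⟩ := P.exists_scale_J_ge
  refine ⟨c, hc, fun u hu => ?_⟩
  obtain ⟨s, hs, hJ⟩ := h u hu.adm hu.ne_zero
  exact hJ.trans (hu.max s hs.le)

theorem exists_neh (P : LatticeProblem N ι) : ∃ u, P.Neh u := by
  have h : P.Adm (Pi.single 0 1) := .of_finite_support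
    ((Set.finite_singleton (0 : Fin N → ℤ)).subset fun x hx => by
      by_contra h0
      exact hx (Pi.single_eq_of_ne h0 _))
  obtain ⟨s, -, hs⟩ := h.exists_neh (fun h0 => by simpa using congrFun h0 0)
  exact ⟨_, hs⟩

theorem Neh.level_le (h : P.Neh u) : P.level ≤ P.J u := by
  obtain ⟨c, _, hc⟩ := Neh.exists_lower P
  exact csInf_le ⟨c, by rintro _ ⟨v, hv, rfl⟩; exact hc v hv⟩ ⟨u, h, rfl⟩

theorem level_pos (P : LatticeProblem N ι) : 0 < P.level := by
  obtain ⟨c, hc0, hc⟩ := Neh.exists_lower P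
  obtain ⟨u, hu⟩ := P.exists_neh
  exact hc0.trans_le (le_csInf ⟨_, u, hu, rfl⟩ (by rintro _ ⟨v, hv, rfl⟩; exact hc v hv))

theorem exists_J_lt (P : LatticeProblem N ι) {δ : ℝ} (hδ : 0 < δ) :
    ∃ u, P.Neh u ∧ P.J u < P.level + δ := by
  obtain ⟨u, hu⟩ := P.exists_neh
  obtain ⟨_, ⟨v, hv, rfl⟩, h⟩ := exists_lt_of_csInf_lt (s := P.J '' {u | P.Neh u}) ⟨_, u, hu, rfl⟩
    (show sInf (P.J '' {u | P.Neh u}) < P.level + δ by unfold level; linarith)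
  exact ⟨v, hv, h⟩

/-- Rescale `u` to `Q = R ^ p`. The result cannot be uniformly small, as its energy would exceed
`C`; so some `|u x| ^ p` is at least a fixed multiple of `Q u`. Superlinearity at this vertex and `J
u ≥ 0` then bound `Q u`. -/
theorem Neh.bound (P : LatticeProblem N ι) (C : ℝ) :
    ∃ B, ∀ u, P.Neh u → P.J u ≤ C → P.Q u ≤ B := by
  have hp := P.p_pos
  -- Chosen so that `R ^ p / (2 * p) = |C| + 1`.
  set R := (2 * P.p * (|C| + 1)) ^ P.p⁻¹ with hR
  have hR0 : 0 < R := by positivity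
  have hRp : R ^ P.p = 2 * P.p * (|C| + 1) := Real.rpow_inv_rpow (by positivity) hp.ne'
  obtain ⟨ρ, hρ, hsm⟩ := P.J_ge_of_small (R ^ P.p)
  obtain ⟨D, hD0, hD⟩ := P.F_lower (2 * R ^ P.p / (P.p * ρ ^ P.p)) (by positivity)
  refine ⟨P.p * D, fun u hu hJ => ?_⟩
  have hQ := hu.adm.Q_pos hu.ne_zero
  set l := P.Q u ^ P.p⁻¹ with hl
  have hl0 : 0 < l := Real.rpow_pos_of_pos hQ _
  have hlp : l ^ P.p = P.Q u := Real.rpow_inv_rpow hQ.le hp.ne'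
  have hQv : P.Q ((R / l) • u) = R ^ P.p := by
    rw [Q_smul_of_nonneg (by positivity), Real.div_rpow hR0.le hl0.le, hlp,
      div_mul_cancel₀ _ hQ.ne']
  obtain ⟨x, hx⟩ : ∃ x, ρ ≤ |((R / l) • u) x| := by
    by_contra hcon
    push Not at hcon
    have h1 := hsm _ (hu.adm.smul _) hQv.le hcon
    rw [hQv, hRp, mul_div_cancel_left₀ _ (by positivity)] at h1
    have := hu.max (R / l) (by positivity)
    have := le_abs_self C
    linarith
  rw [Pi.smul_apply, smul_eq_mul, abs_mul, abs_of_pos (by positivity)] at hx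
  have h2 : ρ ^ P.p ≤ R ^ P.p / P.Q u * |u x| ^ P.p := by
    have := Real.rpow_le_rpow hρ.le hx hp.le
    rwa [Real.mul_rpow (by positivity) (abs_nonneg _), Real.div_rpow hR0.le hl0.le, hlp] at this
  have h3 := hD x (u x)
  have h4 := hu.adm.F_le_pot x
  have h5 : 0 ≤ P.J u := P.level_pos.le.trans hu.level_le
  have h6 : 2 * P.Q u / P.p ≤ 2 * R ^ P.p / (P.p * ρ ^ P.p) * |u x| ^ P.p := by
    have hρp : 0 < ρ ^ P.p := Real.rpow_pos_of_pos hρ _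
    rw [div_mul_eq_mul_div, le_div_iff₀ hQ] at h2
    rw [div_mul_eq_mul_div, div_le_div_iff₀ hp (by positivity)]
    have := mul_le_mul_of_nonneg_left h2 (show 0 ≤ 2 * P.p by positivity)
    linarith
  unfold J at h5
  have h7 : P.Q u / P.p ≤ D := by
    rw [mul_div_assoc] at h6
    linarith
  rwa [div_le_iff₀ hp, mul_comm] at h7

/-- If `u` were uniformly small, then `J (2 u) ≥ 2 ^ p * Q u / (2 * p) ≥ 2 * Q u / p > J u`, as `2 ^
p ≥ 4`; this contradicts maximality along the ray. -/
theorem Neh.nonvanishing (P : LatticeProblem N ι) (C : ℝ) :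
    ∃ ρ > 0, ∀ u, P.Neh u → P.J u ≤ C → ∃ x, ρ ≤ |u x| := by
  obtain ⟨B, hB⟩ := Neh.bound P C
  obtain ⟨ρ, hρ, hsm⟩ := P.J_ge_of_small (2 ^ P.p * B)
  have hp := P.p_pos
  refine ⟨ρ / 2, by positivity, fun u hu hJ => ?_⟩
  by_contra hcon
  push Not at hcon
  have hQ := hu.adm.Q_pos hu.ne_zero
  have hQ2 : P.Q ((2 : ℝ) • u) = 2 ^ P.p * P.Q u := Q_smul_of_nonneg two_pos.le u
  have h1 := hsm ((2 : ℝ) • u) (hu.adm.smul 2)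
    (by rw [hQ2]; exact mul_le_mul_of_nonneg_left (hB u hu hJ) (by positivity))
    (fun x => by
      rw [Pi.smul_apply, smul_eq_mul, abs_mul, abs_two]; have := hcon x; linarith)
  have h2 := hu.max 2 two_pos.le
  have h3 : P.J u ≤ P.Q u / P.p := by have := P.pot_nonneg u; unfold J; linarith
  have h4 : (2 : ℝ) ^ (2 : ℝ) ≤ 2 ^ P.p := Real.rpow_le_rpow_of_exponent_le one_le_two P.two_le
  rw [show ((2 : ℝ) ^ (2 : ℝ)) = 4 by norm_num] at h4
  rw [hQ2] at h1
  have h5 : 2 * (P.Q u / P.p) ≤ 2 ^ P.p * P.Q u / (2 * P.p) := by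
    rw [← mul_div_assoc, div_le_div_iff₀ hp (by positivity)]
    nlinarith [mul_pos hQ hp]
  have h6 : 0 < P.Q u / P.p := by positivity
  linarith

end LatticeProblem

namespace LatticeProblem

variable {N : ℕ} {ι : Type} {P : LatticeProblem N ι} {a b u : (Fin N → ℤ) → ℝ}

/-! ### Translations -/

/-- Translation by `T k`. -/
def shift (P : LatticeProblem N ι) (k : Fin N → ℤ) (u : (Fin N → ℤ) → ℝ) : (Fin N → ℤ) → ℝ :=
  fun x => u (x - (P.T : ℤ) • k)

theorem form_shift (k : Fin N → ℤ) (e : ι) (u) :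
    P.form (P.shiftE k e) (P.shift k u) = P.form e u := by
  simp [form, shift, P.hd_shift, P.tl_shift, P.A_shift, P.B_shift]

theorem shift_smul (k : Fin N → ℤ) (t : ℝ) (u) : P.shift k (t • u) = t • P.shift k u := rfl

theorem shift_shift (k l : Fin N → ℤ) (u) : P.shift k (P.shift l u) = P.shift (k + l) u := by
  funext x
  simp only [shift, smul_add]
  congr 1; abel

theorem shift_zero (u) : P.shift 0 u = u := by
  funext x; simp [shift]

theorem shift_ne_zero (k : Fin N → ℤ) (h : u ≠ 0) : P.shift k u ≠ 0 := by
  obtain ⟨x, hx⟩ := Function.ne_iff.1 h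
  exact Function.ne_iff.2 ⟨x + (P.T : ℤ) • k, by simpa [shift] using hx⟩

theorem Adm.shift (h : P.Adm u) (k : Fin N → ℤ) : P.Adm (P.shift k u) := by
  constructor
  · rw [← (P.shiftE k).summable_iff]
    refine h.form.congr fun e => ?_
    rw [Function.comp_apply, form_shift]
  · exact (Equiv.subRight ((P.T : ℤ) • k)).summable_iff.2 h.pow

theorem Q_shift (k : Fin N → ℤ) (u) : P.Q (P.shift k u) = P.Q u := by
  unfold Q
  rw [← (P.shiftE k).tsum_eq]
  simp_rw [form_shift]

theorem pot_shift (k : Fin N → ℤ) (u) : P.pot (P.shift k u) = P.pot u := by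
  unfold pot
  rw [← (Equiv.addRight ((P.T : ℤ) • k)).tsum_eq]
  refine tsum_congr fun x => ?_
  change primitive (P.f (x + (P.T : ℤ) • k)) (u (x + (P.T : ℤ) • k - (P.T : ℤ) • k)) = _
  rw [P.f_shift, add_sub_cancel_right, F]

theorem J_shift (k : Fin N → ℤ) (u) : P.J (P.shift k u) = P.J u := by
  unfold J; rw [Q_shift, pot_shift]

theorem Neh.shift (h : P.Neh u) (k : Fin N → ℤ) : P.Neh (P.shift k u) :=
  ⟨h.adm.shift k, shift_ne_zero k h.ne_zero, fun t ht => by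
    rw [← shift_smul, J_shift, J_shift]; exact h.max t ht⟩

/-! ### Ground states and compactness -/

/-- Nonnegative functions of minimal energy in the Nehari set. -/
structure IsGround (P : LatticeProblem N ι) (w : (Fin N → ℤ) → ℝ) : Prop where
  neh : P.Neh w
  nonneg : ∀ x, 0 ≤ w x
  J_eq : P.J w = P.level

theorem IsGround.shift (h : P.IsGround u) (k : Fin N → ℤ) : P.IsGround (P.shift k u) :=
  ⟨h.neh.shift k, fun _ => h.nonneg _, by rw [J_shift, h.J_eq]⟩

theorem exists_subseq_pointwise {X : Type*} [Countable X] {v : ℕ → X → ℝ} {M : ℝ}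
    (h : ∀ n x, |v n x| ≤ M) : ∃ (u : X → ℝ) (φ : ℕ → ℕ), StrictMono φ ∧
      ∀ x, Tendsto (fun n => v (φ n) x) atTop (𝓝 (u x)) := by
  obtain ⟨u, -, φ, hφ, hu⟩ := (isCompact_univ_pi fun _ : X =>
    isCompact_Icc (a := -M) (b := M)).tendsto_subseq (x := v) fun n x _ => abs_le.1 (h n x)
  exact ⟨u, φ, hφ, tendsto_pi_nhds.1 hu⟩

/-- A remainder `v n - u` that is not uniformly small has a Nehari multiple with scale bounded above
and away from `0`. So has `u`, and splitting then gives `v n` energy above `level` by a fixed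
amount. -/
theorem eventually_small_of_min {B : ℝ} {v : ℕ → (Fin N → ℤ) → ℝ} (hv : ∀ n, P.Neh (v n))
    (hB : ∀ n, P.Q (v n) ≤ B) (hJ : Tendsto (fun n => P.J (v n)) atTop (𝓝 P.level))
    (hu : P.Adm u) (hu0 : u ≠ 0) (hlim : ∀ x, Tendsto (fun n => v n x) atTop (𝓝 (u x)))
    {κ : ℝ} (hκ : 0 < κ) : ∀ᶠ n in atTop, ∀ x, |v n x - u x| < κ := by
  have hp := P.p_pos
  have hc := P.level_pos
  have hQu : P.Q u ≤ B := (adm_of_tendsto (fun n => (hv n).adm) hB hlim).2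
  have hB0 : 0 ≤ B := (Q_nonneg u).trans hQu
  set B' := 2 ^ (P.p - 1) * (B + B) with hB'
  have hB'0 : 0 ≤ B' := by positivity
  have hy : ∀ n, P.Adm (v n - u) := fun n => (hv n).adm.sub hu
  have hyB : ∀ n, P.Q (v n - u) ≤ B' := fun n => ((hv n).adm.Q_sub_le hu).trans
    (mul_le_mul_of_nonneg_left (add_le_add (hB n) hQu) (by positivity))
  obtain ⟨t, ht, htu⟩ := hu.exists_neh hu0
  by_contra hcon
  simp only [not_eventually, not_forall, not_lt] at hcon
  obtain ⟨ψ, hψ, hψx⟩ := extraction_of_frequently_atTop hcon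
  obtain ⟨S, hS0, hS⟩ := P.coercive_bound B' hκ
  have hex : ∀ n, ∃ s : ℝ, 0 < s ∧ P.Neh (s • (v (ψ n) - u)) := fun n => by
    refine (hy (ψ n)).exists_neh fun h0 => ?_
    obtain ⟨x, hx⟩ := hψx n
    have : v (ψ n) x - u x = 0 := congrFun h0 x
    rw [this, abs_zero] at hx
    linarith
  choose s hs hsN using hex
  have hsS : ∀ n, s n ≤ S := fun n => by
    refine hS _ 0 (Compat.zero_right (hy (ψ n))) (hyB _) (by rw [Q_zero]; exact hB'0) (hψx n)
      (Or.inl rfl) (s n) 0 (hs n).le le_rfl ?_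
    rw [smul_zero, add_zero]
    exact hc.le.trans (hsN n).level_le
  set s₀ := (P.level * P.p / (B' + 1)) ^ P.p⁻¹ with hs₀
  have hs₀0 : 0 < s₀ := by positivity
  -- From `level ≤ J (s y) ≤ s ^ p * Q y / p` and the bound on `Q y`.
  have hs₀s : ∀ n, s₀ ≤ s n := fun n => by
    have h1 := (hsN n).level_le
    have h2 : P.J (s n • (v (ψ n) - u)) ≤ s n ^ P.p * P.Q (v (ψ n) - u) / P.p := by
      rw [← Q_smul_of_nonneg (hs n).le]
      have := P.pot_nonneg (s n • (v (ψ n) - u))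
      unfold J; linarith
    have h3 := h1.trans h2
    rw [le_div_iff₀ hp] at h3
    have h4 : P.level * P.p / (B' + 1) ≤ s n ^ P.p := by
      rw [div_le_iff₀ (by positivity)]
      have : s n ^ P.p * P.Q (v (ψ n) - u) ≤ s n ^ P.p * (B' + 1) :=
        mul_le_mul_of_nonneg_left ((hyB _).trans (by linarith)) (by have := hs n; positivity)
      linarith
    have := Real.rpow_le_rpow (by positivity) h4 (inv_nonneg.2 hp.le)
    rwa [Real.rpow_rpow_inv (hs n).le hp.ne'] at this
  -- At the smaller of the two Nehari scales one summand has energy at least `level`, and the other,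
  -- being scaled down by a bounded ratio, keeps a fixed positive share by `J_smul_le_smul`.
  set τ : ℕ → ℝ := fun n => min (s n) t with hτ
  have hτ0 : ∀ n, 0 < τ n := fun n => lt_min (hs n) ht
  have hτt : ∀ n, |τ n| ≤ t := fun n => by
    rw [abs_of_pos (hτ0 n)]; exact min_le_right _ _
  have hsplit := tendsto_J_split (y := fun n => τ n • (v (ψ n) - u)) (B := t ^ P.p * B') (S := t)
    (t := τ) (fun n => (hy (ψ n)).smul _) (fun n => by
      rw [Q_smul]
      exact mul_le_mul (Real.rpow_le_rpow (abs_nonneg _) (hτt n) hp.le) (hyB _) (Q_nonneg _)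
        (by positivity)) hu hτt (fun x => by
      have h1 : Tendsto (fun n => v (ψ n) x - u x) atTop (𝓝 0) := by
        have := ((hlim x).comp hψ.tendsto_atTop).sub_const (u x)
        rwa [sub_self] at this
      exact bdd_le_mul_tendsto_zero' t (Eventually.of_forall hτt) h1)
  set κ₀ := min ((s₀ / t) ^ P.p * P.level) ((t / S) ^ P.p * P.level) with hκ₀
  have hκ₀0 : 0 < κ₀ := by positivity
  have hlow : ∀ n, P.level + κ₀ ≤ P.J (τ n • (v (ψ n) - u)) + P.J (τ n • u) := fun n => by
    rcases le_total (s n) t with hst | hst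
    · have e : τ n = s n := min_eq_left hst
      rw [e]
      have h1 := (hsN n).level_le
      have h2 := J_smul_le_smul hu (hs n).le ht hst
      have h3 : (s₀ / t) ^ P.p * P.level ≤ (s n / t) ^ P.p * P.J (t • u) :=
        mul_le_mul (Real.rpow_le_rpow (by positivity)
          (div_le_div_of_nonneg_right (hs₀s n) ht.le) hp.le) htu.level_le hc.le
          (by have := hs n; positivity)
      have := min_le_left ((s₀ / t) ^ P.p * P.level) ((t / S) ^ P.p * P.level)
      linarith
    · have e : τ n = t := min_eq_right hst
      rw [e]
      have h1 := htu.level_le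
      have h2 := J_smul_le_smul (hy (ψ n)) ht.le (hs n) hst
      have h3 : (t / S) ^ P.p * P.level ≤ (t / s n) ^ P.p * P.J (s n • (v (ψ n) - u)) :=
        mul_le_mul (Real.rpow_le_rpow (by positivity)
          (div_le_div_of_nonneg_left ht.le (hs n) (hsS n)) hp.le) (hsN n).level_le hc.le
          (by have := hs n; positivity)
      have := min_le_right ((s₀ / t) ^ P.p * P.level) ((t / S) ^ P.p * P.level)
      linarith
  have h1 := (hsplit.sub (hJ.comp hψ.tendsto_atTop))
  have h2 := (h1.eventually (lt_mem_nhds (show 0 - P.level - κ₀ < 0 - P.level by linarith))).exists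
  obtain ⟨n, hn⟩ := h2
  simp only [Function.comp_apply] at hn
  rw [← smul_add, sub_add_cancel] at hn
  have h3 := (hv (ψ n)).max (τ n) (hτ0 n).le
  have := hlow n
  linarith

/-- With `t u` in the Nehari set, `J (v n) ≥ J (t v n)`, which is `J (t u) + J (t (v n - u))` up to
`o(1)`. Here `J (t u) ≥ level` and the last term controls `Q (v n - u)`, so this tends to `0`; the
maximality of `v n` on its ray then passes to `u`. -/
theorem ground_of_min {B : ℝ} {v : ℕ → (Fin N → ℤ) → ℝ} (hv : ∀ n, P.Neh (v n))
    (hv0 : ∀ n x, 0 ≤ v n x)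
    (hB : ∀ n, P.Q (v n) ≤ B) (hJ : Tendsto (fun n => P.J (v n)) atTop (𝓝 P.level))
    (hu : P.Adm u) (hu0 : u ≠ 0) (hlim : ∀ x, Tendsto (fun n => v n x) atTop (𝓝 (u x))) :
    P.IsGround u := by
  have hp := P.p_pos
  have hQu : P.Q u ≤ B := (adm_of_tendsto (fun n => (hv n).adm) hB hlim).2
  have hB0 : 0 ≤ B := (Q_nonneg u).trans hQu
  set B' := 2 ^ (P.p - 1) * (B + B) with hB'
  have hy : ∀ n, P.Adm (v n - u) := fun n => (hv n).adm.sub hu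
  have hyB : ∀ n, P.Q (v n - u) ≤ B' := fun n => ((hv n).adm.Q_sub_le hu).trans
    (mul_le_mul_of_nonneg_left (add_le_add (hB n) hQu) (by positivity))
  have hsplit : ∀ t : ℝ, 0 ≤ t → Tendsto (fun n => P.J (t • v n) - P.J (t • (v n - u))) atTop
      (𝓝 (P.J (t • u))) := fun t ht => by
    have := tendsto_J_split (y := fun n => t • (v n - u)) (B := t ^ P.p * B') (S := t)
      (t := fun _ => t) (fun n => (hy n).smul _) (fun n => by
        rw [Q_smul_of_nonneg ht]
        exact mul_le_mul_of_nonneg_left (hyB n) (by positivity)) hu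
      (fun _ => (abs_of_nonneg ht).le) (fun x => by
        have h1 : Tendsto (fun n => v n x - u x) atTop (𝓝 0) := by
          have := (hlim x).sub_const (u x)
          rwa [sub_self] at this
        simpa using h1.const_mul t)
    have := this.add_const (P.J (t • u))
    rw [zero_add] at this
    refine this.congr fun n => ?_
    rw [← smul_add, sub_add_cancel, sub_add_cancel]
  have hsmall : ∀ t : ℝ, 0 ≤ t → ∀ᶠ n in atTop,
      t ^ P.p * P.Q (v n - u) / (2 * P.p) ≤ P.J (t • (v n - u)) := fun t ht => by
    obtain ⟨ρ, hρ, h⟩ := P.J_ge_of_small (t ^ P.p * B')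
    filter_upwards [eventually_small_of_min hv hB hJ hu hu0 hlim
      (show 0 < ρ / (t + 1) by positivity)] with n hn
    rw [← Q_smul_of_nonneg ht]
    refine h _ ((hy n).smul t) ?_ fun x => ?_
    · rw [Q_smul_of_nonneg ht]
      exact mul_le_mul_of_nonneg_left (hyB n) (by positivity)
    · have := hn x
      rw [lt_div_iff₀ (by positivity)] at this
      rw [Pi.smul_apply, Pi.sub_apply, smul_eq_mul, abs_mul, abs_of_nonneg ht]
      nlinarith [abs_nonneg (v n x - u x)]
  obtain ⟨t, ht, htu⟩ := hu.exists_neh hu0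
  have hQ0 : Tendsto (fun n => P.Q (v n - u)) atTop (𝓝 0) := by
    have h1 : Tendsto (fun n => 2 * P.p / t ^ P.p *
        (P.J (v n) - (P.J (t • v n) - P.J (t • (v n - u))))) atTop
        (𝓝 (2 * P.p / t ^ P.p * (P.level - P.J (t • u)))) :=
      (hJ.sub (hsplit t ht.le)).const_mul _
    have hbd : ∀ᶠ n in atTop, P.Q (v n - u) ≤ 2 * P.p / t ^ P.p *
        (P.J (v n) - (P.J (t • v n) - P.J (t • (v n - u)))) + 0 := by
      filter_upwards [hsmall t ht.le] with n hn
      have h2 := (hv n).max t ht.le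
      have h3 : 0 < t ^ P.p := Real.rpow_pos_of_pos ht _
      rw [div_le_iff₀ (by positivity)] at hn
      rw [add_zero, div_mul_eq_mul_div, le_div_iff₀ h3]
      nlinarith
    have h4 : 2 * P.p / t ^ P.p * (P.level - P.J (t • u)) ≤ 0 := by
      have := htu.level_le
      have : 0 ≤ 2 * P.p / t ^ P.p := by positivity
      nlinarith
    rw [Metric.tendsto_atTop]
    intro ε hε
    obtain ⟨n0, hn0⟩ := eventually_atTop.1 (hbd.and (h1.eventually (gt_mem_nhds (h4.trans_lt hε))))
    refine ⟨n0, fun n hn => ?_⟩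
    rw [Real.dist_eq, sub_zero, abs_of_nonneg (Q_nonneg _)]
    have := hn0 n hn
    linarith [this.1, this.2]
  have hJt : ∀ t : ℝ, 0 ≤ t → Tendsto (fun n => P.J (t • v n)) atTop (𝓝 (P.J (t • u))) := by
    intro t ht
    have h1 : Tendsto (fun n => P.J (t • (v n - u))) atTop (𝓝 0) := by
      refine tendsto_of_tendsto_of_tendsto_of_le_of_le' (g := fun _ => (0 : ℝ))
        (h := fun n => t ^ P.p / P.p * P.Q (v n - u)) tendsto_const_nhds
        (by simpa using hQ0.const_mul (t ^ P.p / P.p)) ?_ (Eventually.of_forall fun n => ?_)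
      · filter_upwards [hsmall t ht] with n hn
        exact le_trans (div_nonneg (mul_nonneg (by positivity) (Q_nonneg _)) (by positivity)) hn
      · change P.J (t • (v n - u)) ≤ t ^ P.p / P.p * P.Q (v n - u)
        rw [div_mul_eq_mul_div, ← Q_smul_of_nonneg ht]
        have := P.pot_nonneg (t • (v n - u))
        unfold J; linarith
    have := (hsplit t ht).add h1
    simpa using this
  have hJu : P.J u = P.level := by
    have := hJt 1 zero_le_one
    simp only [one_smul] at this
    exact tendsto_nhds_unique this hJ
  exact ⟨⟨hu, hu0, fun t ht => hJu ▸ le_of_tendsto_of_tendsto' (hJt t ht) hJ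
    fun n => (hv n).max t ht⟩, fun x => ge_of_tendsto' (hlim x) fun n => hv0 n x, hJu⟩

/-- Nonnegative almost minimisers in the Nehari set are uniformly close to ground states. -/
theorem exists_ground_close (P : LatticeProblem N ι) {η : ℝ} (hη : 0 < η) : ∃ δ > 0, ∀ u, P.Neh u →
    (∀ x, 0 ≤ u x) → P.J u < P.level + δ → ∃ w, P.IsGround w ∧ ∀ x, |u x - w x| ≤ η := by
  by_contra hcon
  push Not at hcon
  choose v hv hv0 hvJ hvW using fun n : ℕ => hcon (1 / ((n : ℝ) + 1)) (by positivity)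
  obtain ⟨B, hB⟩ := Neh.bound P (P.level + 1)
  obtain ⟨ρ, hρ, hns⟩ := Neh.nonvanishing P (P.level + 1)
  have hJ1 : ∀ n, P.J (v n) ≤ P.level + 1 := fun n => (hvJ n).le.trans (by
    have : 1 / ((n : ℝ) + 1) ≤ 1 := by
      rw [div_le_one (by positivity)]
      have : (0 : ℝ) ≤ n := n.cast_nonneg
      linarith
    linarith)
  choose x hx using fun n => hns (v n) (hv n) (hJ1 n)
  have hT : (0 : ℤ) < P.T := by exact_mod_cast P.T_pos
  -- Translating by these multiples of `T` moves the vertex where `v n` is large into the box `[0,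
  -- T]^N`. A subsequence has it constant, so the pointwise limit is not zero.
  set k : ℕ → Fin N → ℤ := fun n i => -(x n i / P.T) with hk
  set x' : ℕ → Fin N → ℤ := fun n i => x n i % P.T with hx'
  have hxx : ∀ n, x' n - (P.T : ℤ) • k n = x n := fun n => by
    funext i
    simp only [hk, hx', Pi.sub_apply, Pi.smul_apply, smul_eq_mul]
    have := Int.emod_add_mul_ediv (x n i) P.T
    linarith
  have hfin : (Set.Icc (0 : Fin N → ℤ) (fun _ => (P.T : ℤ))).Finite := Set.finite_Icc _ _
  have hmem : ∀ n, x' n ∈ Set.Icc (0 : Fin N → ℤ) (fun _ => (P.T : ℤ)) := fun n =>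
    ⟨fun i => Int.emod_nonneg _ hT.ne', fun i => (Int.emod_lt_of_pos _ hT).le⟩
  obtain ⟨x₀, -, φ, hφ, hx₀⟩ := hfin.isCompact.tendsto_subseq hmem
  obtain ⟨M, -, hM⟩ := P.bound_of_Q B
  set z : ℕ → (Fin N → ℤ) → ℝ := fun n => P.shift (k n) (v n) with hz
  have hzN : ∀ n, P.Neh (z n) := fun n => (hv n).shift _
  have hzB : ∀ n, P.Q (z n) ≤ B := fun n => by
    rw [hz, Q_shift]; exact hB _ (hv n) (hJ1 n)
  obtain ⟨u, ψ, hψ, hu⟩ := exists_subseq_pointwise (v := fun n => z (φ n)) (M := M)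
    fun n y => (hM _ (hzN _).adm (hzB _)).2 y
  have hadm := (adm_of_tendsto (y := fun n => z (φ (ψ n))) (fun n => (hzN _).adm)
    (fun n => hzB _) hu).1
  have hu0 : u ≠ 0 := by
    intro h0
    have h1 : ∀ᶠ n in atTop, x' (φ (ψ n)) = x₀ := by
      have := hx₀.comp hψ.tendsto_atTop
      rw [nhds_discrete, tendsto_pure] at this
      exact this
    have h2 : ∀ᶠ n in atTop, |z (φ (ψ n)) x₀| < ρ := by
      have := (hu x₀).abs
      rw [h0, Pi.zero_apply, abs_zero] at this
      exact this.eventually (gt_mem_nhds hρ)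
    obtain ⟨n, hn1, hn2⟩ := (h1.and h2).exists
    have h3 := hx (φ (ψ n))
    rw [← hxx, hn1] at h3
    exact absurd h3 (not_le.2 hn2)
  have hJlim : Tendsto (fun n => P.J (z (φ (ψ n)))) atTop (𝓝 P.level) := by
    have h1 : Tendsto (fun n => P.J (v n)) atTop (𝓝 P.level) := by
      refine tendsto_of_tendsto_of_tendsto_of_le_of_le tendsto_const_nhds
        (h := fun n : ℕ => P.level + 1 / ((n : ℝ) + 1)) ?_ (fun n => (hv n).level_le)
        (fun n => (hvJ n).le)
      simpa using tendsto_one_div_add_atTop_nhds_zero_nat.const_add P.level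
    refine (h1.comp (hφ.comp hψ).tendsto_atTop).congr fun n => ?_
    simp [hz, J_shift]
  have hg := ground_of_min (fun n => hzN _) (fun n y => hv0 _ _) (fun n => hzB _) hJlim hadm hu0 hu
  obtain ⟨n, hn⟩ := (eventually_small_of_min (fun n => hzN _) (fun n => hzB _) hJlim hadm hu0 hu
    hη).exists
  obtain ⟨y, hy⟩ := hvW (φ (ψ n)) (P.shift (-k (φ (ψ n))) u) (hg.shift _)
  have h1 := hn (y + (P.T : ℤ) • k (φ (ψ n)))
  simp only [hz, shift, add_sub_cancel_right] at h1
  simp only [shift, smul_neg, sub_neg_eq_add] at hy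
  linarith

/-- Absolute values keep `pot` and do not increase `Q`, so almost minimisers may be taken
nonnegative. -/
theorem exists_ground (P : LatticeProblem N ι) : ∃ w, P.IsGround w := by
  obtain ⟨δ, hδ, h⟩ := P.exists_ground_close one_pos
  obtain ⟨u, hu, hJ⟩ := P.exists_J_lt hδ
  have habs : P.Adm |u| := hu.adm.comp (fun s t => abs_abs_sub_abs_le s t) abs_zero
  obtain ⟨s, hs, hsu⟩ := habs.exists_neh (fun h0 => hu.ne_zero (by simpa using h0))
  obtain ⟨w, hw, -⟩ := h _ hsu (fun x => mul_nonneg hs.le (abs_nonneg _)) (by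
    refine lt_of_le_of_lt ?_ hJ
    refine le_trans ?_ (hu.max s hs.le)
    unfold J
    have h1 : P.pot (s • |u|) = P.pot (s • u) := by
      unfold pot
      congr 1; funext x
      rw [← F_abs _ ((s • u) x)]
      simp [abs_mul, abs_of_pos hs]
    have h2 : P.Q (s • |u|) ≤ P.Q (s • u) := by
      rw [Q_smul_of_nonneg hs.le, Q_smul_of_nonneg hs.le]
      exact mul_le_mul_of_nonneg_left
        (hu.adm.Q_comp_le (fun s t => abs_abs_sub_abs_le s t) abs_zero) (by positivity)
    rw [h1]
    have := div_le_div_of_nonneg_right h2 P.p_pos.le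
    linarith)
  exact ⟨w, hw⟩

end LatticeProblem

/-! ### Convexity of powers of the absolute value -/

theorem monotone_abs_rpow_mul {p : ℝ} (hp : 2 ≤ p) :
    Monotone fun x : ℝ => p * |x| ^ (p - 2) * x := by
  refine monotone_of_odd_of_monotoneOn_nonneg (fun x => by simp) fun s hs t _ hst => ?_
  have hs' : 0 ≤ s := hs
  have ht' : 0 ≤ t := hs'.trans hst
  simp only [abs_of_nonneg hs', abs_of_nonneg ht']
  have := Real.rpow_le_rpow hs' hst (show 0 ≤ p - 2 by linarith)
  exact mul_le_mul (mul_le_mul_of_nonneg_left this (by linarith)) hst hs' (by positivity)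

theorem abs_rpow_sub_le {p : ℝ} (hp : 2 ≤ p) (c h : ℝ) :
    |c + h| ^ p - |c| ^ p ≤ p * (|c + h| ^ (p - 2) * (c + h)) * h := by
  have := sub_ge_of_monotone_deriv (F := fun x : ℝ => |x| ^ p)
    (fun x => hasDerivAt_abs_rpow x (by linarith)) (monotone_abs_rpow_mul hp) (c + h) (-h)
  rw [add_neg_cancel_right] at this
  linarith

namespace LatticeProblem

variable {N : ℕ} {ι : Type} {P : LatticeProblem N ι} {a b u : (Fin N → ℤ) → ℝ}

/-! ### The Euler–Lagrange equation -/

/-- The indicator function of a vertex. -/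
def delta (x : Fin N → ℤ) : (Fin N → ℤ) → ℝ := Pi.single x 1

theorem delta_self (x : Fin N → ℤ) : delta x x = 1 := Pi.single_eq_same _ _

theorem delta_of_ne {x y : Fin N → ℤ} (h : y ≠ x) : delta x y = 0 := Pi.single_eq_of_ne h _

theorem delta_abs_le (x y : Fin N → ℤ) : |delta x y| ≤ 1 := by
  rcases eq_or_ne y x with rfl | h
  · simp [delta_self]
  · simp [delta_of_ne h]

theorem adm_delta (x : Fin N → ℤ) : P.Adm (delta x) :=
  .of_finite_support ((Set.finite_singleton x).subset fun y hy => by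
    by_contra h0
    exact hy (delta_of_ne h0))

theorem form_delta {x : Fin N → ℤ} {e : ι} (h : e ∉ (P.finite_star x).toFinset) :
    P.form e (delta x) = 0 := by
  simp only [Set.Finite.mem_toFinset, Set.mem_ofPred_eq, not_or] at h
  simp [form, delta_of_ne h.1, delta_of_ne h.2]

/-- The derivative of the energy in the direction of a vertex. -/
noncomputable def grad (P : LatticeProblem N ι) (u : (Fin N → ℤ) → ℝ) (x : Fin N → ℤ) : ℝ :=
  ∑ e ∈ (P.finite_star x).toFinset, |P.form e u| ^ (P.p - 2) * P.form e u * P.form e (delta x) -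
    P.f x (u x)

/-- Convexity is used at the new point for `Q` and at the old point for `F`; both inequalities then
bound the increment of `J` from above. -/
theorem J_add_delta_le (hu : P.Adm u) (x : Fin N → ℤ) (r : ℝ) :
    P.J (u + r • delta x) - P.J u ≤ r * (∑ e ∈ (P.finite_star x).toFinset,
      |P.form e (u + r • delta x)| ^ (P.p - 2) * P.form e (u + r • delta x) * P.form e (delta x) -
      P.f x (u x)) := by
  have hv := hu.add ((adm_delta (P := P) x).smul r)
  have hp := P.p_pos
  have h1 : P.Q (u + r • delta x) - P.Q u ≤ P.p * r * ∑ e ∈ (P.finite_star x).toFinset,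
      |P.form e (u + r • delta x)| ^ (P.p - 2) * P.form e (u + r • delta x) *
        P.form e (delta x) := by
    unfold Q
    rw [← hv.form.tsum_sub hu.form, tsum_eq_sum (s := (P.finite_star x).toFinset), Finset.mul_sum]
    · refine Finset.sum_le_sum fun e _ => ?_
      have := abs_rpow_sub_le P.two_le (P.form e u) (r * P.form e (delta x))
      rw [form_add, form_smul]
      linarith
    · intro e he
      rw [form_add, form_smul, form_delta he, mul_zero, add_zero, sub_self]
  have h2 : P.pot (u + r • delta x) - P.pot u = P.F x (u x + r) - P.F x (u x) := by
    unfold pot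
    rw [← hv.F_summable.tsum_sub hu.F_summable, tsum_eq_single x]
    · simp [delta_self]
    · intro y hy
      simp [delta_of_ne hy]
  have h3 : P.f x (u x) * r ≤ P.F x (u x + r) - P.F x (u x) :=
    (P.f_pm x).tangent_le P.one_lt_p.le (u x) r
  have h4 := div_le_div_of_nonneg_right h1 hp.le
  rw [mul_assoc, mul_div_cancel_left₀ _ hp.ne', sub_div] at h4
  unfold J
  rw [mul_sub]
  linarith

theorem grad_sign_of_tendsto {z : ℕ → (Fin N → ℤ) → ℝ} {r : ℕ → ℝ} {θ : ℝ} {x : Fin N → ℤ}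
    (hz : ∀ n, P.Adm (z n)) (hzu : ∀ y, Tendsto (fun n => z n y) atTop (𝓝 (u y)))
    (hr : Tendsto r atTop (𝓝 0)) (hθ : ∀ n, 0 < θ * r n)
    (hJ : ∀ n, P.J (z n) ≤ P.J (z n + r n • delta x)) : 0 ≤ θ * P.grad u x := by
  have h1 : ∀ y, Tendsto (fun n => (z n + r n • delta x) y) atTop (𝓝 (u y)) := fun y => by
    have := (hzu y).add (hr.mul_const (delta x y))
    rwa [zero_mul, add_zero] at this
  have hlim : Tendsto (fun n => θ * (∑ e ∈ (P.finite_star x).toFinset,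
      |P.form e (z n + r n • delta x)| ^ (P.p - 2) * P.form e (z n + r n • delta x) *
        P.form e (delta x) - P.f x (z n x))) atTop (𝓝 (θ * P.grad u x)) := by
    refine Tendsto.const_mul _ (Tendsto.sub (tendsto_finsetSum _ fun e _ => ?_) ?_)
    · have h2 := tendsto_form (P := P) h1 e
      exact ((h2.abs.rpow_const (Or.inr (by linarith [P.two_le]))).mul h2).mul_const _
    · exact ((P.f_pm x).cont.tendsto _).comp (hzu x)
  refine ge_of_tendsto' hlim fun n => ?_
  have h2 := J_add_delta_le (hz n) x (r n)
  have h3 := hJ n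
  have h4 := hθ n
  set D := ∑ e ∈ (P.finite_star x).toFinset,
      |P.form e (z n + r n • delta x)| ^ (P.p - 2) * P.form e (z n + r n • delta x) *
        P.form e (delta x) - P.f x (z n x)
  have h5 : 0 ≤ r n * D := by linarith
  have h6 : r n ≠ 0 := fun h0 => by simp [h0] at h4
  have h7 : 0 < r n ^ 2 := by positivity
  -- It is the product of `θ * r n` and `r n * D`, both nonnegative.
  have h8 : 0 ≤ r n ^ 2 * (θ * D) := by nlinarith [mul_nonneg h4.le h5]
  exact nonneg_of_mul_nonneg_right h8 h7

/-- Envelope argument: a maximiser on a cone whose value cannot be lowered by perturbing the cone at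
the vertex `x` has a one-sided derivative in the direction of `x`. -/
theorem grad_sign_of_minimax (hab : P.Compat a b) (ha : a ≠ 0)
    (hmax : ∀ s t : ℝ, 0 ≤ s → 0 ≤ t → P.J (s • a + t • b) ≤ P.J (a + b))
    {x : Fin N → ℤ} {α β ε : ℕ → ℝ} {θ κ : ℝ} (hκ : 0 < κ)
    (hα : ∀ n, 0 ≤ θ * α n) (hβ : ∀ n, 0 ≤ θ * β n) (hαβ : ∀ n, α n + β n = θ * ε n)
    (hθ : θ ≠ 0) (hε : ∀ n, 0 < ε n) (hε0 : Tendsto ε atTop (𝓝 0))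
    (hα' : ∀ n, |α n| ≤ |θ| * ε n) (hβ' : ∀ n, |β n| ≤ |θ| * ε n)
    (hcompat : ∀ n, P.Compat (a + α n • delta x) (b + β n • delta x))
    (hb : (b = 0 ∧ ∀ n, b + β n • delta x = 0) ∨
      (b ≠ 0 ∧ ∀ n, ∃ y, κ ≤ |(b + β n • delta x) y|))
    (ha' : ∀ n, ∃ y, κ ≤ |(a + α n • delta x) y|)
    (hmin : ∀ n (s t : ℝ), 0 < s → 0 < t → (∀ s' t' : ℝ, 0 ≤ s' → 0 ≤ t' →
      P.J (s' • (a + α n • delta x) + t' • (b + β n • delta x)) ≤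
      P.J (s • (a + α n • delta x) + t • (b + β n • delta x))) →
      P.J (a + b) ≤ P.J (s • (a + α n • delta x) + t • (b + β n • delta x))) :
    0 ≤ θ * P.grad (a + b) x := by
  have hex : ∀ n, ∃ s t : ℝ, 0 < s ∧ 0 < t ∧ (b + β n • delta x = 0 → t = 1) ∧
      ∀ s' t' : ℝ, 0 ≤ s' → 0 ≤ t' →
      P.J (s' • (a + α n • delta x) + t' • (b + β n • delta x)) ≤
      P.J (s • (a + α n • delta x) + t • (b + β n • delta x)) := fun n => by
    refine (hcompat n).exists_max fun h0 => ?_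
    obtain ⟨y, hy⟩ := ha' n
    rw [h0, Pi.zero_apply, abs_zero] at hy
    linarith
  choose s t hs ht ht1 hst using hex
  have hge : ∀ n, P.J (a + b) ≤ P.J (s n • (a + α n • delta x) + t n • (b + β n • delta x)) :=
    fun n => hmin n _ _ (hs n) (ht n) (hst n)
  have hα0 : Tendsto α atTop (𝓝 0) :=
    squeeze_zero_norm hα' (by simpa using hε0.const_mul |θ|)
  have hβ0 : Tendsto β atTop (𝓝 0) :=
    squeeze_zero_norm hβ' (by simpa using hε0.const_mul |θ|)
  obtain ⟨E, hE⟩ := (Metric.isBounded_range_of_tendsto ε hε0).exists_norm_le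
  have hE' : ∀ n, ε n ≤ E := fun n => (le_abs_self _).trans (hE _ ⟨n, rfl⟩)
  have hE0 : 0 ≤ E := (hε 0).le.trans (hE' 0)
  set D := |θ| * E with hD
  have hD0 : 0 ≤ D := by positivity
  have hαD : ∀ n, |α n| ≤ D := fun n => (hα' n).trans
    (mul_le_mul_of_nonneg_left (hE' n) (abs_nonneg _))
  have hβD : ∀ n, |β n| ≤ D := fun n => (hβ' n).trans
    (mul_le_mul_of_nonneg_left (hE' n) (abs_nonneg _))
  have hδ := adm_delta (P := P) x
  set B := 2 ^ (P.p - 1) * (P.Q a + P.Q b + D ^ P.p * P.Q (delta x)) with hB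
  have hQ : ∀ (c : (Fin N → ℤ) → ℝ) (γ : ℝ), P.Adm c → P.Q c ≤ P.Q a + P.Q b → |γ| ≤ D →
      P.Q (c + γ • delta x) ≤ B := fun c γ hc hcQ hγ => by
    refine (hc.Q_add_le (hδ.smul γ)).trans (mul_le_mul_of_nonneg_left (add_le_add hcQ ?_)
      (by positivity))
    rw [Q_smul]
    exact mul_le_mul_of_nonneg_right (Real.rpow_le_rpow (abs_nonneg _) hγ P.p_pos.le) (Q_nonneg _)
  have hQa := P.Q_nonneg a
  have hQb := P.Q_nonneg b
  obtain ⟨S, hS0, hS⟩ := P.coercive_bound B hκ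
  have hJ0 : 0 ≤ P.J (a + b) := by
    have := hmax 0 0 le_rfl le_rfl
    simpa [J_zero] using this
  have hsS : ∀ n, s n ≤ S := fun n => hS _ _ (hcompat n) (hQ a _ hab.left (by linarith) (hαD n))
    (hQ b _ hab.right (by linarith) (hβD n)) (ha' n) (hb.imp (fun h => h.2 n) fun h => h.2 n)
    (s n) (t n) (hs n).le (ht n).le (hJ0.trans (hge n))
  have htS : ∀ n, t n ≤ max S 1 := fun n => by
    rcases hb with hb | hb
    · rw [ht1 n (hb.2 n)]; exact le_max_right _ _
    · refine (hS _ _ (hcompat n).symm (hQ b _ hab.right (by linarith) (hβD n))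
        (hQ a _ hab.left (by linarith) (hαD n)) (hb.2 n) (Or.inr (ha' n))
        (t n) (s n) (ht n).le (hs n).le ?_).trans (le_max_left _ _)
      rw [add_comm]; exact hJ0.trans (hge n)
  obtain ⟨⟨s₀, t₀⟩, hq, φ, hφ, hlim⟩ := ((isCompact_Icc (a := (0 : ℝ)) (b := S)).prod
    (isCompact_Icc (a := (0 : ℝ)) (b := max S 1))).tendsto_subseq (x := fun n => (s n, t n))
    fun n => ⟨⟨(hs n).le, hsS n⟩, ⟨(ht n).le, htS n⟩⟩
  have hs₀ : Tendsto (fun n => s (φ n)) atTop (𝓝 s₀) := hlim.fst_nhds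
  have ht₀ : Tendsto (fun n => t (φ n)) atTop (𝓝 t₀) := hlim.snd_nhds
  have hφ' := hφ.tendsto_atTop
  have hmix : ∀ n, s n • (a + α n • delta x) + t n • (b + β n • delta x) =
      (s n • a + t n • b) + (s n * α n + t n * β n) • delta x := fun n => by
    simp only [smul_add, add_smul, mul_smul]; abel
  have hr0 : Tendsto (fun n => s (φ n) * α (φ n) + t (φ n) * β (φ n)) atTop (𝓝 0) := by
    have := (hs₀.mul (hα0.comp hφ')).add (ht₀.mul (hβ0.comp hφ'))
    simpa using this
  have hJlim : P.J (a + b) ≤ P.J (s₀ • a + t₀ • b) := by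
    have h1 : Tendsto (fun n => P.J (s (φ n) • (a + α (φ n) • delta x) +
        t (φ n) • (b + β (φ n) • delta x))) atTop (𝓝 (P.J (s₀ • a + t₀ • b))) := by
      set L := max S 1 with hL
      have hL0 : 0 ≤ L := hS0.le.trans (le_max_left _ _)
      have hs' : ∀ n, |s n| ≤ L := fun n => by
        rw [abs_of_pos (hs n)]; exact (hsS n).trans (le_max_left _ _)
      have ht' : ∀ n, |t n| ≤ L := fun n => by
        rw [abs_of_pos (ht n)]; exact htS n
      have hr' : ∀ n, |s n * α n + t n * β n| ≤ L * D + L * D := fun n => by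
        refine (abs_add_le _ _).trans ?_
        rw [abs_mul, abs_mul]
        exact add_le_add (mul_le_mul (hs' n) (hαD n) (abs_nonneg _) hL0)
          (mul_le_mul (ht' n) (hβD n) (abs_nonneg _) hL0)
      have hLD : 0 ≤ L * D + L * D := by positivity
      refine tendsto_J_of_dominated
        (β := fun e => (L * |P.form e a| + L * |P.form e b|) +
          (L * D + L * D) * |P.form e (delta x)|)
        (γ := fun y => (L * |a y| + L * |b y|) + (L * D + L * D) * |delta x y|) ?_ ?_ ?_ ?_ ?_
      · exact summable_add_rpow P.one_lt_p.le (fun _ => by positivity) (fun _ => by positivity)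
          (summable_add_rpow P.one_lt_p.le (fun _ => by positivity) (fun _ => by positivity)
          (summable_mul_rpow hL0 (fun _ => abs_nonneg _) hab.left.form)
          (summable_mul_rpow hL0 (fun _ => abs_nonneg _) hab.right.form))
          (summable_mul_rpow hLD (fun _ => abs_nonneg _) hδ.form)
      · exact summable_add_rpow P.one_lt_r.le (fun _ => by positivity) (fun _ => by positivity)
          (summable_add_rpow P.one_lt_r.le (fun _ => by positivity) (fun _ => by positivity)
          (summable_mul_rpow hL0 (fun _ => abs_nonneg _) hab.left.pow)
          (summable_mul_rpow hL0 (fun _ => abs_nonneg _) hab.right.pow))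
          (summable_mul_rpow hLD (fun _ => abs_nonneg _) hδ.pow)
      · intro n e
        rw [hmix, form_add, form_add, form_smul, form_smul, form_smul]
        refine (abs_add_le _ _).trans (add_le_add ((abs_add_le _ _).trans (add_le_add ?_ ?_)) ?_) <;>
          rw [abs_mul] <;> refine mul_le_mul_of_nonneg_right ?_ (abs_nonneg _)
        exacts [hs' _, ht' _, hr' _]
      · intro n y
        rw [hmix]
        simp only [Pi.add_apply, Pi.smul_apply, smul_eq_mul]
        refine (abs_add_le _ _).trans (add_le_add ((abs_add_le _ _).trans (add_le_add ?_ ?_)) ?_) <;>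
          rw [abs_mul] <;> refine mul_le_mul_of_nonneg_right ?_ (abs_nonneg _)
        exacts [hs' _, ht' _, hr' _]
      · intro y
        simp_rw [hmix]
        have := ((hs₀.mul_const (a y)).add (ht₀.mul_const (b y))).add (hr0.mul_const (delta x y))
        rw [zero_mul, add_zero] at this
        exact this
    exact ge_of_tendsto' h1 fun n => hge _
  -- The limit point of the perturbed maximisers also maximises on the original cone, so uniqueness
  -- identifies it with `(1, 1)`.
  have hs1 : 1 = s₀ := hab.max_unique ha (s₁ := 1) (t₁ := 1) zero_le_one hq.1.1 zero_le_one hq.2.1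
    (by simpa using hmax) (by simpa using hJlim)
  have ht1' : 1 = t₀ := by
    rcases hb with hb | hb
    · have : (fun n => t (φ n)) = fun _ => 1 := funext fun n => ht1 _ (hb.2 _)
      rw [this] at ht₀
      exact tendsto_nhds_unique tendsto_const_nhds ht₀
    · refine hab.symm.max_unique hb.1 (s₁ := 1) (t₁ := 1) zero_le_one hq.2.1 zero_le_one hq.1.1
        (fun s' t' h1 h2 => ?_) ?_
      · have := hmax t' s' h2 h1
        rw [add_comm, one_smul, one_smul, add_comm b]; exact this
      · rw [add_comm, one_smul, one_smul, add_comm (t₀ • b)]; exact hJlim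
  -- With `z = s n a + t n b` one has `J z ≤ J (a + b) ≤ J (z + r δ_x)`, by maximality of `a + b` on
  -- its cone and the minimax hypothesis. The step `r = s n * α n + t n * β n` has the sign of `θ`.
  refine grad_sign_of_tendsto (z := fun n => s (φ n) • a + t (φ n) • b)
    (fun n => (hab.left.smul _).add (hab.right.smul _)) (fun y => ?_) hr0 (fun n => ?_) fun n => ?_
  · rw [← hs1] at hs₀
    rw [← ht1'] at ht₀
    have := (hs₀.mul_const (a y)).add (ht₀.mul_const (b y))
    rw [one_mul, one_mul] at this
    exact this
  · have h1 := mul_nonneg (hs (φ n)).le (hα (φ n))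
    have h2 := mul_nonneg (ht (φ n)).le (hβ (φ n))
    have h3 : 0 < θ * α (φ n) + θ * β (φ n) := by
      rw [← mul_add, hαβ, ← mul_assoc]
      exact mul_pos (mul_self_pos.2 hθ) (hε _)
    have h4 : θ * (s (φ n) * α (φ n) + t (φ n) * β (φ n)) =
        s (φ n) * (θ * α (φ n)) + t (φ n) * (θ * β (φ n)) := by ring
    rw [h4]
    rcases (hα (φ n)).eq_or_lt with h5 | h5
    · have : 0 < θ * β (φ n) := by linarith
      have := mul_pos (ht (φ n)) this
      linarith
    · have := mul_pos (hs (φ n)) h5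
      linarith
  · rw [← hmix]
    exact (hmax _ _ (hs _).le (ht _).le).trans (hge _)

/-- Ground states are critical points. -/
theorem IsGround.grad_eq_zero (h : P.IsGround u) (x : Fin N → ℤ) : P.grad u x = 0 := by
  obtain ⟨y, hy⟩ := Function.ne_iff.1 h.neh.ne_zero
  have hy' : 0 < |u y| := abs_pos.2 hy
  have key : ∀ θ : ℝ, |θ| = 1 → 0 ≤ θ * P.grad u x := by
    intro θ hθ
    have hθ0 : θ ≠ 0 := fun h0 => by simp [h0] at hθ
    -- Perturbations of size at most `|u y| / 2` leave at least `|u y| / 2` at `y`, as the uniform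
    -- coercivity bound requires.
    have hε : ∀ n : ℕ, 0 < |u y| / 2 * (1 / ((n : ℝ) + 1)) := fun n => by positivity
    have hε1 : ∀ n : ℕ, |u y| / 2 * (1 / ((n : ℝ) + 1)) ≤ |u y| / 2 := fun n => by
      refine mul_le_of_le_one_right (by positivity) ?_
      rw [div_le_one (by positivity)]
      have : (0 : ℝ) ≤ n := n.cast_nonneg
      linarith
    have hbig : ∀ n : ℕ, ∃ z, |u y| / 2 ≤
        |(u + (θ * (|u y| / 2 * (1 / ((n : ℝ) + 1)))) • delta x) z| := fun n => by
      refine ⟨y, ?_⟩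
      have h1 : |(θ * (|u y| / 2 * (1 / ((n : ℝ) + 1)))) * delta x y| ≤ |u y| / 2 := by
        rw [abs_mul, abs_mul, hθ, one_mul, abs_of_pos (hε n)]
        exact (mul_le_of_le_one_right (hε n).le (delta_abs_le x y)).trans (hε1 n)
      have h2 := abs_sub_abs_le_abs_sub (u y)
        (-((θ * (|u y| / 2 * (1 / ((n : ℝ) + 1)))) * delta x y))
      rw [abs_neg, sub_neg_eq_add] at h2
      change _ ≤ |u y + (θ * (|u y| / 2 * (1 / ((n : ℝ) + 1)))) * delta x y|
      linarith
    have hadm : ∀ r : ℝ, P.Adm (u + r • delta x) := fun r =>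
      h.neh.adm.add ((adm_delta x).smul r)
    have := grad_sign_of_minimax (Compat.zero_right h.neh.adm) h.neh.ne_zero
      (fun s t hs _ => by simpa using h.neh.max s hs) (x := x)
      (α := fun n : ℕ => θ * (|u y| / 2 * (1 / ((n : ℝ) + 1)))) (β := fun _ => 0)
      (ε := fun n : ℕ => |u y| / 2 * (1 / ((n : ℝ) + 1))) (θ := θ) (κ := |u y| / 2) (by positivity)
      (fun n => by rw [← mul_assoc]; exact mul_nonneg (mul_self_nonneg _) (hε n).le)
      (fun n => by simp) (fun n => by simp) hθ0 hε
      (by simpa using tendsto_one_div_add_atTop_nhds_zero_nat.const_mul (|u y| / 2))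
      (fun n => by rw [abs_mul, abs_of_pos (hε n)])
      (fun n => by simpa [hθ] using (hε n).le)
      (fun n => by simpa using Compat.zero_right (hadm _))
      (Or.inl ⟨rfl, fun n => by simp⟩) hbig
      (fun n s t hs ht hst => by
        simp only [zero_smul, add_zero, smul_zero] at hst ⊢
        rw [h.J_eq]
        refine Neh.level_le ⟨(hadm _).smul s, smul_ne_zero hs.ne' fun h0 => ?_, fun t ht => ?_⟩
        · obtain ⟨z, hz⟩ := hbig n
          rw [h0, Pi.zero_apply, abs_zero] at hz
          linarith
        · rw [smul_smul]
          exact hst (t * s) 0 (by positivity) le_rfl)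
    simpa using this
  have h1 := key 1 (by simp)
  have h2 := key (-1) (by simp)
  linarith

end LatticeProblem

namespace LatticeProblem

variable {N : ℕ} {ι : Type} {P : LatticeProblem N ι} {a b u : (Fin N → ℤ) → ℝ}

/-! ### Separation of ground states -/

theorem smul_injective_of_ne {k l y : Fin N → ℤ} (h : y + (P.T : ℤ) • k = y + (P.T : ℤ) • l) :
    k = l := by
  have hT : (P.T : ℤ) ≠ 0 := by exact_mod_cast P.T_pos.ne'
  funext i
  have := congrFun h i
  simp only [Pi.add_apply, Pi.smul_apply, smul_eq_mul, add_right_inj] at this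
  exact mul_left_cancel₀ hT this

/-- A function in `ℓ^r` cannot take a nonzero value at infinitely many translates of one vertex. -/
theorem Adm.eq_zero_of_shift_eq (hu : P.Adm u) (h0 : u ≠ 0) {k : Fin N → ℤ}
    (h : P.shift k u = u) : k = 0 := by
  obtain ⟨x, hx⟩ := Function.ne_iff.1 h0
  have hper : ∀ n : ℕ, u (x + (P.T : ℤ) • (n • k)) = u x := fun n => by
    induction n with
    | zero => simp
    | succ n ih =>
      rw [← ih, ← congrFun h (x + (P.T : ℤ) • ((n + 1) • k))]
      refine congrArg u ?_
      rw [succ_nsmul, smul_add]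
      abel
  by_contra hk
  have hinj : Function.Injective fun n : ℕ => x + (P.T : ℤ) • (n • k) := fun m n hmn => by
    have h1 : m • k = n • k := smul_injective_of_ne hmn
    obtain ⟨i, hi⟩ := Function.ne_iff.1 hk
    have h2 := congrFun h1 i
    simp only [Pi.smul_apply, nsmul_eq_mul] at h2
    exact_mod_cast mul_right_cancel₀ hi h2
  refine Set.infinite_of_injective_forall_mem hinj (fun n => ?_)
    (hu.support_large_finite (abs_pos.2 hx))
  change _ ≤ |u _|
  rw [hper]

/-- Proportional ground states coincide, because the maximiser on a ray is unique. Otherwise some `2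
× 2` minor of `(w, w')` is nonzero, and `l w` close to `w'` at its two vertices would make it too
small. -/
theorem IsGround.pair_sep {w w' : (Fin N → ℤ) → ℝ} (hw : P.IsGround w) (hw' : P.IsGround w')
    (hne : w ≠ w') : ∃ d > 0, ∀ l : ℝ, ∃ x, d < |l * w x - w' x| := by
  obtain ⟨x, y, hxy⟩ : ∃ x y, w x * w' y ≠ w y * w' x := by
    by_contra hcon
    push Not at hcon
    obtain ⟨x, hx⟩ := Function.ne_iff.1 hw.neh.ne_zero
    have hx : w x ≠ 0 := hx
    have h1 : w' = (w' x / w x) • w := by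
      funext y
      simp only [Pi.smul_apply, smul_eq_mul]
      rw [div_mul_eq_mul_div, eq_div_iff hx, mul_comm, hcon x y, mul_comm]
    have h2 := hw.neh.eq_one (s := w' x / w x) (div_nonneg (hw'.nonneg x) (hw.nonneg x))
      (by rw [← h1, hw.J_eq, hw'.J_eq])
    rw [h2, one_smul] at h1
    exact hne h1.symm
  have hD : 0 < |w x * w' y - w y * w' x| := abs_pos.2 (sub_ne_zero.2 hxy)
  have hx := hw.nonneg x
  have hy := hw.nonneg y
  refine ⟨|w x * w' y - w y * w' x| / (2 * (w x + w y + 1)), by positivity, fun l => ?_⟩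
  by_contra hcon
  push Not at hcon
  have h1 := hcon x
  have h2 := hcon y
  have h3 : w x * w' y - w y * w' x = w y * (l * w x - w' x) - w x * (l * w y - w' y) := by ring
  have h4 : |w x * w' y - w y * w' x| ≤ w y * |l * w x - w' x| + w x * |l * w y - w' y| := by
    rw [h3]
    refine (abs_sub _ _).trans ?_
    rw [abs_mul, abs_mul, abs_of_nonneg hx, abs_of_nonneg hy]
  rw [le_div_iff₀ (by positivity)] at h1 h2
  have h5 := mul_le_mul_of_nonneg_left h1 hy
  have h6 := mul_le_mul_of_nonneg_left h2 hx
  have h7 : |w x * w' y - w y * w' x| * (2 * (w x + w y + 1)) ≤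
      (w x + w y) * |w x * w' y - w y * w' x| := by
    calc _ ≤ (w y * |l * w x - w' x| + w x * |l * w y - w' y|) * (2 * (w x + w y + 1)) :=
          mul_le_mul_of_nonneg_right h4 (by positivity)
      _ ≤ _ := by linarith
  nlinarith

theorem IsGround.exists_bounds (P : LatticeProblem N ι) : ∃ ρ M, 0 < ρ ∧ 0 < M ∧
    ∀ w, P.IsGround w → (∃ x, ρ ≤ w x) ∧ ∀ x, w x ≤ M := by
  obtain ⟨B, hB⟩ := Neh.bound P P.level
  obtain ⟨ρ, hρ, hns⟩ := Neh.nonvanishing P P.level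
  obtain ⟨M, hM0, hM⟩ := P.bound_of_Q B
  refine ⟨ρ, M + 1, hρ, by positivity, fun w hw => ⟨?_, fun x => ?_⟩⟩
  · obtain ⟨x, hx⟩ := hns w hw.neh hw.J_eq.le
    exact ⟨x, by rwa [abs_of_nonneg (hw.nonneg x)] at hx⟩
  · have := (hM w hw.neh.adm (hB w hw.neh hw.J_eq.le)).2 x
    have := le_abs_self (w x)
    linarith

/-- If the ground states form finitely many orbits, the rays through them are separated. -/
theorem IsGround.exists_sep {G : Set ((Fin N → ℤ) → ℝ)} (hG : G.Finite)
    (hGg : ∀ g ∈ G, P.IsGround g)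
    (hGW : ∀ w, P.IsGround w → ∃ g ∈ G, ∃ k, w = P.shift k g) :
    ∃ d > 0, ∀ w w', P.IsGround w → P.IsGround w' → ∀ l : ℝ, (∀ x, |l * w x - w' x| ≤ d) →
      w = w' := by
  obtain ⟨ρ, M, hρ, hM, hbd⟩ := IsGround.exists_bounds P
  -- The threshold is written `exp (-C)` so that it stays positive and the property persists as `C`
  -- grows, as a common constant for finitely many cases requires.
  suffices h : ∃ C : ℝ, ∀ q ∈ G ×ˢ G, ∀ k, ∀ l : ℝ,
      (∀ x, |l * q.1 x - P.shift k q.2 x| ≤ Real.exp (-C)) → q.1 = P.shift k q.2 by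
    obtain ⟨C, hC⟩ := h
    refine ⟨Real.exp (-C), Real.exp_pos _, fun w w' hw hw' l hl => ?_⟩
    obtain ⟨g, hg, k, rfl⟩ := hGW w hw
    obtain ⟨g', hg', k', rfl⟩ := hGW w' hw'
    have h1 := hC (g, g') ⟨hg, hg'⟩ (-k + k') l fun x => by
      have := hl (x + (P.T : ℤ) • k)
      simp only [LatticeProblem.shift, add_sub_cancel_right] at this
      simp only [LatticeProblem.shift, smul_add, smul_neg]
      rwa [show x - (-((P.T : ℤ) • k) + (P.T : ℤ) • k') = x + (P.T : ℤ) • k - (P.T : ℤ) • k' by abel]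
    rw [show g = P.shift (-k + k') g' from h1, shift_shift, add_neg_cancel_left]
  refine (hG.prod hG).exists_uniform_const
    (Pr := fun q C => ∀ k, ∀ l : ℝ,
      (∀ x, |l * q.1 x - P.shift k q.2 x| ≤ Real.exp (-C)) → q.1 = P.shift k q.2) ?_ ?_
  · intro q C C' hCC' h k l hl
    exact h k l fun x => (hl x).trans (Real.exp_le_exp.2 (by linarith))
  · rintro ⟨g, v⟩ ⟨hg, hv⟩
    have hg' := hGg g hg
    have hv' := hGg v hv
    obtain ⟨y, hy⟩ := (hbd v hv').1
    -- Closeness forces `l ≤ (M + ρ) / ρ` and `l * g ≥ ρ / 2` at the translate of `y`, hence `g ≥ κ`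
    -- there. As `g` decays, only finitely many `k` remain.
    set κ := ρ / 2 / ((M + ρ) / ρ) with hκ
    have hκ0 : 0 < κ := by positivity
    have hfin : {k : Fin N → ℤ | κ ≤ |g (y + (P.T : ℤ) • k)|}.Finite :=
      (hg'.neh.adm.support_large_finite hκ0).preimage (f := fun k => y + (P.T : ℤ) • k)
        fun k _ l _ h => smul_injective_of_ne h
    obtain ⟨C, hC⟩ := hfin.exists_uniform_const
      (Pr := fun k C => ∀ l : ℝ, (∀ x, |l * g x - P.shift k v x| ≤ Real.exp (-C)) →
        g = P.shift k v)
      (fun k C C' hCC' h l hl => h l fun x => (hl x).trans (Real.exp_le_exp.2 (by linarith)))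
      (fun k _ => by
        by_cases hgk : g = P.shift k v
        · exact ⟨0, fun _ _ => hgk⟩
        · obtain ⟨d, hd, hsep⟩ := hg'.pair_sep (hv'.shift k) hgk
          refine ⟨-Real.log d, fun l hl => ?_⟩
          obtain ⟨x, hx⟩ := hsep l
          have := hl x
          rw [neg_neg, Real.exp_log hd] at this
          linarith)
    refine ⟨max C (-Real.log (ρ / 2)), fun k l hl => ?_⟩
    have h1 : Real.exp (-max C (-Real.log (ρ / 2))) ≤ ρ / 2 := by
      rw [← Real.exp_log (show 0 < ρ / 2 by positivity)]
      refine Real.exp_le_exp.2 ?_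
      rw [Real.exp_log (show 0 < ρ / 2 by positivity)]
      have := le_max_right C (-Real.log (ρ / 2))
      linarith
    refine hC k ?_ l fun x => (hl x).trans (Real.exp_le_exp.2 (by
      have := le_max_left C (-Real.log (ρ / 2)); linarith))
    obtain ⟨z, hz⟩ := (hbd g hg').1
    have h2 : l * g z - P.shift k v z ≤ ρ / 2 := (abs_le.1 ((hl z).trans h1)).2
    have h3 := (hbd _ (hv'.shift k)).2 z
    have h4 := (abs_le.1 ((hl (y + (P.T : ℤ) • k)).trans h1)).1
    simp only [LatticeProblem.shift, add_sub_cancel_right] at h4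
    have h5 := hg'.nonneg (y + (P.T : ℤ) • k)
    have hl0 : 0 < l := by
      by_contra hcon
      push Not at hcon
      have := mul_nonpos_of_nonpos_of_nonneg hcon h5
      linarith
    have h6 : l ≤ (M + ρ) / ρ := by
      rw [le_div_iff₀ hρ]
      have := mul_le_mul_of_nonneg_left hz hl0.le
      linarith
    change κ ≤ |g (y + (P.T : ℤ) • k)|
    rw [abs_of_nonneg h5, hκ, div_le_iff₀ (by positivity)]
    have := mul_le_mul_of_nonneg_right h6 h5
    linarith

/-- A function cannot be close, up to scaling, to two different ground states. -/
def ConeSep (P : LatticeProblem N ι) (η : ℝ) : Prop :=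
  ∀ w w' X : (Fin N → ℤ) → ℝ, P.IsGround w → P.IsGround w' → ∀ s t : ℝ, 0 < s → 0 < t →
    (∀ x, |s * X x - w x| ≤ η) → (∀ x, |t * X x - w' x| ≤ η) → w = w'

/-- Eliminating `X` gives `|(t / s) * w - w'| ≤ (1 + t / s) * η`, and a vertex where `w` is at least
`ρ` bounds `t / s` by `L`. -/
theorem exists_coneSep {G : Set ((Fin N → ℤ) → ℝ)} (hG : G.Finite)
    (hGg : ∀ g ∈ G, P.IsGround g)
    (hGW : ∀ w, P.IsGround w → ∃ g ∈ G, ∃ k, w = P.shift k g) : ∃ η > 0, P.ConeSep η := by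
  obtain ⟨d, hd, hsep⟩ := IsGround.exists_sep hG hGg hGW
  obtain ⟨ρ, M, hρ, hM, hbd⟩ := IsGround.exists_bounds P
  set L := 2 * (M + ρ) / ρ with hL
  have hL0 : 0 < L := by positivity
  refine ⟨min (ρ / 2) (d / (L + 1)), by positivity, fun w w' X hw hw' s t hs ht h1 h2 => ?_⟩
  set η := min (ρ / 2) (d / (L + 1)) with hη
  have hη1 : η ≤ ρ / 2 := min_le_left _ _
  have hη2 : η * (L + 1) ≤ d := by
    rw [← le_div_iff₀ (by positivity)]; exact min_le_right _ _
  have hη0 : 0 ≤ η := by positivity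
  obtain ⟨z, hz⟩ := (hbd w hw).1
  have h3 := (abs_le.1 (h1 z)).1
  have h4 := (abs_le.1 (h2 z)).2
  have h5 := (hbd w' hw').2 z
  have hts : t / s ≤ L := by
    rw [div_le_iff₀ hs, hL, div_mul_eq_mul_div, le_div_iff₀ hρ]
    have h6 : ρ / 2 ≤ s * X z := by linarith
    have h7 : t * X z ≤ M + ρ := by linarith
    have h8 := mul_le_mul_of_nonneg_left h6 ht.le
    have h9 := mul_le_mul_of_nonneg_left h7 hs.le
    linarith
  refine hsep w w' hw hw' (t / s) fun x => ?_
  have e : t / s * w x - w' x = (t * X x - w' x) - t / s * (s * X x - w x) := by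
    field_simp; ring
  rw [e]
  refine (abs_sub _ _).trans ?_
  rw [abs_mul, abs_of_pos (div_pos ht hs)]
  have h10 : t / s * |s * X x - w x| ≤ L * η :=
    mul_le_mul hts (h1 x) (abs_nonneg _) hL0.le
  have := h2 x
  linarith

/-! ### Sign-changing pairs -/

/-- A nonnegative and a nonpositive admissible function with disjoint supports. -/
structure SignPair (P : LatticeProblem N ι) (a b : (Fin N → ℤ) → ℝ) : Prop where
  left : P.Adm a
  right : P.Adm b
  nonneg : ∀ x, 0 ≤ a x
  nonpos : ∀ x, b x ≤ 0
  mul : ∀ x, a x * b x = 0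

/-- When the product of the two forms is expanded, the diagonal terms vanish by disjointness and the
cross terms are nonnegative by the signs. -/
theorem SignPair.compat (h : P.SignPair a b) : P.Compat a b := by
  refine ⟨h.left, h.right, fun e => ?_, h.mul⟩
  have hA := P.A_nonneg e
  have hB := P.B_nonneg e
  have e1 : P.form e a * P.form e b = P.A e ^ 2 * (a (P.hd e) * b (P.hd e)) +
      P.B e ^ 2 * (a (P.tl e) * b (P.tl e)) + P.A e * P.B e * (a (P.hd e) * -b (P.tl e)) +
      P.A e * P.B e * (a (P.tl e) * -b (P.hd e)) := by
    simp only [form]; ring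
  rw [e1, h.mul, h.mul]
  have h1 := mul_nonneg (h.nonneg (P.hd e)) (neg_nonneg.2 (h.nonpos (P.tl e)))
  have h2 := mul_nonneg (h.nonneg (P.tl e)) (neg_nonneg.2 (h.nonpos (P.hd e)))
  positivity

theorem SignPair.smul (h : P.SignPair a b) {s t : ℝ} (hs : 0 ≤ s) (ht : 0 ≤ t) :
    P.SignPair (s • a) (t • b) :=
  ⟨h.left.smul s, h.right.smul t, fun x => mul_nonneg hs (h.nonneg x),
    fun x => mul_nonpos_of_nonneg_of_nonpos ht (h.nonpos x), (h.compat.smul hs ht).mul⟩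

theorem abs_max_zero_sub_le (s t : ℝ) : |max s 0 - max t 0| ≤ |s - t| :=
  abs_max_sub_max_le_abs s t 0

theorem abs_min_zero_sub_le (s t : ℝ) : |min s 0 - min t 0| ≤ |s - t| := by
  have := abs_min_sub_min_le_max s 0 t 0
  simpa using this

theorem SignPair.posNeg (hu : P.Adm u) :
    P.SignPair (fun x => max (u x) 0) (fun x => min (u x) 0) :=
  ⟨hu.comp abs_max_zero_sub_le (max_self 0), hu.comp abs_min_zero_sub_le (min_self 0),
    fun _ => le_max_right _ _, fun _ => min_le_right _ _, fun x => by
      rcases le_total (u x) 0 with h | h <;> simp [h]⟩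

theorem SignPair.max_add (h : P.SignPair a b) (x) : max ((a + b) x) 0 = a x := by
  have h1 := h.nonneg x
  have h2 := h.nonpos x
  rw [Pi.add_apply]
  rcases mul_eq_zero.1 (h.mul x) with h0 | h0 <;> rw [h0]
  · rw [zero_add, max_eq_right h2]
  · rw [add_zero, max_eq_left h1]

theorem SignPair.min_add (h : P.SignPair a b) (x) : min ((a + b) x) 0 = b x := by
  have h1 := h.nonneg x
  have h2 := h.nonpos x
  rw [Pi.add_apply]
  rcases mul_eq_zero.1 (h.mul x) with h0 | h0 <;> rw [h0]
  · rw [zero_add, min_eq_left h2]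
  · rw [add_zero, min_eq_right h1]

theorem J_neg (u) : P.J (-u) = P.J u := by
  have h1 : P.Q (-u) = P.Q u := by
    rw [← neg_one_smul ℝ, Q_smul]; simp
  have h2 : P.pot (-u) = P.pot u := by
    unfold pot
    congr 1; funext x
    rw [Pi.neg_apply, ← F_abs, abs_neg, F_abs]
  unfold J; rw [h1, h2]

theorem Neh.neg (h : P.Neh u) : P.Neh (-u) :=
  ⟨by have := h.adm.smul (-1); rwa [neg_one_smul] at this, neg_ne_zero.2 h.ne_zero, fun t ht => by
    rw [smul_neg, J_neg, J_neg]; exact h.max t ht⟩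

/-- Pairs whose two members are, up to scaling, `η`-close to `w` and to `-w'`. -/
structure Near (P : LatticeProblem N ι) (w w' : (Fin N → ℤ) → ℝ) (η : ℝ)
    (a b : (Fin N → ℤ) → ℝ) : Prop where
  pair : P.SignPair a b
  left : ∃ s : ℝ, 0 < s ∧ ∀ x, |s * a x - w x| ≤ η
  right : ∃ t : ℝ, 0 < t ∧ ∀ x, |t * b x + w' x| ≤ η

theorem Near.smul {w w' : (Fin N → ℤ) → ℝ} {η : ℝ} (h : P.Near w w' η a b) {s t : ℝ} (hs : 0 < s)
    (ht : 0 < t) : P.Near w w' η (s • a) (t • b) := by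
  obtain ⟨s', hs', h1⟩ := h.left
  obtain ⟨t', ht', h2⟩ := h.right
  refine ⟨h.pair.smul hs.le ht.le, ⟨s' / s, by positivity, fun x => ?_⟩,
    ⟨t' / t, by positivity, fun x => ?_⟩⟩
  · rw [Pi.smul_apply, smul_eq_mul, ← mul_assoc, div_mul_cancel₀ _ hs.ne']; exact h1 x
  · rw [Pi.smul_apply, smul_eq_mul, ← mul_assoc, div_mul_cancel₀ _ ht.ne']; exact h2 x

/-- The pair maximises the energy on the cone it spans. -/
def IsMaxPair (P : LatticeProblem N ι) (a b : (Fin N → ℤ) → ℝ) : Prop :=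
  ∀ s t : ℝ, 0 ≤ s → 0 ≤ t → P.J (s • a + t • b) ≤ P.J (a + b)

theorem isMaxPair_smul {s t : ℝ} (hs : 0 ≤ s) (ht : 0 ≤ t)
    (h : ∀ s' t' : ℝ, 0 ≤ s' → 0 ≤ t' → P.J (s' • a + t' • b) ≤ P.J (s • a + t • b)) :
    P.IsMaxPair (s • a) (t • b) := fun s' t' hs' ht' => by
  rw [smul_smul, smul_smul]
  exact h _ _ (mul_nonneg hs' hs) (mul_nonneg ht' ht)

/-! ### Finitely supported almost minimisers -/

theorem abs_trunc_sub_le (ε s t : ℝ) : |max (s - ε) 0 - max (t - ε) 0| ≤ |s - t| := by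
  have := abs_max_zero_sub_le (s - ε) (t - ε)
  rwa [sub_sub_sub_cancel_right] at this

/-- The truncations `max (w - ε) 0` have finite support since `w` decays. Their Nehari multiples
converge along a subsequence to some `s₀ w`, of energy at most `level`. -/
theorem exists_finite_almost_min {w : (Fin N → ℤ) → ℝ} (hw : P.IsGround w) {δ η : ℝ} (hδ : 0 < δ)
    (hη : 0 < η) : ∃ v, P.Neh v ∧ (∀ x, 0 ≤ v x) ∧ (Function.support v).Finite ∧
      P.J v < P.level + δ ∧ ∃ s : ℝ, 0 < s ∧ ∀ x, |s * v x - w x| ≤ η := by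
  obtain ⟨x, hx⟩ := Function.ne_iff.1 hw.neh.ne_zero
  have hx : 0 < w x := (hw.nonneg x).lt_of_ne (Ne.symm hx)
  set ε₀ := min η (w x / 2) with hε₀
  have hε₀0 : 0 < ε₀ := by positivity
  set ε : ℕ → ℝ := fun n => ε₀ * (1 / ((n : ℝ) + 1)) with hε
  have hεpos : ∀ n, 0 < ε n := fun n => by positivity
  have hεle : ∀ n, ε n ≤ ε₀ := fun n => by
    refine mul_le_of_le_one_right hε₀0.le ?_
    rw [div_le_one (by positivity)]
    have : (0 : ℝ) ≤ n := n.cast_nonneg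
    linarith
  have hε0 : Tendsto ε atTop (𝓝 0) := by
    simpa [hε] using tendsto_one_div_add_atTop_nhds_zero_nat.const_mul ε₀
  set v : ℕ → (Fin N → ℤ) → ℝ := fun n y => max (w y - ε n) 0 with hv
  have hmax0 : ∀ n, max (0 - ε n) 0 = 0 := fun n => max_eq_right (by have := hεpos n; linarith)
  have hvA : ∀ n, P.Adm (v n) := fun n => hw.neh.adm.comp (abs_trunc_sub_le (ε n)) (hmax0 n)
  have hvQ : ∀ n, P.Q (v n) ≤ P.Q w := fun n =>
    hw.neh.adm.Q_comp_le (abs_trunc_sub_le (ε n)) (hmax0 n)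
  have hvx : ∀ n, w x / 2 ≤ |v n x| := fun n => by
    refine le_trans ?_ (le_abs_self _)
    refine le_trans ?_ (le_max_left _ _)
    have := hεle n
    have := min_le_right η (w x / 2)
    linarith
  have hvw : ∀ n y, |v n y - w y| ≤ ε n := fun n y => by
    have h1 := hεpos n
    have h2 := hw.nonneg y
    simp only [hv]
    rcases le_total (w y - ε n) 0 with h | h
    · rw [max_eq_right h, zero_sub, abs_neg, abs_of_nonneg h2]; linarith
    · rw [max_eq_left h, sub_sub_cancel_left, abs_neg, abs_of_pos h1]
  choose s hs hsN using fun n => (hvA n).exists_neh fun h0 => by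
    have := hvx n
    rw [h0, Pi.zero_apply, abs_zero] at this
    linarith
  obtain ⟨S, hS0, hS⟩ := P.coercive_bound (P.Q w) (show 0 < w x / 2 by positivity)
  have hsS : ∀ n, s n ≤ S := fun n => hS _ 0 (Compat.zero_right (hvA n)) (hvQ n)
    (by rw [Q_zero]; exact Q_nonneg _) ⟨x, hvx n⟩ (Or.inl rfl) (s n) 0 (hs n).le le_rfl (by
      rw [smul_zero, add_zero]; exact P.level_pos.le.trans (hsN n).level_le)
  obtain ⟨s₀, hs₀, φ, hφ, hlim⟩ := (isCompact_Icc (a := (0 : ℝ)) (b := S)).tendsto_subseq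
    fun n => ⟨(hs n).le, hsS n⟩
  have hJ : Tendsto (fun n => P.J (s (φ n) • v (φ n))) atTop (𝓝 (P.J (s₀ • w))) := by
    refine tendsto_J_of_dominated (β := fun e => S * |P.form e w|) (γ := fun y => S * |w y|)
      (summable_mul_rpow hS0.le (fun _ => abs_nonneg _) hw.neh.adm.form)
      (summable_mul_rpow hS0.le (fun _ => abs_nonneg _) hw.neh.adm.pow) ?_ ?_ ?_
    · intro n e
      rw [form_smul, abs_mul, abs_of_pos (hs _)]
      exact mul_le_mul (hsS _) (Adm.abs_form_comp_le (abs_trunc_sub_le _) (hmax0 _) e w)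
        (abs_nonneg _) hS0.le
    · intro n y
      rw [Pi.smul_apply, smul_eq_mul, abs_mul, abs_of_pos (hs _)]
      refine mul_le_mul (hsS _) ?_ (abs_nonneg _) hS0.le
      have := abs_trunc_sub_le (ε (φ n)) (w y) 0
      rwa [hmax0, sub_zero, sub_zero] at this
    · intro y
      refine hlim.mul ?_
      rw [tendsto_iff_norm_sub_tendsto_zero]
      exact squeeze_zero (fun _ => norm_nonneg _) (fun n => hvw _ y) (hε0.comp hφ.tendsto_atTop)
  have h1 : P.J (s₀ • w) < P.level + δ := by
    have := hw.neh.max s₀ hs₀.1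
    rw [hw.J_eq] at this
    linarith
  obtain ⟨n, hn⟩ := (hJ.eventually (gt_mem_nhds h1)).exists
  refine ⟨s (φ n) • v (φ n), hsN _, fun y => mul_nonneg (hs _).le (le_max_right _ _), ?_, hn,
    (s (φ n))⁻¹, inv_pos.2 (hs _), fun y => ?_⟩
  · refine (hw.neh.adm.support_large_finite (hεpos (φ n))).subset fun y hy => ?_
    change _ ≤ |w y|
    rw [abs_of_nonneg (hw.nonneg y)]
    by_contra hcon
    push Not at hcon
    refine hy ?_
    simp only [hv, Pi.smul_apply, smul_eq_mul]
    rw [max_eq_right (by linarith), mul_zero]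
  · rw [Pi.smul_apply, smul_eq_mul, inv_mul_cancel_left₀ (hs _).ne']
    exact (hvw _ y).trans ((hεle _).trans (min_le_left _ _))

theorem J_add_of_separated (ha : P.Adm a) (hb : P.Adm b) (h1 : ∀ e, P.form e a = 0 ∨ P.form e b = 0)
    (h2 : ∀ x, a x * b x = 0) : P.J (a + b) = P.J a + P.J b := by
  have hc : P.Compat a b := ⟨ha, hb, fun e => by
    rcases h1 e with h | h <;> simp [h], h2⟩
  have hQ : P.Q (a + b) = P.Q a + P.Q b := by
    unfold Q
    rw [← ha.form.tsum_add hb.form]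
    congr 1; funext e
    rcases h1 e with h | h <;> simp [h, Real.zero_rpow P.p_pos.ne']
  unfold J
  rw [hQ, hc.pot_add, add_div]
  ring

/-- Far translates of a finitely supported function do not interact. -/
theorem finite_interaction {v : (Fin N → ℤ) → ℝ} (hv : (Function.support v).Finite) :
    {k : Fin N → ℤ | ¬ ((∀ e, P.form e v = 0 ∨ P.form e (P.shift k v) = 0) ∧
      ∀ x, v x * P.shift k v x = 0)}.Finite := by
  set E := ⋃ x ∈ Function.support v, {e | P.hd e = x ∨ P.tl e = x} with hE
  have hEf : E.Finite := hv.biUnion fun x _ => P.finite_star x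
  set X := Function.support v ∪ (P.hd '' E ∪ P.tl '' E) with hX
  have hXf : X.Finite := hv.union ((hEf.image _).union (hEf.image _))
  have hbad : (⋃ y ∈ Function.support v, {k : Fin N → ℤ | y + (P.T : ℤ) • k ∈ X}).Finite :=
    hv.biUnion fun y _ => hXf.preimage (f := fun k => y + (P.T : ℤ) • k)
      fun k _ l _ h => smul_injective_of_ne h
  refine hbad.subset fun k hk => ?_
  by_contra hcon
  have hout : ∀ x ∈ X, P.shift k v x = 0 := fun x hx => by
    by_contra h0
    refine hcon (Set.mem_iUnion₂.2 ⟨x - (P.T : ℤ) • k, h0, ?_⟩)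
    change _ ∈ X
    rwa [sub_add_cancel]
  refine hk ⟨fun e => ?_, fun x => ?_⟩
  · by_cases he : e ∈ E
    · right
      simp [form, hout _ (Or.inr (Or.inl ⟨e, he, rfl⟩)), hout _ (Or.inr (Or.inr ⟨e, he, rfl⟩))]
    · left
      have h1 : v (P.hd e) = 0 := by
        by_contra h; exact he (Set.mem_iUnion₂.2 ⟨_, h, Or.inl rfl⟩)
      have h2 : v (P.tl e) = 0 := by
        by_contra h; exact he (Set.mem_iUnion₂.2 ⟨_, h, Or.inr rfl⟩)
      simp [form, h1, h2]
  · by_cases hx : v x = 0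
    · rw [hx, zero_mul]
    · rw [hout x (Or.inl hx), mul_zero]

/-- For a finitely supported almost minimiser `v` and a far translate, `J` is additive on the cone
of `v` and minus the translate. Maximality on the two rays is then maximality on the cone. -/
theorem exists_near_maxPair {w : (Fin N → ℤ) → ℝ} (hw : P.IsGround w) {δ η : ℝ} (hδ : 0 < δ)
    (hη : 0 < η) : ∃ K : Set (Fin N → ℤ), K.Finite ∧ ∀ k ∉ K, ∃ a b, P.Near w (P.shift k w) η a b ∧
      P.IsMaxPair a b ∧ P.J (a + b) < 2 * P.level + δ := by
  obtain ⟨v, hvN, hv0, hvf, hvJ, s, hs, hsw⟩ := exists_finite_almost_min hw (half_pos hδ) hη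
  refine ⟨_, P.finite_interaction hvf, fun k hk => ?_⟩
  simp only [Set.mem_ofPred_eq, not_not] at hk
  have hneg := (hvN.shift k).neg
  have hform : ∀ e, P.form e (-P.shift k v) = -P.form e (P.shift k v) := fun e => by
    simp only [form, Pi.neg_apply]; ring
  have hJ : ∀ s t : ℝ, P.J (s • v + t • -P.shift k v) = P.J (s • v) + P.J (t • -P.shift k v) :=
    fun s t => J_add_of_separated (hvN.adm.smul s) (hneg.adm.smul t)
      (fun e => by
        rw [form_smul, form_smul, hform]
        rcases hk.1 e with h | h <;> simp [h])
      (fun x => by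
        simp only [Pi.smul_apply, Pi.neg_apply, smul_eq_mul]
        have := hk.2 x
        linear_combination (-(s * t)) * this)
  have hJ1 : P.J (v + -P.shift k v) = P.J v + P.J (-P.shift k v) := by
    simpa using hJ 1 1
  refine ⟨v, -P.shift k v, ⟨⟨hvN.adm, hneg.adm, hv0, fun x => neg_nonpos.2 (hv0 _), fun x => ?_⟩,
    ⟨s, hs, hsw⟩, ⟨s, hs, fun x => ?_⟩⟩, fun s t hs ht => ?_, ?_⟩
  · rw [Pi.neg_apply, mul_neg, hk.2, neg_zero]
  · have := hsw (x - (P.T : ℤ) • k)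
    rw [Pi.neg_apply, mul_neg, neg_add_eq_sub, abs_sub_comm]
    exact this
  · rw [hJ, hJ1]
    exact add_le_add (hvN.max s hs) (hneg.max t ht)
  · rw [hJ1, J_neg, J_shift]; linarith

end LatticeProblem

namespace LatticeProblem

variable {N : ℕ} {ι : Type} {P : LatticeProblem N ι} {a b u : (Fin N → ℤ) → ℝ}

/-! ### Two-bump minimisers -/

theorem Near.mono {w w' : (Fin N → ℤ) → ℝ} {η η' : ℝ} (h : P.Near w w' η a b) (hη : η ≤ η') :
    P.Near w w' η' a b :=
  ⟨h.pair, h.left.imp fun _ h => ⟨h.1, fun x => (h.2 x).trans hη⟩,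
    h.right.imp fun _ h => ⟨h.1, fun x => (h.2 x).trans hη⟩⟩

theorem Near.left_ne_zero {w w' : (Fin N → ℤ) → ℝ} {η : ℝ} (h : P.Near w w' η a b)
    (hw : ∃ x, η < w x) : a ≠ 0 := by
  rintro rfl
  obtain ⟨s, _, hs⟩ := h.left
  obtain ⟨x, hx⟩ := hw
  have := (abs_le.1 (hs x)).1
  simp only [Pi.zero_apply, mul_zero, zero_sub] at this
  linarith

theorem Near.right_ne_zero {w w' : (Fin N → ℤ) → ℝ} {η : ℝ} (h : P.Near w w' η a b)
    (hw : ∃ x, η < w' x) : b ≠ 0 := by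
  rintro rfl
  obtain ⟨s, _, hs⟩ := h.right
  obtain ⟨x, hx⟩ := hw
  have := (abs_le.1 (hs x)).2
  simp only [Pi.zero_apply, mul_zero, zero_add] at this
  linarith

theorem IsMaxPair.nonneg (h : P.IsMaxPair a b) : 0 ≤ P.J (a + b) := by
  have := h 0 0 le_rfl le_rfl
  simpa [J_zero] using this

/-- Rescaling the members of a near pair of low energy to the Nehari set makes them close to the
ground states without further scaling. -/
theorem Near.exists_rescale {w w' : (Fin N → ℤ) → ℝ} (hw : P.IsGround w) (hw' : P.IsGround w')
    {η η₀ δ : ℝ} (hη : 0 < η) (hsep : P.ConeSep η₀) (hη₀ : η ≤ η₀)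
    (hwx : ∃ x, η < w x) (hwx' : ∃ x, η < w' x)
    (hclose : ∀ u, P.Neh u → (∀ x, 0 ≤ u x) → P.J u < P.level + δ →
      ∃ w, P.IsGround w ∧ ∀ x, |u x - w x| ≤ η / 2)
    (h : P.Near w w' η a b) (hmax : P.IsMaxPair a b) (hJ : P.J (a + b) < 2 * P.level + δ) :
    ∃ a' b', P.SignPair a' b' ∧ P.Neh a' ∧ P.Neh b' ∧ P.J a' < P.level + δ ∧
      P.J b' < P.level + δ ∧
      (∀ x, |a' x - w x| ≤ η / 2) ∧ (∀ x, |b' x + w' x| ≤ η / 2) ∧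
      ∀ s t : ℝ, 0 ≤ s → 0 ≤ t → P.J (s • a' + t • b') ≤ P.J (a + b) := by
  obtain ⟨s, hs, hsN⟩ := h.pair.left.exists_neh (h.left_ne_zero hwx)
  obtain ⟨t, ht, htN⟩ := h.pair.right.exists_neh (h.right_ne_zero hwx')
  have hpair := h.pair.smul hs.le ht.le
  have hmax' : ∀ s' t' : ℝ, 0 ≤ s' → 0 ≤ t' →
      P.J (s' • s • a + t' • t • b) ≤ P.J (a + b) := fun s' t' hs' ht' => by
    rw [smul_smul, smul_smul]
    exact hmax _ _ (by positivity) (by positivity)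
  -- The two energies sum to less than `2 * level + δ` and each is at least `level`, so each is
  -- below `level + δ`.
  have h1 := hpair.compat.J_add_ge
  have h2 := hmax' 1 1 zero_le_one zero_le_one
  rw [one_smul, one_smul] at h2
  have h3 := hsN.level_le
  have h4 := htN.level_le
  have hJa : P.J (s • a) < P.level + δ := by linarith
  have hJb : P.J (t • b) < P.level + δ := by linarith
  refine ⟨s • a, t • b, hpair, hsN, htN, hJa, hJb, ?_, ?_, hmax'⟩
  · obtain ⟨w₁, hw₁, hw₁c⟩ := hclose _ hsN hpair.nonneg hJa
    obtain ⟨s', hs', hs'c⟩ := h.left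
    have e : w = w₁ := hsep w w₁ a hw hw₁ s' s hs' hs (fun x => (hs'c x).trans hη₀) fun x =>
      (hw₁c x).trans (by linarith)
    rw [e]; exact hw₁c
  · obtain ⟨w₁, hw₁, hw₁c⟩ := hclose _ htN.neg (fun x => neg_nonneg.2 (hpair.nonpos x))
      (by rwa [J_neg])
    obtain ⟨t', ht', ht'c⟩ := h.right
    have e : w' = w₁ := hsep w' w₁ (-b) hw' hw₁ t' t ht' ht
      (fun x => by
        have := ht'c x
        rw [← abs_neg] at this
        refine le_trans (le_of_eq ?_) (this.trans hη₀)
        congr 1; rw [Pi.neg_apply]; ring)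
      (fun x => by
        have := hw₁c x
        refine le_trans (le_of_eq ?_) (this.trans (by linarith))
        congr 1; simp only [Pi.neg_apply, Pi.smul_apply, smul_eq_mul]; ring)
    intro x
    have := hw₁c x
    rw [← abs_neg, ← e] at this
    refine le_trans (le_of_eq ?_) this
    congr 1; simp only [Pi.neg_apply]; ring

/-- The gap between `η / 2` for the minimiser and `η` for its competitors keeps the minimiser off
the boundary of the constraint, leaving room for small variations. -/
theorem exists_min_near {w : (Fin N → ℤ) → ℝ} (hw : P.IsGround w) {η₀ : ℝ} (hη₀ : 0 < η₀)
    (hsep : P.ConeSep η₀) : ∃ η, 0 < η ∧ η ≤ η₀ ∧ ∃ K : Set (Fin N → ℤ), K.Finite ∧ ∀ k ∉ K,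
      (∃ x, η < w x) ∧ (∃ x, η < P.shift k w x) ∧
      ∃ a b, P.Near w (P.shift k w) (η / 2) a b ∧ P.IsMaxPair a b ∧
        ∀ a' b', P.Near w (P.shift k w) η a' b' → P.IsMaxPair a' b' →
          P.J (a + b) ≤ P.J (a' + b') := by
  have hp := P.p_pos
  obtain ⟨B, hB⟩ := Neh.bound P (P.level + 1)
  obtain ⟨ρ, M, hρ, -, hbd⟩ := IsGround.exists_bounds P
  obtain ⟨S, hS0, hS⟩ := P.coercive_bound B (half_pos hρ)
  set B₁ := 2 ^ (P.p - 1) * (B + B) with hB₁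
  set B₂ := 2 ^ (P.p - 1) * (S ^ P.p * B₁ + S ^ P.p * B₁) with hB₂
  obtain ⟨ρ₂, hρ₂, hsmall⟩ := P.J_ge_of_small B₂
  -- The bounds serve, in order, cone separation, nonvanishing of both members, and smallness of the
  -- remainder `y`, whose size is at most `2 * S * η`.
  set η := min (min η₀ (ρ / 2)) (ρ₂ / (4 * S)) with hη
  have hη0 : 0 < η := by positivity
  have hηη₀ : η ≤ η₀ := (min_le_left _ _).trans (min_le_left _ _)
  have hηρ : η ≤ ρ / 2 := (min_le_left _ _).trans (min_le_right _ _)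
  have hηS : η * (4 * S) ≤ ρ₂ := by
    rw [← le_div_iff₀ (by positivity)]; exact min_le_right _ _
  obtain ⟨δ', hδ', hclose'⟩ := P.exists_ground_close (half_pos hη0)
  set δ := min δ' 1 with hδ
  have hδ0 : 0 < δ := by positivity
  have hclose : ∀ u, P.Neh u → (∀ x, 0 ≤ u x) → P.J u < P.level + δ →
      ∃ w, P.IsGround w ∧ ∀ x, |u x - w x| ≤ η / 2 := fun u hu hu0 hJ =>
    hclose' u hu hu0 (hJ.trans_le (by have := min_le_left δ' 1; linarith))
  obtain ⟨K, hK, hnear⟩ := exists_near_maxPair hw hδ0 hη0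
  refine ⟨η, hη0, hηη₀, K, hK, fun k hk => ?_⟩
  have hwk := hw.shift k
  obtain ⟨x₁, hx₁⟩ := (hbd w hw).1
  obtain ⟨x₂, hx₂⟩ := (hbd _ hwk).1
  have hwx : ∃ x, η < w x := ⟨x₁, by linarith⟩
  have hwx' : ∃ x, η < P.shift k w x := ⟨x₂, by linarith⟩
  refine ⟨hwx, hwx', ?_⟩
  set E : Set ℝ := {m | ∃ a b, P.Near w (P.shift k w) η a b ∧ P.IsMaxPair a b ∧ m = P.J (a + b)}
    with hE
  have hEb : BddBelow E := ⟨0, by rintro _ ⟨a, b, -, h, rfl⟩; exact h.nonneg⟩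
  obtain ⟨a₀, b₀, hn₀, hm₀, hJ₀⟩ := hnear k hk
  have hE0 : E.Nonempty := ⟨_, a₀, b₀, hn₀, hm₀, rfl⟩
  obtain ⟨m, -, hmlim, hmE⟩ := exists_seq_tendsto_sInf hE0 hEb
  have hinf : sInf E < 2 * P.level + δ := (csInf_le hEb ⟨a₀, b₀, hn₀, hm₀, rfl⟩).trans_lt hJ₀
  obtain ⟨n₀, hn₀'⟩ := eventually_atTop.1 (hmlim.eventually (gt_mem_nhds hinf))
  have hres : ∀ n, ∃ a' b', P.SignPair a' b' ∧ P.Neh a' ∧ P.Neh b' ∧ P.J a' < P.level + δ ∧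
      P.J b' < P.level + δ ∧
      (∀ x, |a' x - w x| ≤ η / 2) ∧ (∀ x, |b' x + P.shift k w x| ≤ η / 2) ∧
      ∀ s t : ℝ, 0 ≤ s → 0 ≤ t → P.J (s • a' + t • b') ≤ m (n + n₀) := fun n => by
    obtain ⟨a, b, hab, hmax, hm⟩ := hmE (n + n₀)
    have := hn₀' (n + n₀) (Nat.le_add_left _ _)
    rw [hm] at this ⊢
    exact hab.exists_rescale hw hwk hη0 hsep hηη₀ hwx hwx' hclose hmax this
  choose α β hpair hαN hβN hαJ hβJ hαw hβw hmax using hres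
  have hδ1 : δ ≤ 1 := min_le_right _ _
  have hαB : ∀ n, P.Q (α n) ≤ B := fun n => hB _ (hαN n) (by have := hαJ n; linarith)
  have hβB : ∀ n, P.Q (β n) ≤ B := fun n => hB _ (hβN n) (by have := hβJ n; linarith)
  obtain ⟨M₁, -, hM₁⟩ := P.bound_of_Q B
  obtain ⟨a, φ, hφ, hα⟩ := exists_subseq_pointwise fun n => (hM₁ _ (hαN n).adm (hαB n)).2
  obtain ⟨b, ψ, hψ, hβ⟩ := exists_subseq_pointwise
    fun n => (hM₁ _ (hβN (φ n)).adm (hβB (φ n))).2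
  replace hα : ∀ x, Tendsto (fun n => α (φ (ψ n)) x) atTop (𝓝 (a x)) :=
    fun x => (hα x).comp hψ.tendsto_atTop
  obtain ⟨haA, haB⟩ := adm_of_tendsto (fun n => (hαN (φ (ψ n))).adm) (fun n => hαB _) hα
  obtain ⟨hbA, hbB⟩ := adm_of_tendsto (fun n => (hβN (φ (ψ n))).adm) (fun n => hβB _) hβ
  have hab : P.SignPair a b := ⟨haA, hbA, fun x => ge_of_tendsto' (hα x) fun n => (hpair _).nonneg x,
    fun x => le_of_tendsto' (hβ x) fun n => (hpair _).nonpos x, fun x =>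
      tendsto_nhds_unique ((hα x).mul (hβ x)) (by
        simp_rw [fun n => (hpair (φ (ψ n))).mul x]; exact tendsto_const_nhds)⟩
  have haw : ∀ x, |a x - w x| ≤ η / 2 := fun x =>
    le_of_tendsto' ((hα x).sub_const (w x)).abs fun n => hαw _ x
  have hbw : ∀ x, |b x + P.shift k w x| ≤ η / 2 := fun x =>
    le_of_tendsto' ((hβ x).add_const (P.shift k w x)).abs fun n => hβw _ x
  have hnear' : P.Near w (P.shift k w) (η / 2) a b :=
    ⟨hab, ⟨1, one_pos, fun x => by rw [one_mul]; exact haw x⟩,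
      ⟨1, one_pos, fun x => by rw [one_mul]; exact hbw x⟩⟩
  have ha0 := (hnear'.mono (half_le_self hη0.le)).left_ne_zero hwx
  have hb0 := (hnear'.mono (half_le_self hη0.le)).right_ne_zero hwx'
  obtain ⟨s, t, hs, ht, -, hst⟩ := hab.compat.exists_max ha0
  have hJst : 0 ≤ P.J (s • a + t • b) := by
    have := hst 0 0 le_rfl le_rfl
    simpa [J_zero] using this
  have hax : ∃ x, ρ / 2 ≤ |a x| := ⟨x₁, by
    have := (abs_le.1 (haw x₁)).1
    exact le_trans (by linarith) (le_abs_self _)⟩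
  have hbx : ∃ x, ρ / 2 ≤ |b x| := ⟨x₂, by
    have := (abs_le.1 (hbw x₂)).2
    exact le_trans (by linarith) (neg_le_abs _)⟩
  have hsS : s ≤ S := hS a b hab.compat haB hbB hax (Or.inr hbx) s t hs.le ht.le hJst
  have htS : t ≤ S := hS b a hab.compat.symm hbB haB hbx (Or.inr hax) t s ht.le hs.le
    (by rwa [add_comm])
  -- Lower semicontinuity: the rescaled pairs are within `η` of their limits, so the remainder is
  -- uniformly small, its energy is nonnegative, and Brezis–Lieb gives the inequality.
  have hJle : P.J (s • a + t • b) ≤ sInf E := by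
    set y : ℕ → (Fin N → ℤ) → ℝ := fun n => s • (α (φ (ψ n)) - a) + t • (β (φ (ψ n)) - b) with hy
    have hyA : ∀ n, P.Adm (y n) := fun n =>
      (((hαN _).adm.sub haA).smul s).add (((hβN _).adm.sub hbA).smul t)
    have hyB : ∀ n, P.Q (y n) ≤ B₂ := fun n => by
      refine ((((hαN _).adm.sub haA).smul s).Q_add_le (((hβN _).adm.sub hbA).smul t)).trans ?_
      rw [Q_smul_of_nonneg hs.le, Q_smul_of_nonneg ht.le]
      refine mul_le_mul_of_nonneg_left (add_le_add ?_ ?_) (by positivity)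
      · refine mul_le_mul (Real.rpow_le_rpow hs.le hsS hp.le) ?_ (Q_nonneg _) (by positivity)
        exact ((hαN _).adm.Q_sub_le haA).trans
          (mul_le_mul_of_nonneg_left (add_le_add (hαB _) haB) (by positivity))
      · refine mul_le_mul (Real.rpow_le_rpow ht.le htS hp.le) ?_ (Q_nonneg _) (by positivity)
        exact ((hβN _).adm.Q_sub_le hbA).trans
          (mul_le_mul_of_nonneg_left (add_le_add (hβB _) hbB) (by positivity))
    have hy0 : ∀ x, Tendsto (fun n => y n x) atTop (𝓝 0) := fun x => by
      have := (((hα x).sub_const (a x)).const_mul s).add (((hβ x).sub_const (b x)).const_mul t)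
      rw [sub_self, sub_self, mul_zero, mul_zero, add_zero] at this
      exact this
    have hysmall : ∀ n x, |y n x| < ρ₂ := fun n x => by
      have h1 : |α (φ (ψ n)) x - a x| ≤ η := by
        have h1 := hαw (φ (ψ n)) x
        have h2 := haw x
        rw [abs_le] at h1 h2 ⊢
        constructor <;> linarith
      have h2 : |β (φ (ψ n)) x - b x| ≤ η := by
        have h1 := hβw (φ (ψ n)) x
        have h2 := hbw x
        rw [abs_le] at h1 h2 ⊢
        constructor <;> linarith
      have h3 : |y n x| ≤ s * |α (φ (ψ n)) x - a x| + t * |β (φ (ψ n)) x - b x| := by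
        refine (abs_add_le _ _).trans (le_of_eq ?_)
        simp only [Pi.smul_apply, Pi.sub_apply, smul_eq_mul, abs_mul, abs_of_pos hs, abs_of_pos ht]
      have h4 := mul_le_mul hsS h1 (abs_nonneg _) hS0.le
      have h5 := mul_le_mul htS h2 (abs_nonneg _) hS0.le
      have h6 : 0 < S * η := by positivity
      linarith
    have hJy : ∀ n, 0 ≤ P.J (y n) := fun n =>
      (div_nonneg (Q_nonneg _) (by positivity)).trans (hsmall _ (hyA n) (hyB n) (hysmall n))
    have hsplit := tendsto_J_split (z := s • a + t • b) (t := fun _ => 1) (S := 1) hyA hyB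
      ((haA.smul s).add (hbA.smul t)) (fun _ => by simp) hy0
    have hm' : Tendsto (fun n => m (φ (ψ n) + n₀)) atTop (𝓝 (sInf E)) :=
      hmlim.comp ((tendsto_add_atTop_nat n₀).comp (hφ.comp hψ).tendsto_atTop)
    have h1 := hm'.sub hsplit
    rw [sub_zero] at h1
    refine ge_of_tendsto' h1 fun n => ?_
    have e : y n + (1 : ℝ) • (s • a + t • b) = s • α (φ (ψ n)) + t • β (φ (ψ n)) := by
      simp only [hy, smul_sub, one_smul]; abel
    rw [e, one_smul]
    have := hmax (φ (ψ n)) s t hs.le ht.le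
    have := hJy n
    linarith
  exact ⟨s • a, t • b, hnear'.smul hs ht, isMaxPair_smul hs.le ht.le hst, fun a' b' h1 h2 =>
    hJle.trans (csInf_le hEb ⟨a', b', h1, h2, rfl⟩)⟩

/-- A pair minimising the energy among the maximising pairs in a neighbourhood adds up to a critical
point. -/
theorem grad_eq_zero_of_min_near {w w' : (Fin N → ℤ) → ℝ} {η : ℝ} (hη : 0 < η)
    (hwx : ∃ x, η < w x) (hwx' : ∃ x, η < w' x) (h : P.Near w w' (η / 2) a b)
    (hmax : P.IsMaxPair a b)
    (hmin : ∀ a' b', P.Near w w' η a' b' → P.IsMaxPair a' b' → P.J (a + b) ≤ P.J (a' + b'))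
    (x : Fin N → ℤ) : P.grad (a + b) x = 0 := by
  have h' := h.mono (half_le_self hη.le)
  have ha0 := h'.left_ne_zero hwx
  have hb0 := h'.right_ne_zero hwx'
  obtain ⟨s, hs, hsw⟩ := h.left
  obtain ⟨t, ht, htw⟩ := h.right
  obtain ⟨y, hy⟩ := Function.ne_iff.1 ha0
  obtain ⟨z, hz⟩ := Function.ne_iff.1 hb0
  have hy : 0 < |a y| := abs_pos.2 hy
  have hz : 0 < |b z| := abs_pos.2 hz
  set κ := min (|a y|) (|b z|) / 2 with hκ
  have hκ0 : 0 < κ := by positivity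
  -- Keeps both members at least `κ` in size at `y` and `z`, and uses up at most the reserve `η / 2`
  -- of closeness.
  set ε₀ := min κ (min (η / (2 * s)) (η / (2 * t))) with hε₀
  have hε₀0 : 0 < ε₀ := by positivity
  have hεκ : ε₀ ≤ κ := min_le_left _ _
  have hεs : s * ε₀ ≤ η / 2 := by
    have : ε₀ ≤ η / (2 * s) := (min_le_right _ _).trans (min_le_left _ _)
    rw [le_div_iff₀ (by positivity)] at this
    linarith
  have hεt : t * ε₀ ≤ η / 2 := by
    have : ε₀ ≤ η / (2 * t) := (min_le_right _ _).trans (min_le_right _ _)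
    rw [le_div_iff₀ (by positivity)] at this
    linarith
  set ε : ℕ → ℝ := fun n => ε₀ * (1 / ((n : ℝ) + 1)) with hε
  have hεpos : ∀ n, 0 < ε n := fun n => by positivity
  have hεle : ∀ n, ε n ≤ ε₀ := fun n => by
    refine mul_le_of_le_one_right hε₀0.le ?_
    rw [div_le_one (by positivity)]
    have : (0 : ℝ) ≤ n := n.cast_nonneg
    linarith
  have hε0 : Tendsto ε atTop (𝓝 0) := by
    simpa [hε] using tendsto_one_div_add_atTop_nhds_zero_nat.const_mul ε₀
  set u := a + b with hu
  have huA : P.Adm u := h.pair.left.add h.pair.right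
  have key : ∀ θ : ℝ, |θ| = 1 → 0 ≤ θ * P.grad u x := by
    intro θ hθ
    have hθ0 : θ ≠ 0 := fun h0 => by simp [h0] at hθ
    -- The increments at `x` of the positive and negative parts of `u` when `θ * ε n` is added
    -- there. The perturbed pair is thus again a sign pair, even if the value at `x` changes sign.
    set α : ℕ → ℝ := fun n => max (u x + θ * ε n) 0 - max (u x) 0 with hα
    set β : ℕ → ℝ := fun n => min (u x + θ * ε n) 0 - min (u x) 0 with hβ
    have hθε : ∀ n, |θ * ε n| = ε n := fun n => by rw [abs_mul, hθ, one_mul, abs_of_pos (hεpos n)]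
    have hα' : ∀ n, |α n| ≤ ε n := fun n => by
      have := abs_max_zero_sub_le (u x + θ * ε n) (u x)
      rwa [add_sub_cancel_left, hθε] at this
    have hβ' : ∀ n, |β n| ≤ ε n := fun n => by
      have := abs_min_zero_sub_le (u x + θ * ε n) (u x)
      rwa [add_sub_cancel_left, hθε] at this
    have hae : ∀ n, a + α n • delta x = fun y => max ((u + (θ * ε n) • delta x) y) 0 := fun n => by
      funext y
      rcases eq_or_ne y x with rfl | hne
      · simp only [Pi.add_apply, Pi.smul_apply, delta_self, smul_eq_mul, mul_one, hα]
        rw [← h.pair.max_add y]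
        ring
      · simp only [Pi.add_apply, Pi.smul_apply, delta_of_ne hne, smul_eq_mul, mul_zero, add_zero]
        exact (h.pair.max_add y).symm
    have hbe : ∀ n, b + β n • delta x = fun y => min ((u + (θ * ε n) • delta x) y) 0 := fun n => by
      funext y
      rcases eq_or_ne y x with rfl | hne
      · simp only [Pi.add_apply, Pi.smul_apply, delta_self, smul_eq_mul, mul_one, hβ]
        rw [← h.pair.min_add y]
        ring
      · simp only [Pi.add_apply, Pi.smul_apply, delta_of_ne hne, smul_eq_mul, mul_zero, add_zero]
        exact (h.pair.min_add y).symm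
    have hpair : ∀ n, P.SignPair (a + α n • delta x) (b + β n • delta x) := fun n => by
      rw [hae, hbe]
      exact SignPair.posNeg (huA.add ((adm_delta x).smul _))
    have hδ : ∀ (γ : ℝ) n (y : Fin N → ℤ), |γ| ≤ ε n → |γ * delta x y| ≤ ε₀ := fun γ n y hγ => by
      rw [abs_mul]
      exact (mul_le_of_le_one_right (abs_nonneg _) (delta_abs_le x y)).trans (hγ.trans (hεle n))
    have hbig : ∀ (c : (Fin N → ℤ) → ℝ) (γ : ℝ) n (y : Fin N → ℤ), |γ| ≤ ε n → 2 * κ ≤ |c y| →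
        κ ≤ |(c + γ • delta x) y| := fun c γ n y hγ hc => by
      have h1 := hδ γ n y hγ
      have h2 := abs_sub_abs_le_abs_sub (c y) (-(γ * delta x y))
      rw [abs_neg, sub_neg_eq_add] at h2
      change _ ≤ |c y + γ * delta x y|
      linarith
    have hnear : ∀ n, P.Near w w' η (a + α n • delta x) (b + β n • delta x) := fun n => by
      refine ⟨hpair n, ⟨s, hs, fun y => ?_⟩, ⟨t, ht, fun y => ?_⟩⟩
      · have e : s * (a + α n • delta x) y - w y = (s * a y - w y) + s * (α n * delta x y) := by
          simp only [Pi.add_apply, Pi.smul_apply, smul_eq_mul]; ring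
        rw [e]
        refine (abs_add_le _ _).trans ?_
        rw [abs_mul s, abs_of_pos hs]
        have := mul_le_mul_of_nonneg_left (hδ _ n y (hα' n)) hs.le
        have := hsw y
        linarith
      · have e : t * (b + β n • delta x) y + w' y = (t * b y + w' y) + t * (β n * delta x y) := by
          simp only [Pi.add_apply, Pi.smul_apply, smul_eq_mul]; ring
        rw [e]
        refine (abs_add_le _ _).trans ?_
        rw [abs_mul t, abs_of_pos ht]
        have := mul_le_mul_of_nonneg_left (hδ _ n y (hβ' n)) ht.le
        have := htw y
        linarith
    have hsign : ∀ n, 0 ≤ θ * α n ∧ 0 ≤ θ * β n := fun n => by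
      have he := hεpos n
      rcases (abs_eq zero_le_one).1 hθ with rfl | rfl
      · have h1 : u x ≤ u x + 1 * ε n := by linarith
        have h2 := max_le_max_right 0 h1
        have h3 := min_le_min_right 0 h1
        simp only [hα, hβ]
        constructor <;> linarith
      · have h1 : u x + -1 * ε n ≤ u x := by linarith
        have h2 := max_le_max_right 0 h1
        have h3 := min_le_min_right 0 h1
        simp only [hα, hβ]
        constructor <;> linarith
    refine grad_sign_of_minimax h.pair.compat ha0 hmax (α := α) (β := β) (ε := ε) (κ := κ) hκ0
      (fun n => (hsign n).1) (fun n => (hsign n).2) (fun n => ?_) hθ0 hεpos hε0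
      (fun n => by rw [hθ, one_mul]; exact hα' n) (fun n => by rw [hθ, one_mul]; exact hβ' n)
      (fun n => (hpair n).compat)
      (Or.inr ⟨hb0, fun n => ⟨z, hbig b _ n z (hβ' n) ?_⟩⟩)
      (fun n => ⟨y, hbig a _ n y (hα' n) ?_⟩) (fun n s t hs ht hst => ?_)
    · have h1 := max_add_min (u x + θ * ε n) 0
      have h2 := max_add_min (u x) 0
      simp only [hα, hβ]
      linarith
    · have := min_le_right (|a y|) (|b z|)
      linarith
    · have := min_le_left (|a y|) (|b z|)
      linarith
    · exact hmin _ _ ((hnear n).smul hs ht) (isMaxPair_smul hs.le ht.le hst)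
  have h1 := key 1 (by simp)
  have h2 := key (-1) (by simp)
  linarith

/-- If the ground states form finitely many orbits, there are infinitely many critical points no two
of which are translates of each other. -/
theorem exists_infinite_of_finite_ground (hN : 0 < N) {G : Set ((Fin N → ℤ) → ℝ)} (hG : G.Finite)
    (hGg : ∀ g ∈ G, P.IsGround g)
    (hGW : ∀ w, P.IsGround w → ∃ g ∈ G, ∃ k, w = P.shift k g) :
    ∃ S : Set ((Fin N → ℤ) → ℝ), S.Infinite ∧ (∀ u ∈ S, P.Adm u ∧ ∀ x, P.grad u x = 0) ∧
      S.Pairwise fun u v => ∀ k, v ≠ P.shift k u := by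
  obtain ⟨η₀, hη₀, hsep⟩ := exists_coneSep hG hGg hGW
  obtain ⟨w, hw⟩ := P.exists_ground
  obtain ⟨η, hη, hηη₀, K, hK, hmin⟩ := exists_min_near hw hη₀ hsep
  choose hwx hwx' a b hnear hmax hle using fun k : (Kᶜ : Set (Fin N → ℤ)) => hmin k k.2
  have hle' : η / 2 ≤ η₀ := by linarith
  -- Positive parts put one function on rays close to `w` and to its translate by `l`, so `l = 0` by
  -- separation and aperiodicity. Negative parts then identify the translates of `w` by `i` and `j`.
  have hdist : ∀ (i j : (Kᶜ : Set (Fin N → ℤ))) l, a j + b j = P.shift l (a i + b i) → i = j := by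
    intro i j l hij
    have ha : a j = P.shift l (a i) := funext fun x => by
      rw [← (hnear j).pair.max_add, hij]
      exact (hnear i).pair.max_add _
    have hb : b j = P.shift l (b i) := funext fun x => by
      rw [← (hnear j).pair.min_add, hij]
      exact (hnear i).pair.min_add _
    obtain ⟨s, hs, hsw⟩ := (hnear i).left
    obtain ⟨s', hs', hsw'⟩ := (hnear j).left
    obtain ⟨t, ht, htw⟩ := (hnear i).right
    obtain ⟨t', ht', htw'⟩ := (hnear j).right
    have h1 : P.shift l w = w := hsep _ _ (a j) (hw.shift l) hw s s' hs hs'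
      (fun x => by rw [ha]; exact (hsw _).trans hle') fun x => (hsw' x).trans hle'
    have hl := hw.neh.adm.eq_zero_of_shift_eq hw.neh.ne_zero h1
    rw [hl, shift_zero] at hb
    have hflip : ∀ c d : ℝ, |c * -d - -c| = |c * d - c| := fun c d => by
      rw [← abs_neg]; congr 1; ring
    have h2 : P.shift i w = P.shift j w := hsep _ _ (-(b j)) (hw.shift _) (hw.shift _) t t' ht ht'
      (fun x => by
        rw [hb, Pi.neg_apply, ← abs_neg]
        refine le_trans (le_of_eq ?_) ((htw x).trans hle')
        congr 1; ring)
      (fun x => by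
        rw [Pi.neg_apply, ← abs_neg]
        refine le_trans (le_of_eq ?_) ((htw' x).trans hle')
        congr 1; ring)
    have h3 : P.shift (-(j : Fin N → ℤ) + i) w = w := by
      rw [← shift_shift, h2, shift_shift, neg_add_cancel, shift_zero]
    have h4 := hw.neh.adm.eq_zero_of_shift_eq hw.neh.ne_zero h3
    exact Subtype.ext (neg_add_eq_zero.1 h4).symm
  refine ⟨Set.range fun k => a k + b k, ?_, ?_, ?_⟩
  · have : Nonempty (Fin N) := ⟨⟨0, hN⟩⟩
    have : Infinite (Kᶜ : Set (Fin N → ℤ)) := hK.infinite_compl.to_subtype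
    exact Set.infinite_range_of_injective fun i j hij =>
      hdist i j 0 (by rw [shift_zero]; exact hij.symm)
  · rintro _ ⟨k, rfl⟩
    exact ⟨(hnear k).pair.left.add (hnear k).pair.right,
      grad_eq_zero_of_min_near hη (hwx k) (hwx' k) (hnear k) (hmax k) (hle k)⟩
  · rintro _ ⟨i, rfl⟩ _ ⟨j, rfl⟩ hne k hk
    exact hne (by rw [hdist i j k hk])

/-- The problem has infinitely many critical points no two of which are translates of each other. -/
theorem exists_infinite_critical (P : LatticeProblem N ι) (hN : 0 < N) :
    ∃ S : Set ((Fin N → ℤ) → ℝ), S.Infinite ∧ (∀ u ∈ S, P.Adm u ∧ ∀ x, P.grad u x = 0) ∧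
      S.Pairwise fun u v => ∀ k, v ≠ P.shift k u := by
  let r : Setoid ((Fin N → ℤ) → ℝ) :=
    { r := fun u v => ∃ k, v = P.shift k u
      iseqv := ⟨fun u => ⟨0, (shift_zero u).symm⟩, fun ⟨k, h⟩ => ⟨-k, by
        rw [h, shift_shift, neg_add_cancel, shift_zero]⟩, fun ⟨k, h⟩ ⟨l, h'⟩ => ⟨l + k, by
        rw [h', h, shift_shift]⟩⟩ }
  let W : Set (Quotient r) := Quotient.mk r '' {w | P.IsGround w}
  have hrep : ∀ q ∈ W, P.IsGround q.out := by
    rintro _ ⟨w, hw, rfl⟩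
    obtain ⟨k, hk⟩ : ∃ k, w = P.shift k (Quotient.mk r w).out := Quotient.mk_out (s := r) w
    have := hw.shift (-k)
    rwa [hk, shift_shift, neg_add_cancel, shift_zero] at this
  by_cases hW : W.Finite
  · refine exists_infinite_of_finite_ground hN (G := Quotient.out '' W) (hW.image _) ?_ ?_
    · rintro _ ⟨q, hq, rfl⟩
      exact hrep q hq
    · intro w hw
      exact ⟨_, ⟨_, ⟨w, hw, rfl⟩, rfl⟩, Quotient.mk_out (s := r) w⟩
  · refine ⟨Quotient.out '' W, Set.Infinite.image (Quotient.out_injective.injOn) hW, ?_, ?_⟩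
    · rintro _ ⟨q, hq, rfl⟩
      exact ⟨(hrep q hq).neh.adm, (hrep q hq).grad_eq_zero⟩
    · rintro _ ⟨q, -, rfl⟩ _ ⟨q', -, rfl⟩ hne k hk
      refine hne ?_
      have : q = q' := by
        rw [← q.out_eq, ← q'.out_eq]
        exact Quotient.sound ⟨k, hk⟩
      rw [this]

end LatticeProblem

/-! ### The discrete Sobolev inequality -/

open MeasureTheory in
theorem Measure.pi_count_int (N : ℕ) :
    Measure.pi (fun _ : Fin N => (Measure.count : Measure ℤ)) = Measure.count := by
  refine Measure.ext_of_singleton fun x => ?_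
  rw [← Set.univ_pi_singleton, Measure.pi_pi]
  simp [Set.univ_pi_singleton]

/-- Telescope from `m` to `+∞`, where `g` vanishes. -/
theorem ofReal_abs_le_tsum_abs_sub {g : ℤ → ℝ} (hg : Tendsto g atTop (𝓝 0)) (m : ℤ) :
    ENNReal.ofReal |g m| ≤ ∑' j : ℤ, ENNReal.ofReal |g (j + 1) - g j| := by
  have key : ∀ n : ℕ, ENNReal.ofReal |g m - g (m + n)|
      ≤ ∑' j : ℤ, ENNReal.ofReal |g (j + 1) - g j| := by
    intro n
    have h1 : |g m - g (m + n)| ≤ ∑ k ∈ Finset.range n, |g (m + k + 1) - g (m + k)| := by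
      have h := Finset.sum_range_sub (fun k : ℕ => g (m + k)) n
      have h2 : g m - g (m + n) = -∑ k ∈ Finset.range n, (g (m + k + 1) - g (m + k)) := by
        simp only [Nat.cast_add, Nat.cast_one, ← add_assoc, Nat.cast_zero, add_zero] at h
        rw [h]; ring
      rw [h2, abs_neg]
      exact Finset.abs_sum_le_sum_abs _ _
    have hinj : Function.Injective (fun k : ℕ => m + (k : ℤ)) := fun a b h => by
      simpa using h
    calc ENNReal.ofReal |g m - g (m + n)|
        ≤ ENNReal.ofReal (∑ k ∈ Finset.range n, |g (m + k + 1) - g (m + k)|) :=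
          ENNReal.ofReal_le_ofReal h1
      _ = ∑ k ∈ Finset.range n, ENNReal.ofReal |g (m + k + 1) - g (m + k)| :=
          ENNReal.ofReal_sum_of_nonneg fun _ _ => abs_nonneg _
      _ ≤ ∑' k : ℕ, ENNReal.ofReal |g (m + k + 1) - g (m + k)| := ENNReal.sum_le_tsum _
      _ ≤ _ := ENNReal.tsum_comp_le_tsum_of_injective hinj
          (fun j : ℤ => ENNReal.ofReal |g (j + 1) - g j|)
  have hlim : Tendsto (fun n : ℕ => ENNReal.ofReal |g m - g (m + n)|) atTop
      (𝓝 (ENNReal.ofReal |g m - 0|)) := by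
    refine ENNReal.tendsto_ofReal (Tendsto.abs (tendsto_const_nhds.sub ?_))
    exact hg.comp (tendsto_atTop_add_const_left _ m tendsto_natCast_atTop_atTop)
  rw [sub_zero] at hlim
  exact le_of_tendsto' hlim key

/-- The Gagliardo-Nirenberg inequality on `ℤ^N`. -/
theorem tsum_ofReal_abs_rpow_le {N : ℕ} (hN : 2 ≤ N) {g : (Fin N → ℤ) → ℝ}
    (hg : Tendsto g cofinite (𝓝 0)) :
    ∑' x, ENNReal.ofReal |g x| ^ ((N : ℝ) / (N - 1)) ≤
      (∑' x, ∑ i, ENNReal.ofReal |g (x + Pi.single i 1) - g x|) ^ ((N : ℝ) / (N - 1)) := by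
  have hN' : (1 : ℝ) < N := by exact_mod_cast hN
  have hconj : Real.HolderConjugate (Fintype.card (Fin N)) ((N : ℝ) / (N - 1)) := by
    rw [Fintype.card_fin]
    exact Real.HolderConjugate.conjExponent hN'
  have hmeas : Measurable fun x : Fin N → ℤ =>
      ∑ i, ENNReal.ofReal |g (x + Pi.single i 1) - g x| := measurable_of_countable _
  -- Gagliardo's inequality for products of line integrals, with counting measure. On each
  -- coordinate line through `x`, telescoping bounds `|g x|` by the sum of the differences.
  have h := MeasureTheory.lintegral_prod_lintegral_pow_le
    (fun _ : Fin N => (MeasureTheory.Measure.count : MeasureTheory.Measure ℤ)) hconj hmeas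
  rw [Measure.pi_count_int, MeasureTheory.lintegral_count, MeasureTheory.lintegral_count] at h
  refine le_trans (ENNReal.tsum_le_tsum fun x => ?_) h
  have hline : ∀ i, ENNReal.ofReal |g x| ≤ ∫⁻ xi : ℤ, ∑ j, ENNReal.ofReal
      |g (Function.update x i xi + Pi.single j 1) - g (Function.update x i xi)|
      ∂MeasureTheory.Measure.count := by
    intro i
    rw [MeasureTheory.lintegral_count]
    have hinj : Function.Injective fun j : ℤ => Function.update x i j :=
      Function.update_injective x i
    have h1 := ofReal_abs_le_tsum_abs_sub (g := fun j => g (Function.update x i j))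
      ((hg.comp hinj.tendsto_cofinite).mono_left (by rw [Int.cofinite_eq]; exact le_sup_right))
      (x i)
    simp only [Function.update_eq_self] at h1
    refine h1.trans (ENNReal.tsum_le_tsum fun j => ?_)
    have h2 : Function.update x i (j + 1) = Function.update x i j + Pi.single i 1 := by
      ext k
      by_cases hk : k = i
      · subst hk; simp
      · simp [hk]
    rw [h2]
    exact Finset.single_le_sum (f := fun k => ENNReal.ofReal
      |g (Function.update x i j + Pi.single k 1) - g (Function.update x i j)|)
      (fun _ _ => zero_le) (Finset.mem_univ i)
  have hN1 : (0 : ℝ) ≤ 1 / (Fintype.card (Fin N) - 1) := by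
    rw [Fintype.card_fin]; exact div_nonneg zero_le_one (by linarith)
  calc ENNReal.ofReal |g x| ^ ((N : ℝ) / (N - 1))
      = ∏ i : Fin N, ENNReal.ofReal |g x| ^ ((1 : ℝ) / (Fintype.card (Fin N) - 1)) := by
        rw [Finset.prod_const, Finset.card_univ, Fintype.card_fin, ← ENNReal.rpow_natCast,
          ← ENNReal.rpow_mul]
        congr 1; ring
    _ ≤ _ := Finset.prod_le_prod' fun i _ => ENNReal.rpow_le_rpow (hline i) hN1

theorem abs_abs_rpow_sub_le {c : ℝ} (hc : 2 ≤ c) (a b : ℝ) :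
    |(|a| ^ c - |b| ^ c)| ≤ c * (|a| ^ (c - 1) * |a - b| + |b| ^ (c - 1) * |a - b|) := by
  have key : ∀ a b : ℝ, |a| ^ c - |b| ^ c ≤ c * (|a| ^ (c - 1) * |a - b|) := by
    intro a b
    have h := abs_rpow_sub_le hc b (a - b)
    rw [add_sub_cancel] at h
    refine h.trans ?_
    rw [mul_assoc]
    refine mul_le_mul_of_nonneg_left ?_ (by linarith)
    refine (le_abs_self _).trans_eq ?_
    rw [abs_mul, abs_mul, abs_of_nonneg (Real.rpow_nonneg (abs_nonneg a) _)]
    congr 1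
    rw [show c - 1 = c - 2 + 1 by ring, Real.rpow_add_one' (abs_nonneg a) (by linarith)]
  have hc0 : 0 ≤ c := by linarith
  have h1 : 0 ≤ c * (|a| ^ (c - 1) * |a - b|) := by positivity
  have h2 : 0 ≤ c * (|b| ^ (c - 1) * |a - b|) := by positivity
  rw [abs_le]
  have := key a b
  have h3 := key b a
  rw [abs_sub_comm b a] at h3
  constructor <;> linarith

/-- Differences of `|u| ^ c` are bounded by `c` times `|u| ^ (c - 1)` at the two ends times `|u (τ
x) - u x|`; Hölder with exponents `p / (p - 1)` and `p` follows. Bijectivity of `τ` makes both ends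
contribute the same `ℓ^r` sum. -/
theorem tsum_ofReal_abs_rpow_sub_le {α : Type*} {c p r : ℝ} (hc : 2 ≤ c) (hp : 1 < p)
    (hexp : (c - 1) * (p / (p - 1)) = r) {τ : α → α}
    (hτ : τ.Bijective) {u : α → ℝ}
    (hu : Summable fun x => |u x| ^ r) {D : ℝ} (hsum : Summable fun x => |u (τ x) - u x| ^ p)
    (hD : ∑' x, |u (τ x) - u x| ^ p ≤ D) :
    ∑' x, ENNReal.ofReal |(|u (τ x)| ^ c - |u x| ^ c)| ≤
      ENNReal.ofReal (c * 2 * ((∑' x, |u x| ^ r) ^ ((p - 1) / p) * D ^ (1 / p))) := by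
  have hp1 : 0 < p - 1 := by linarith
  have hc0 : 0 < c := by linarith
  have hpq : Real.HolderConjugate (p / (p - 1)) p := (Real.HolderConjugate.conjExponent hp).symm
  have hpow : ∀ a : ℝ, (|a| ^ (c - 1)) ^ (p / (p - 1)) = |a| ^ r := fun a => by
    rw [← Real.rpow_mul (abs_nonneg a), hexp]
  have hol : ∀ w : α → ℝ, (Summable fun x => |w x| ^ r) →
      (∑' x, |w x| ^ r = ∑' x, |u x| ^ r) →
      (Summable fun x => |w x| ^ (c - 1) * |u (τ x) - u x|) ∧
      ∑' x, |w x| ^ (c - 1) * |u (τ x) - u x| ≤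
        (∑' x, |u x| ^ r) ^ ((p - 1) / p) * D ^ (1 / p) := by
    intro w hw hwA
    have h := Real.summable_and_inner_le_Lp_mul_Lq_tsum_of_nonneg hpq
      (f := fun x => |w x| ^ (c - 1)) (g := fun x => |u (τ x) - u x|)
      (fun x => Real.rpow_nonneg (abs_nonneg _) _) (fun x => abs_nonneg _)
      (by simpa only [hpow] using hw) hsum
    refine ⟨h.1, h.2.trans ?_⟩
    simp only [hpow, one_div_div, hwA]
    exact mul_le_mul_of_nonneg_left (Real.rpow_le_rpow
      (tsum_nonneg fun x => Real.rpow_nonneg (abs_nonneg _) _) hD (by positivity))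
      (Real.rpow_nonneg (tsum_nonneg fun x => Real.rpow_nonneg (abs_nonneg _) _) _)
  have h1 := hol u hu rfl
  have h2 := hol (fun x => u (τ x)) ((Equiv.ofBijective τ hτ).summable_iff (f := fun x => |u x| ^ r) |>.2 hu)
    ((Equiv.ofBijective τ hτ).tsum_eq fun x => |u x| ^ r)
  have hs3 := (h2.1.add h1.1).mul_left c
  calc ∑' x, ENNReal.ofReal |(|u (τ x)| ^ c - |u x| ^ c)|
      ≤ ∑' x, ENNReal.ofReal (c * (|u (τ x)| ^ (c - 1) * |u (τ x) - u x| +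
          |u x| ^ (c - 1) * |u (τ x) - u x|)) :=
        ENNReal.tsum_le_tsum fun x => ENNReal.ofReal_le_ofReal (abs_abs_rpow_sub_le hc _ _)
    _ = ENNReal.ofReal (∑' x, c * (|u (τ x)| ^ (c - 1) * |u (τ x) - u x| +
          |u x| ^ (c - 1) * |u (τ x) - u x|)) :=
        (ENNReal.ofReal_tsum_of_nonneg (fun x => by positivity) hs3).symm
    _ ≤ _ := by
        refine ENNReal.ofReal_le_ofReal ?_
        rw [tsum_mul_left, h2.1.tsum_add h1.1, mul_assoc]
        refine mul_le_mul_of_nonneg_left ?_ hc0.le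
        linarith [h1.2, h2.2]

/-- The Sobolev inequality on `ℤ^N`. -/
theorem lattice_sobolev {N : ℕ} {p : ℝ} (hp : 2 ≤ p) (hpN : p < N) {u : (Fin N → ℤ) → ℝ}
    (hu : Summable fun x => |u x| ^ criticalExponent N p) {D : ℝ}
    (hsum : ∀ i, Summable fun x => |u (x + Pi.single i 1) - u x| ^ p)
    (hD : ∀ i, ∑' x, |u (x + Pi.single i 1) - u x| ^ p ≤ D) :
    ∑' x, |u x| ^ criticalExponent N p ≤
      (N * (p * (N - 1) / (N - p) * 2)) ^ criticalExponent N p *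
        D ^ (criticalExponent N p / p) := by
  have hN2 : (2 : ℝ) < N := by linarith
  have hN2' : 2 ≤ N := by exact_mod_cast hN2.le
  have hNp : (0 : ℝ) < N - p := by linarith
  have hN1 : (0 : ℝ) < N - 1 := by linarith
  have hp0 : 0 < p := by linarith
  have hp1 : 0 < p - 1 := by linarith
  obtain ⟨r, hr'⟩ : ∃ r, r = (N : ℝ) * p / (N - p) := ⟨_, rfl⟩
  rw [criticalExponent, ← hr'] at hu ⊢
  have hr0 : 0 < r := by rw [hr']; positivity
  -- The power for which both `c * N / (N - 1)` and `(c - 1) * p / (p - 1)` equal `r`: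
  -- Gagliardo–Nirenberg and Hölder then yield the same sum `A`.
  obtain ⟨c, hc⟩ : ∃ c, c = p * (N - 1) / (N - p) := ⟨_, rfl⟩
  rw [← hc]
  have hc0 : 0 < c := by rw [hc]; positivity
  have hc2 : 2 ≤ c := by
    refine hp.trans ?_
    rw [hc, le_div_iff₀ hNp]
    exact mul_le_mul_of_nonneg_left (by linarith) hp0.le
  obtain ⟨A, hA⟩ : ∃ A, A = ∑' x, |u x| ^ r := ⟨_, rfl⟩
  rw [← hA]
  have hA0 : 0 ≤ A := hA ▸ tsum_nonneg fun x => Real.rpow_nonneg (abs_nonneg _) _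
  have i0 : Fin N := ⟨0, by omega⟩
  have hD0 : 0 ≤ D := (tsum_nonneg fun x => Real.rpow_nonneg (abs_nonneg _) _).trans (hD i0)
  have hexp : (c - 1) * (p / (p - 1)) = r := by
    rw [hc, hr']; field_simp; ring
  obtain ⟨M, hM⟩ : ∃ M, M = A ^ ((p - 1) / p) * D ^ (1 / p) := ⟨_, rfl⟩
  have hM0 : 0 ≤ M := by rw [hM]; positivity
  have hdir : ∀ i : Fin N, ∑' x, ENNReal.ofReal |(|u (x + Pi.single i 1)| ^ c - |u x| ^ c)| ≤
      ENNReal.ofReal (c * 2 * M) := fun i => by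
    rw [hM, hA]
    exact tsum_ofReal_abs_rpow_sub_le (τ := fun x => x + Pi.single i 1) hc2 (by linarith) hexp
      (AddGroup.addRight_bijective _) hu (hsum i) (hD i)
  have hg : Tendsto (fun x => |u x| ^ c) cofinite (𝓝 0) := by
    have h := hu.tendsto_cofinite_zero.rpow_const (p := c / r) (Or.inr (by positivity))
    rw [Real.zero_rpow (by positivity)] at h
    refine h.congr fun x => ?_
    rw [← Real.rpow_mul (abs_nonneg _), mul_div_cancel₀ _ hr0.ne']
  have hGN := tsum_ofReal_abs_rpow_le hN2' hg
  have hL : ∑' x, ENNReal.ofReal |(|u x| ^ c)| ^ ((N : ℝ) / (N - 1)) = ENNReal.ofReal A := by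
    rw [hA, ENNReal.ofReal_tsum_of_nonneg (fun x => Real.rpow_nonneg (abs_nonneg _) _) hu]
    refine tsum_congr fun x => ?_
    rw [abs_of_nonneg (Real.rpow_nonneg (abs_nonneg _) _),
      ENNReal.ofReal_rpow_of_nonneg (Real.rpow_nonneg (abs_nonneg _) _) (by positivity),
      ← Real.rpow_mul (abs_nonneg _)]
    congr 2
    rw [hc, hr']; field_simp
  have hR : ∑' x, ∑ i, ENNReal.ofReal |(|u (x + Pi.single i 1)| ^ c - |u x| ^ c)| ≤
      ENNReal.ofReal (N * (c * 2 * M)) := by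
    rw [Summable.tsum_finsetSum fun _ _ => ENNReal.summable]
    refine (Finset.sum_le_sum fun i _ => hdir i).trans ?_
    rw [Finset.sum_const, Finset.card_univ, Fintype.card_fin, nsmul_eq_mul,
      ENNReal.ofReal_mul (Nat.cast_nonneg N), ENNReal.ofReal_natCast]
  have hn0 : 0 ≤ (N : ℝ) / (N - 1) := by positivity
  have hfin : A ≤ (N * (c * 2 * M)) ^ ((N : ℝ) / (N - 1)) := by
    rw [hL] at hGN
    have h := hGN.trans (ENNReal.rpow_le_rpow hR hn0)
    rw [ENNReal.ofReal_rpow_of_nonneg (by positivity) hn0] at h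
    exact (ENNReal.ofReal_le_ofReal_iff (by positivity)).1 h
  rcases hA0.eq_or_lt with h0 | hApos
  · rw [← h0]; positivity
  obtain ⟨s, hs⟩ : ∃ s, s = (N : ℝ) / (N - 1) := ⟨_, rfl⟩
  rw [← hs] at hfin hn0
  have hs0 : 0 < s := by rw [hs]; positivity
  obtain ⟨C, hC⟩ : ∃ C, C = N * (c * 2) := ⟨_, rfl⟩
  rw [← hC]
  have hC0 : 0 < C := by rw [hC]; positivity
  have h1 : A ≤ C ^ s * (A ^ ((p - 1) / p * s) * D ^ (1 / p * s)) := by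
    rw [Real.rpow_mul hA0, Real.rpow_mul hD0,
      ← Real.mul_rpow (by positivity) (by positivity),
      ← Real.mul_rpow hC0.le (by positivity)]
    calc A ≤ _ := hfin
      _ = _ := by rw [hC, hM]; ring_nf
  -- Absorption of `A` from the right-hand side, which is allowed since `A` is finite and positive;
  -- the exponent left over is `s / r`.
  have h2 : A ^ (1 - (p - 1) / p * s) ≤ C ^ s * D ^ (1 / p * s) := by
    rw [Real.rpow_sub hApos, Real.rpow_one, div_le_iff₀ (by positivity)]
    linarith [h1]
  have hθ : 1 - (p - 1) / p * s = s / r := by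
    rw [hs, hr']; field_simp; ring
  rw [hθ] at h2
  have h3 := Real.rpow_le_rpow (by positivity) h2 (by positivity : 0 ≤ r / s)
  rw [← Real.rpow_mul hA0, Real.mul_rpow (by positivity) (by positivity),
    ← Real.rpow_mul hC0.le, ← Real.rpow_mul hD0] at h3
  have e1 : s / r * (r / s) = 1 := by field_simp
  have e2 : s * (r / s) = r := by field_simp
  have e3 : 1 / p * s * (r / s) = r / p := by field_simp
  rwa [e1, e2, e3, Real.rpow_one] at h3

/-! ### Finitely supported approximations -/

namespace LatticeProblem

variable {N : ℕ} {ι : Type} {P : LatticeProblem N ι} {u : (Fin N → ℤ) → ℝ}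

theorem abs_clamp_sub_clamp_le (ε s t : ℝ) :
    |max (-ε) (min ε s) - max (-ε) (min ε t)| ≤ |s - t| := by
  rw [max_comm (-ε), max_comm (-ε), min_comm ε, min_comm ε]
  refine (abs_max_sub_max_le_abs (min s ε) (min t ε) (-ε)).trans ?_
  simpa using abs_min_sub_min_le_max s ε t ε

/-- Subtract from `u` its clamp to `[-ε, ε]`. What remains lives where `|u| ≥ ε`, a finite set, and
the clamps tend to zero in energy by dominated convergence. -/
theorem Adm.exists_approx (hu : P.Adm u) : ∃ φ : ℕ → (Fin N → ℤ) → ℝ,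
    (∀ n, (Function.support (φ n)).Finite) ∧ (∀ x, Tendsto (fun n => φ n x) atTop (𝓝 (u x))) ∧
    Tendsto (fun n => P.Q (φ n - u)) atTop (𝓝 0) := by
  set ε : ℕ → ℝ := fun n => 1 / ((n : ℝ) + 1) with hε
  have hε0 : ∀ n, 0 < ε n := fun n => Nat.one_div_pos_of_nat
  have hεlim : Tendsto ε atTop (𝓝 0) := tendsto_one_div_add_atTop_nhds_zero_nat
  set ψ : ℕ → ℝ → ℝ := fun n t => max (-ε n) (min (ε n) t) with hψ
  have hψ_lip : ∀ n s t, |ψ n s - ψ n t| ≤ |s - t| := fun n => abs_clamp_sub_clamp_le (ε n)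
  have hψ_zero : ∀ n, ψ n 0 = 0 := fun n => by
    simp only [hψ, min_eq_right (hε0 n).le, max_eq_right (neg_nonpos.2 (hε0 n).le)]
  have hψ_le : ∀ n t, |ψ n t| ≤ ε n := fun n t =>
    _root_.abs_le.2 ⟨le_max_left _ _, max_le (by linarith [hε0 n]) (min_le_left _ _)⟩
  have hψ_lim : ∀ t, Tendsto (fun n => ψ n t) atTop (𝓝 0) := fun t =>
    squeeze_zero_norm (fun n => hψ_le n t) hεlim
  refine ⟨fun n x => u x - ψ n (u x), fun n => ?_, fun x => ?_, ?_⟩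
  · refine (hu.support_large_finite (hε0 n)).subset fun x hx => ?_
    by_contra hcon
    rw [Set.mem_ofPred_eq, not_le, abs_lt] at hcon
    apply hx
    simp only [hψ, min_eq_right hcon.2.le, max_eq_right hcon.1.le, sub_self]
  · simpa using (hψ_lim (u x)).const_sub (u x)
  · have hQ : ∀ n, P.Q ((fun x => u x - ψ n (u x)) - u) =
        ∑' e, |P.form e fun x => ψ n (u x)| ^ P.p := fun n => by
      refine tsum_congr fun e => ?_
      have : ((fun x => u x - ψ n (u x)) - u) = (-1 : ℝ) • fun x => ψ n (u x) := by
        ext x; simp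
      rw [this, form_smul, neg_one_mul, abs_neg]
    simp only [hQ]
    have hp := P.p_pos
    have hlim := tendsto_tsum_of_dominated_convergence (𝓕 := atTop)
      (f := fun n e => |P.form e fun x => ψ n (u x)| ^ P.p) (g := fun _ => 0) hu.form
      (fun e => ?_) (Eventually.of_forall fun n e => ?_)
    · simpa using hlim
    · have h1 : Tendsto (fun n => P.form e fun x => ψ n (u x)) atTop (𝓝 0) := by
        have := ((hψ_lim (u (P.hd e))).const_mul (P.A e)).sub
          ((hψ_lim (u (P.tl e))).const_mul (P.B e))
        simp only [mul_zero, sub_zero] at this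
        exact this
      have h2 := h1.abs.rpow_const (p := P.p) (Or.inr hp.le)
      rwa [abs_zero, Real.zero_rpow hp.ne'] at h2
    · rw [Real.norm_of_nonneg (by positivity)]
      exact Real.rpow_le_rpow (abs_nonneg _) (abs_form_comp_le (hψ_lip n) (hψ_zero n) e u) hp.le

end LatticeProblem

/-! ### The lattice graph -/

/-- The periods form a subgroup, and it contains the generators `Pi.single i T`. -/
theorem IsPeriodic.add_smul {N : ℕ} {α : Type*} {T : ℕ} {h : (Fin N → ℤ) → α}
    (hh : IsPeriodic T h) (x k : Fin N → ℤ) : h (x + (T : ℤ) • k) = h x := by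
  let H : AddSubgroup (Fin N → ℤ) :=
    { carrier := {a | ∀ x, h (x + a) = h x}
      zero_mem' := fun x => by rw [add_zero]
      add_mem' := fun {a b} ha hb x => by rw [← add_assoc, hb, ha]
      neg_mem' := fun {a} ha x => by rw [← ha, neg_add_cancel_right] }
  have hk : (T : ℤ) • k = ∑ i, k i • Pi.single i (T : ℤ) := by
    ext j
    simp [Finset.sum_apply, Pi.single_apply, mul_comm]
  have : (T : ℤ) • k ∈ H := by
    rw [hk]
    exact H.sum_mem fun i _ => H.zsmul_mem (show Pi.single i (T : ℤ) ∈ H from fun x => hh x i) _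
  exact this x

theorem latticeGraph_adj_add_right {N : ℕ} {x y : Fin N → ℤ} (a : Fin N → ℤ)
    (h : (latticeGraph N).Adj x y) : (latticeGraph N).Adj (x + a) (y + a) := by
  simpa [latticeGraph] using h

theorem latticeGraph_adj_add_single {N : ℕ} (x : Fin N → ℤ) (i : Fin N) :
    (latticeGraph N).Adj x (x + Pi.single i 1) := by
  simp [latticeGraph, Pi.single_apply, apply_ite abs]

/-- Translation of the darts of the lattice graph. -/
def dartTranslate {N : ℕ} (a : Fin N → ℤ) :
    (latticeGraph N).Dart ≃ (latticeGraph N).Dart where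
  toFun d := ⟨(d.fst + a, d.snd + a), latticeGraph_adj_add_right a d.adj⟩
  invFun d := ⟨(d.fst + -a, d.snd + -a), latticeGraph_adj_add_right (-a) d.adj⟩
  left_inv d := by ext <;> simp
  right_inv d := by ext <;> simp

/-! ### The energy of the `p`-Laplace equation on the lattice -/

section Weights

variable {N : ℕ} (p : ℝ) (V : (Fin N → ℤ) → ℝ)

/-- The terms of the energy: darts of the lattice graph, and vertices. -/
abbrev LatticeTerm (N : ℕ) : Type := (latticeGraph N).Dart ⊕ (Fin N → ℤ)

namespace LatticeTerm

/-- The weight of the value at the head. -/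
noncomputable def hdWeight : LatticeTerm N → ℝ :=
  Sum.elim (fun _ => (1 / 2) ^ (1 / p)) fun x => V x ^ (1 / p)

/-- The weight of the value at the tail. -/
noncomputable def tlWeight : LatticeTerm N → ℝ :=
  Sum.elim (fun _ => (1 / 2) ^ (1 / p)) fun _ => 0

/-- The head of a term. -/
def head : LatticeTerm N → Fin N → ℤ := Sum.elim (fun d => d.snd) id

/-- The tail of a term. -/
def tail : LatticeTerm N → Fin N → ℤ := Sum.elim (fun d => d.fst) id

/-- The term `½ |u(y) - u(x)| ^ p` attached to a dart. -/
theorem abs_dart_rpow {p : ℝ} (hp : 0 < p) (u : (Fin N → ℤ) → ℝ) (d : (latticeGraph N).Dart) :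
    |hdWeight p V (Sum.inl d) * u (head (Sum.inl d)) -
      tlWeight p (Sum.inl d) * u (tail (Sum.inl d))| ^ p = 1 / 2 * |u d.snd - u d.fst| ^ p := by
  have h : (0 : ℝ) ≤ (1 / 2) ^ (1 / p) := by positivity
  simp only [hdWeight, tlWeight, head, tail, Sum.elim_inl, ← mul_sub]
  rw [abs_mul, abs_of_nonneg h, Real.mul_rpow h (abs_nonneg _), ← Real.rpow_mul (by norm_num),
    one_div_mul_cancel hp.ne', Real.rpow_one]

/-- The term `V(x) |u(x)| ^ p` attached to a vertex. -/
theorem abs_vertex_rpow {p : ℝ} (hp : 0 < p) (hV : ∀ x, 0 ≤ V x) (u : (Fin N → ℤ) → ℝ)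
    (x : Fin N → ℤ) :
    |hdWeight p V (Sum.inr x) * u (head (Sum.inr x)) -
      tlWeight p (Sum.inr x) * u (tail (Sum.inr x))| ^ p = V x * |u x| ^ p := by
  have h : (0 : ℝ) ≤ V x ^ (1 / p) := Real.rpow_nonneg (hV x) _
  simp only [hdWeight, tlWeight, head, tail, Sum.elim_inr, zero_mul, sub_zero, id]
  rw [abs_mul, abs_of_nonneg h, Real.mul_rpow h (abs_nonneg _), ← Real.rpow_mul (hV x),
    one_div_mul_cancel hp.ne', Real.rpow_one]

/-- The darts at `x`, one for each neighbour and orientation, and the vertex `x`. -/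
theorem star_eq (x : Fin N → ℤ) :
    {e : LatticeTerm N | head e = x ∨ tail e = x} =
      (Set.range fun y : (latticeGraph N).neighborSet x => Sum.inl ⟨(x, y.1), y.2⟩) ∪
      (Set.range fun y : (latticeGraph N).neighborSet x => Sum.inl ⟨(y.1, x), y.2.symm⟩) ∪
      {Sum.inr x} := by
  ext e
  rcases e with d | y
  · simp only [head, tail, Set.mem_ofPred_eq, Sum.elim_inl, Set.mem_union, Set.mem_range,
      Sum.inl.injEq, Set.mem_singleton_iff, reduceCtorEq, or_false]
    constructor
    · rintro (h | h)
      · exact Or.inr ⟨⟨d.fst, h ▸ d.adj.symm⟩, by ext <;> simp [← h]⟩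
      · exact Or.inl ⟨⟨d.snd, h ▸ d.adj⟩, by ext <;> simp [← h]⟩
    · rintro (⟨y, rfl⟩ | ⟨y, rfl⟩)
      · exact Or.inr rfl
      · exact Or.inl rfl
  · simp [head, tail]

theorem finite_star (x : Fin N → ℤ) : {e : LatticeTerm N | head e = x ∨ tail e = x}.Finite := by
  rw [star_eq]
  exact ((Set.finite_range _).union (Set.finite_range _)).union (Set.finite_singleton _)

/-- Translation of the terms. -/
def translate (a : Fin N → ℤ) : LatticeTerm N ≃ LatticeTerm N :=
  (dartTranslate a).sumCongr (Equiv.addRight a)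

/-- The Sobolev inequality for the energy. -/
theorem sobolev {p : ℝ} (hp : 2 ≤ p) (hpN : p < N) (u : (Fin N → ℤ) → ℝ)
    (hs : Summable fun e : LatticeTerm N =>
      |hdWeight p V e * u (head e) - tlWeight p e * u (tail e)| ^ p)
    (hu : Summable fun x => |u x| ^ criticalExponent N p) :
    ∑' x, |u x| ^ criticalExponent N p ≤
      ((N * (p * (N - 1) / (N - p) * 2)) ^ criticalExponent N p *
        2 ^ (criticalExponent N p / p)) *
      (∑' e : LatticeTerm N, |hdWeight p V e * u (head e) - tlWeight p e * u (tail e)| ^ p) ^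
        (criticalExponent N p / p) := by
  have hp0 : 0 < p := by linarith
  have hinj : ∀ i : Fin N, Function.Injective fun x => (Sum.inl
      ⟨(x, x + Pi.single i 1), latticeGraph_adj_add_single x i⟩ : LatticeTerm N) := by
    intro i x y h
    exact congrArg tail h
  have heq : ∀ (i : Fin N) x, |u (x + Pi.single i 1) - u x| ^ p =
      2 * |hdWeight p V (Sum.inl ⟨(x, x + Pi.single i 1), latticeGraph_adj_add_single x i⟩) *
        u (head (Sum.inl ⟨(x, x + Pi.single i 1), latticeGraph_adj_add_single x i⟩)) -
      tlWeight p (Sum.inl ⟨(x, x + Pi.single i 1), latticeGraph_adj_add_single x i⟩) *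
        u (tail (Sum.inl ⟨(x, x + Pi.single i 1), latticeGraph_adj_add_single x i⟩))| ^ p := by
    intro i x
    rw [abs_dart_rpow V hp0]
    ring
  -- The factor `2` undoes the weight `1 / 2` of a dart; each direction selects one dart per vertex.
  have h := lattice_sobolev hp hpN hu (fun i => ?_) (fun i => ?_)
    (D := 2 * ∑' e : LatticeTerm N,
      |hdWeight p V e * u (head e) - tlWeight p e * u (tail e)| ^ p)
  · rw [Real.mul_rpow zero_le_two (tsum_nonneg fun _ => by positivity), ← mul_assoc] at h
    exact h
  · simp only [heq]
    exact (hs.comp_injective (hinj i)).mul_left 2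
  · simp only [heq]
    rw [tsum_mul_left]
    exact mul_le_mul_of_nonneg_left
      (tsum_comp_le_tsum_of_inj hs (fun _ => by positivity) (hinj i)) zero_le_two

end LatticeTerm

end Weights

section Equation

variable {N : ℕ} {p : ℝ} {T : ℕ} {V : (Fin N → ℤ) → ℝ} {f : (Fin N → ℤ) → ℝ → ℝ}

theorem lt_criticalExponent (hp : 2 ≤ p) (hpN : p < N) : p < criticalExponent N p := by
  rw [criticalExponent, lt_div_iff₀ (by linarith)]
  nlinarith

open LatticeTerm in
/-- The variational problem of the equation `-Δ_p u + V |u| ^ (p - 2) u = f(x, u)`. -/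
noncomputable def pLaplaceProblem (hp : 2 ≤ p) (hpN : p < N) (hT : 0 < T)
    (hV_periodic : IsPeriodic T V) (hf_periodic : IsPeriodic T f) (hV_nonneg : ∀ x, 0 ≤ V x)
    (hf : ∀ x, IsPMonotone p (f x))
    (hf_zero : ∀ ε > 0, ∃ δ > 0, ∀ x t, 0 < |t| → |t| < δ →
      |f x t| ≤ ε * |t| ^ (criticalExponent N p - 1))
    (hF_superlinear : ∀ M : ℝ, ∃ R : ℝ, ∀ x t, R < |t| →
      M ≤ primitive (f x) t / |t| ^ p) :
    LatticeProblem N (LatticeTerm N) where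
  p := p
  r := criticalExponent N p
  two_le := hp
  p_lt_r := lt_criticalExponent hp hpN
  T := T
  T_pos := hT
  A := hdWeight p V
  B := tlWeight p
  A_nonneg := by
    rintro (d | x)
    · exact Real.rpow_nonneg (by norm_num) _
    · exact Real.rpow_nonneg (hV_nonneg x) _
  B_nonneg := by
    rintro (d | x)
    · exact Real.rpow_nonneg (by norm_num) _
    · exact le_rfl
  B_eq_or := by
    rintro (d | x)
    · exact Or.inl rfl
    · exact Or.inr rfl
  hd := head
  tl := tail
  finite_star := finite_star
  shiftE k := translate ((T : ℤ) • k)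
  hd_shift k e := by rcases e with d | x <;> rfl
  tl_shift k e := by rcases e with d | x <;> rfl
  A_shift k e := by
    rcases e with d | x
    · rfl
    · exact congrArg (· ^ (1 / p)) (hV_periodic.add_smul x k)
  B_shift k e := by rcases e with d | x <;> rfl
  K := (N * (p * (N - 1) / (N - p) * 2)) ^ criticalExponent N p * 2 ^ (criticalExponent N p / p)
  K_nonneg := by
    have h1 : (0 : ℝ) ≤ N - 1 := by linarith
    have h2 : (0 : ℝ) ≤ N - p := by linarith
    positivity
  sobolev := LatticeTerm.sobolev V hp hpN
  f := f
  f_shift := hf_periodic.add_smul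
  f_pm := hf
  f_zero := hf_zero
  F_super := hF_superlinear

theorem abs_mul_rpow_mul_mul {a : ℝ} (ha : 0 ≤ a) (hp : 2 ≤ p) (s : ℝ) :
    |a * s| ^ (p - 2) * (a * s) * a = a ^ p * (|s| ^ (p - 2) * s) := by
  have h : a ^ p = a ^ (p - 2) * a * a := by
    rw [← Real.rpow_add_one' ha (by linarith), ← Real.rpow_add_one' ha (by linarith)]
    congr 1; ring
  rw [abs_mul, abs_of_nonneg ha, Real.mul_rpow ha (abs_nonneg _), h]
  ring

variable {P : LatticeProblem N (LatticeTerm N)}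

open LatticeTerm LatticeProblem

/-- The sum over the star of a vertex, split into darts and the vertex term. -/
theorem LatticeTerm.sum_star (x : Fin N → ℤ) (g : LatticeTerm N → ℝ) :
    ∑ e ∈ (finite_star x).toFinset, g e =
      ∑ y : (latticeGraph N).neighborSet x,
        (g (Sum.inl ⟨(x, y.1), y.2⟩) + g (Sum.inl ⟨(y.1, x), y.2.symm⟩)) + g (Sum.inr x) := by
  classical
  set i₁ : (latticeGraph N).neighborSet x → LatticeTerm N :=
    fun y => Sum.inl ⟨(x, y.1), y.2⟩ with hi₁
  set i₂ : (latticeGraph N).neighborSet x → LatticeTerm N :=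
    fun y => Sum.inl ⟨(y.1, x), y.2.symm⟩ with hi₂
  have hinj₁ : Function.Injective i₁ := fun y z h => Subtype.ext (congrArg head h)
  have hinj₂ : Function.Injective i₂ := fun y z h => Subtype.ext (congrArg tail h)
  have hstar : (finite_star x).toFinset =
      (Finset.univ.image i₁ ∪ Finset.univ.image i₂) ∪ {Sum.inr x} := by
    ext e
    rw [Set.Finite.mem_toFinset, star_eq]
    simp [hi₁, hi₂]
  have hd₁ : Disjoint (Finset.univ.image i₁) (Finset.univ.image i₂) := by
    rw [Finset.disjoint_left]
    intro e he he'
    obtain ⟨y, -, rfl⟩ := Finset.mem_image.1 he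
    obtain ⟨z, -, h⟩ := Finset.mem_image.1 he'
    exact (show (latticeGraph N).Adj x y.1 from y.2).ne (congrArg head h)
  have hd₂ : Disjoint (Finset.univ.image i₁ ∪ Finset.univ.image i₂) {Sum.inr x} := by
    simp [hi₁, hi₂]
  rw [hstar, Finset.sum_union hd₂, Finset.sum_union hd₁, Finset.sum_image hinj₁.injOn,
    Finset.sum_image hinj₂.injOn, Finset.sum_singleton, Finset.sum_add_distrib]

/-- Each edge at `x` enters through its two darts, of weight `1 / 2` each. Their contributions are
equal, which restores the full coefficient in the `p`-Laplacian. -/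
theorem grad_pLaplaceProblem (hp : 2 ≤ p) (hpN : p < N) (hT : 0 < T)
    (hV_periodic : IsPeriodic T V) (hf_periodic : IsPeriodic T f) (hV_nonneg : ∀ x, 0 ≤ V x)
    (hf : ∀ x, IsPMonotone p (f x))
    (hf_zero : ∀ ε > 0, ∃ δ > 0, ∀ x t, 0 < |t| → |t| < δ →
      |f x t| ≤ ε * |t| ^ (criticalExponent N p - 1))
    (hF_superlinear : ∀ M : ℝ, ∃ R : ℝ, ∀ x t, R < |t| →
      M ≤ primitive (f x) t / |t| ^ p) (u : (Fin N → ℤ) → ℝ) (x : Fin N → ℤ) :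
    (pLaplaceProblem hp hpN hT hV_periodic hf_periodic hV_nonneg hf hf_zero hF_superlinear).grad
      u x = -pLaplacian (latticeGraph N) p u x + V x * (|u x| ^ (p - 2) * u x) - f x (u x) := by
  have hp0 : 0 < p := by linarith
  have hhalf : (0 : ℝ) ≤ (1 / 2) ^ (1 / p) := by positivity
  have hhalf_pow : (((1 : ℝ) / 2) ^ (1 / p)) ^ p = 1 / 2 := by
    rw [← Real.rpow_mul (by norm_num), one_div_mul_cancel hp0.ne', Real.rpow_one]
  have hV1 : 0 ≤ V x ^ (1 / p) := Real.rpow_nonneg (hV_nonneg x) _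
  have hV_pow : (V x ^ (1 / p)) ^ p = V x := by
    rw [← Real.rpow_mul (hV_nonneg x), one_div_mul_cancel hp0.ne', Real.rpow_one]
  refine congrArg (· - f x (u x)) ((LatticeTerm.sum_star x _).trans ?_)
  refine congrArg₂ (· + ·) ?_ ?_
  · rw [pLaplacian, ← Finset.sum_neg_distrib]
    refine Eq.trans (Finset.sum_congr rfl fun y _ => ?_) (Finset.sum_set_coe
      (f := fun y => -(|u y - u x| ^ (p - 2) * (u y - u x))) ((latticeGraph N).neighborSet x))
    have hne : y.1 ≠ x := (show (latticeGraph N).Adj x y.1 from y.2).ne'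
    have e1 : delta x y.1 = 0 := delta_of_ne hne
    have e2 : delta x x = 1 := by simp [delta]
    have h := abs_mul_rpow_mul_mul hhalf hp (u y.1 - u x)
    have h' := abs_mul_rpow_mul_mul hhalf hp (u x - u y.1)
    rw [hhalf_pow] at h h'
    rw [abs_sub_comm (u x)] at h'
    simp only [form, pLaplaceProblem, hdWeight, tlWeight, head, tail, Sum.elim_inl, e1, e2,
      ← mul_sub]
    linear_combination -h + h'
  · have e2 : delta x x = 1 := by simp [delta]
    have h := abs_mul_rpow_mul_mul hV1 hp (u x)
    rw [hV_pow] at h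
    simpa only [form, pLaplaceProblem, hdWeight, tlWeight, head, tail, Sum.elim_inr, e2, id,
      zero_mul, sub_zero, mul_one] using h

theorem mem_sobolevSpace_of_adm (hp : 2 ≤ p) (hV_nonneg : ∀ x, 0 ≤ V x) (hPp : P.p = p)
    (hA : P.A = hdWeight p V) (hB : P.B = tlWeight p) (hhd : P.hd = head) (htl : P.tl = tail)
    {u : (Fin N → ℤ) → ℝ} (hu : P.Adm u) : u ∈ sobolevSpace (latticeGraph N) p V := by
  have hp0 : 0 < p := by linarith
  obtain ⟨φ, hfin, hpt, hQ⟩ := hu.exists_approx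
  refine ⟨φ, hfin, hpt, ?_⟩
  have hnorm : ∀ w, P.Adm w → sobolevNorm (latticeGraph N) p V w =
      ENNReal.ofReal (P.Q w) ^ (1 / p) := by
    intro w hw
    have h : ENNReal.ofReal (P.Q w) = ∑' e, ENNReal.ofReal (|P.form e w| ^ P.p) :=
      ENNReal.ofReal_tsum_of_nonneg (fun _ => by positivity) hw.form
    rw [h, sobolevNorm, Summable.tsum_sum ENNReal.summable ENNReal.summable]
    congr 2
    · refine tsum_congr fun d => ?_
      rw [form, hPp, hA, hB, hhd, htl, abs_dart_rpow V hp0]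
    · refine tsum_congr fun x => ?_
      rw [form, hPp, hA, hB, hhd, htl, abs_vertex_rpow V hp0 hV_nonneg]
  have hlim := (ENNReal.tendsto_ofReal hQ).ennrpow_const (1 / p)
  rw [ENNReal.ofReal_zero, ENNReal.zero_rpow_of_pos (by positivity)] at hlim
  exact hlim.congr fun n => (hnorm _ ((Adm.of_finite_support (hfin n)).sub hu)).symm

end Equation

/-! ### Disjoint orbits and the main theorem. -/

theorem geometricallyDistinct_of_forall_ne {N T : ℕ} {u v : (Fin N → ℤ) → ℝ}
    (h : ∀ k : Fin N → ℤ, v ≠ fun x => u (x - (T : ℤ) • k)) : GeometricallyDistinct T u v := by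
  rw [GeometricallyDistinct, Set.disjoint_left]
  rintro w ⟨k, rfl⟩ ⟨l, hl⟩
  refine h (k - l) (funext fun x => ?_)
  have := congrFun hl (x + (T : ℤ) • l)
  simp only [add_sub_cancel_right] at this
  rw [this, smul_sub]
  congr 1
  abel

theorem theorem1p4 (N : ℕ) (p : ℝ) (hp : 2 ≤ p) (hpN : p < N) (T : ℕ) (hT : 0 < T)
    (V : (Fin N → ℤ) → ℝ) (f : (Fin N → ℤ) → ℝ → ℝ)
    (hV_periodic : IsPeriodic T V)
    (hf_periodic : IsPeriodic T f)
    (hV_nonneg : ∀ x, 0 ≤ V x)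
    (hf_cont : ∀ x, Continuous (f x))
    (hf_growth : ∃ a > 0, ∃ q > criticalExponent N p,
      ∀ x t, f x t ≤ a * (1 + |t| ^ (q - 1)))
    (hf_zero : ∀ ε > 0, ∃ δ > 0, ∀ x t, 0 < |t| → |t| < δ →
      |f x t| ≤ ε * |t| ^ (criticalExponent N p - 1))
    (hf_mono : ∀ x, StrictMonoOn (fun t => f x t / |t| ^ (p - 1)) (Set.Iio 0 ∪ Set.Ioi 0))
    (hF_superlinear : ∀ M : ℝ, ∃ R : ℝ, ∀ x t, R < |t| →
      M ≤ (∫ s in (0 : ℝ)..t, f x s) / |t| ^ p)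
    (hf_odd : ∀ x, Function.Odd (f x)) :
    ∃ S : Set ((Fin N → ℤ) → ℝ), S.Infinite ∧
      (∀ u ∈ S, IsSolution (latticeGraph N) p V f u) ∧
      S.Pairwise (GeometricallyDistinct T) := by
  have hf : ∀ x, IsPMonotone p (f x) := fun x => ⟨hf_cont x, hf_odd x, hf_mono x⟩
  have hN : 0 < N := by
    have : (0 : ℝ) < N := by linarith
    exact_mod_cast this
  obtain ⟨S, hS, hcrit, hpair⟩ := (pLaplaceProblem hp hpN hT hV_periodic hf_periodic hV_nonneg hf
    hf_zero hF_superlinear).exists_infinite_critical hN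
  refine ⟨S, hS, fun u hu => ⟨?_, fun x => ?_⟩, fun u hu v hv huv => ?_⟩
  · exact mem_sobolevSpace_of_adm hp hV_nonneg rfl rfl rfl rfl rfl (hcrit u hu).1
  · have h := (hcrit u hu).2 x
    have h' := (grad_pLaplaceProblem hp hpN hT hV_periodic hf_periodic hV_nonneg hf hf_zero
      hF_superlinear u x).symm.trans h
    linarith
  · exact geometricallyDistinct_of_forall_ne (hpair hu hv huv)
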